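/- **Setting.** Let $\Sigma\subset\mathbb R^2$ be a compact convex body whose boundary is a simple closed $C^2$ curve of length $L$ with nowhere vanishing curvature. The origin is the center of mass of $\Sigma$. For $\sigma$ the arc length on $\partial\Sigma$, let $r=r(\sigma)$ be the boundary point and $n=n(\sigma)$ the unit outward normal there. For $\alpha>0$ let $\Sigma_\alpha=\{y: d(y,\Sigma)\le\alpha/2\}$, let $L_\alpha$ be the perimeter of $\Sigma_\alpha$ and $d\sigma_\alpha$ the arc length on $\partial\Sigma_\alpha$; this boundary is described by $r_\alpha=r+\frac\alpha2 n$. Write $x^\perp=(-x_2,x_1)$, let $R_\Theta$ be the rotation of angle $\Theta$, and write $r_\Theta=R_\Theta r$, $n_\Theta=R_\Theta n$, $r_{\alpha,\Theta}=R_\Theta r_\alpha$; $x_-=\max(-x,0)$. Fix $\beta>0$, $I>0$ and $0<\eta<1/6$. The state of the body is $Y=(X,V,\Theta,\Omega)\in\mathbb T^2\times\mathbb R^2\times\mathbb S\times\mathbb R$, where $\mathbb T^2=[0,1]^2$ is periodic and $\mathbb S=\mathbb R/2\pi\mathbb Z$. Put $M_\beta(v)=\frac{\beta}{2\pi}e^{-\beta|v|^2/2}$,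 $M_{\beta,I}(V,\Omega)=\frac{\beta}{2\pi}\big(\frac{\beta I}{2\pi}\big)^{1/2}e^{-\frac\beta2(|V|^2+I\Omega^2)}$ and $\bar M_{\beta,I}=\frac1{2\pi}M_{\beta,I}$. For a collision at $\sigma$ with an atom of velocity $v$, put $A=\alpha^2\big(1+\frac1I(n\cdot r^\perp)^2\big)$, $q=(\alpha V+\alpha\Omega r_\Theta^\perp-v)\cdot n_\Theta$ and $$v'=v+\tfrac{2}{A+1}\,q\,n_\Theta,\qquad V'=V-\tfrac{2}{A+1}\,\alpha q\,n_\Theta,\qquad \Omega'=\Omega-\tfrac{2}{(A+1)I}(n\cdot r^\perp)\,\alpha q,\qquad Y'=(X,V',\Theta,\Omega').$$ Say that $\mathbf{(G)}$ holds for the collision if $$|V'-V|\ge\alpha^{2+\eta},\quad \max\{|V|,|V'|,|\Omega|,|\Omega'|\}\le|\log\alpha|,\quad |v-\alpha V|\ge\alpha^{2/3+\eta},\quad |v'-\alpha V'|\ge\alpha^{2/3+\eta},$$ and that $\mathbf{(R)}$ holds if there is no direct recollision in the backward two-body evolution in the whole plane, that is (in the frame of the center of mass, with lengths and times in units $\varepsilon/\alpha$)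 $$d\big(r_{\alpha,\Theta}-s(\tfrac v\alpha-V),\,R_{\Theta-s\Omega}\Sigma\big)>\tfrac\alpha2\qquad\text{for all } s>0 .$$ For $\varepsilon>0$ consider the linear Boltzmann equation $$\partial_t g_\varepsilon+V\cdot\nabla_Xg_\varepsilon+\tfrac\alpha\varepsilon\Omega\,\partial_\Theta g_\varepsilon=\frac1\alpha\int_{[0,L_\alpha]\times\mathbb R^2}M_\beta(v)\Big(g_\varepsilon(Y')\big((\tfrac1\alpha v'-V'-\Omega'r_\Theta^\perp)\cdot n_\Theta\big)_--g_\varepsilon(Y)\big((\tfrac1\alpha v-V-\Omega r_\Theta^\perp)\cdot n_\Theta\big)_-\Big)d\sigma_\alpha dv$$ and the truncated equation $$\partial_t\tilde g_\varepsilon+V\cdot\nabla_X\tilde g_\varepsilon+\tfrac\alpha\varepsilon\Omega\,\partial_\Theta\tilde g_\varepsilon=\frac1\alpha\int_{[0,L_\alpha]\times\mathbb R^2}M_\beta(v)\Big(\mathbf 1_{(G)}\tilde g_\varepsilon(Y')\big((\tfrac1\alpha v'-V'-\Omega'r_\Theta^\perp)\cdot n_\Theta\big)_--\mathbf 1_{(R)}\tilde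 g_\varepsilon(Y)\big((\tfrac1\alpha v-V-\Omega r_\Theta^\perp)\cdot n_\Theta\big)_-\Big)d\sigma_\alpha dv .$$ Solutions are mild: they are measurable, have $\int_0^T\!\!\int(1+|V|+|\Omega|)M_{\beta,I}|g|\,dY\,dt<\infty$ for every $T$, and satisfy at every time $t\ge0$, for almost every $Y$, the equation integrated along the characteristics of the transport operator (Duhamel formula). **Proposition.** For every $C$ there are $\alpha_0\in(0,1)$, a constant $C_0$ and, for every $T\ge0$, a constant $C_T$, depending only on $\Sigma,\beta,I,\eta,C$ (and $C_T$ also on $T$), such that the following holds for all $0<\alpha\le\alpha_0$ and all $\varepsilon>0$. Let $g_0$ satisfy $\|g_0\|_{L^\infty}\le C$, $\|\nabla g_0\|_{L^\infty}\le C$ and $\int\bar M_{\beta,I}\,g_0\,dY=1$, and let $g_\varepsilon$ and $\tilde g_\varepsilon$ be solutions of the linear Boltzmann equation and of the truncated equation with initial data $g_0$. Then $$\|\tilde g_\varepsilon\|_{L^\infty(\mathbb R^+\times\mathbb T^2\times\mathbb R^2\times\mathbb S\times\mathbb R)}\le C_0$$ and, for every $T\ge0$, $$\|M_{\beta,I}(g_\varepsilon-\tilde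 g_\varepsilon)\|_{L^\infty([0,T];L^1(\mathbb T^2\times\mathbb R^2\times\mathbb S\times\mathbb R))}\le C_T\,\alpha^{2\eta}.$$ -/

import Mathlib

open MeasureTheory Set
open scoped RealInnerProductSpace NNReal ENNReal

namespace RigidBodyGas

noncomputable section

/-- The Euclidean plane. -/
abbrev Plane : Type := EuclideanSpace ℝ (Fin 2)

instance fact_two_pi_pos : Fact (0 < 2 * Real.pi) := ⟨Real.two_pi_pos⟩

/-- The circle of orientations, of total length `2π`. -/
abbrev Orientation : Type := AddCircle (2 * Real.pi)

/-- The states `Y = (X, V, Θ, Ω)` of the rigid body: position on the torus `[0,1]²` with periodic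
boundary conditions, velocity, orientation, (rescaled) angular velocity. The measure `volume` on it
is `dX dV dΘ dΩ`. -/
abbrev Phase : Type := UnitAddTorus (Fin 2) × Plane × Orientation × ℝ

/-- `x^⊥ = (-x₂, x₁)`. -/
def perp (x : Plane) : Plane := !₂[-x 1, x 0]

/-- Cosine and sine on the circle of orientations. -/
def cosO (Θ : Orientation) : ℝ := Real.cos_periodic.lift Θ

def sinO (Θ : Orientation) : ℝ := Real.sin_periodic.lift Θ

/-- The rotation `R_Θ`. -/
def rot (Θ : Orientation) (x : Plane) : Plane :=
  !₂[cosO Θ * x 0 - sinO Θ * x 1, sinO Θ * x 0 + cosO Θ * x 1]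

/-- The normal `-(r')^⊥` along a curve `r`; for a counterclockwise simple curve it points
outwards. -/
def curveNormal (r : ℝ → Plane) (σ : ℝ) : Plane := -perp (deriv r σ)

/-- A planar rigid body `Σ`, in the frame attached to its center of mass (the origin): a compact
convex set whose boundary is a simple closed `C²` curve with nowhere vanishing curvature. The
boundary is parametrized counterclockwise by its arc length `σ`, so that `curveNormal r σ` is the
unit outward normal. -/
structure RigidBody where
  /-- the set `Σ` -/
  carrier : Set Plane
  /-- the perimeter `L` of `Σ` -/
  perimeter : ℝ
  /-- the boundary point of arc length `σ` -/
  r : ℝ → Plane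
  isCompact : IsCompact carrier
  convex : Convex ℝ carrier
  perimeter_pos : 0 < perimeter
  contDiff : ContDiff ℝ 2 r
  periodic : Function.Periodic r perimeter
  injOn : Set.InjOn r (Set.Ico 0 perimeter)
  range_eq : Set.range r = frontier carrier
  unit_speed : ∀ σ, ‖deriv r σ‖ = 1
  outward : ∀ σ, ∀ x ∈ carrier, ⟪x - r σ, curveNormal r σ⟫ ≤ 0
  curvature_pos : ∀ σ, 0 < -⟪deriv (deriv r) σ, curveNormal r σ⟫

/-- The unit outward normal `n` at the boundary point of arc length `σ`. -/
def RigidBody.n (B : RigidBody) (σ : ℝ) : Plane := curveNormal B.r σ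

/-- The point `r_α = r + (α/2) n` of the boundary of the enlarged body
`Σ_α = {y | d(y, Σ) ≤ α/2}`. -/
def RigidBody.rEnlarged (B : RigidBody) (α σ : ℝ) : Plane := B.r σ + (α / 2) • B.n σ

/-- The product `dσ_α dv` of the arc length of `∂Σ_α` and the Lebesgue measure on the velocities of
an atom. The curve `∂Σ_α` is described by `σ ↦ r_α(σ)`, whence `dσ_α = |r_α'(σ)| dσ`. -/
def RigidBody.collisionMeasure (B : RigidBody) (α : ℝ) : Measure (ℝ × Plane) :=
  ((volume.restrict (Set.Ioc 0 B.perimeter)).withDensity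
    (fun σ => ‖deriv (B.rEnlarged α) σ‖ₑ)).prod volume

/-- The Maxwellian `M_β` of the atoms. -/
def maxwellian (β : ℝ) (v : Plane) : ℝ :=
  β / (2 * Real.pi) * Real.exp (-(β / 2) * ‖v‖ ^ 2)

/-- The Maxwellian `M_{β,I}(V, Ω)` of the rigid body, as a function of `Y`. -/
def bodyMaxwellian (β I : ℝ) : Phase → ℝ := fun (_, V, _, Ω) =>
  β / (2 * Real.pi) * Real.sqrt (β * I / (2 * Real.pi)) *
    Real.exp (-(β / 2) * (‖V‖ ^ 2 + I * Ω ^ 2))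

/-- The normal relative velocity `(v/α - V - Ω r_Θ^⊥) · n_Θ` at the contact point. -/
def normalVelocity (B : RigidBody) (α : ℝ) (Θ : Orientation) (σ : ℝ) (v V : Plane) (Ω : ℝ) : ℝ :=
  ⟪α⁻¹ • v - V - Ω • perp (rot Θ (B.r σ)), rot Θ (B.n σ)⟫

/-- `A = α² (1 + (n · r^⊥)² / I)`. -/
def massRatio (B : RigidBody) (α I σ : ℝ) : ℝ :=
  α ^ 2 * (1 + ⟪B.n σ, perp (B.r σ)⟫ ^ 2 / I)

/-- `(αV + αΩ r_Θ^⊥ - v) · n_Θ`. -/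
def normalImpulse (B : RigidBody) (α : ℝ) (Θ : Orientation) (σ : ℝ) (v V : Plane) (Ω : ℝ) : ℝ :=
  ⟪α • V + (α * Ω) • perp (rot Θ (B.r σ)) - v, rot Θ (B.n σ)⟫

/-- The velocity `v'` of the atom after the scattering. -/
def scatAtom (B : RigidBody) (α I : ℝ) (Θ : Orientation) (σ : ℝ) (v V : Plane) (Ω : ℝ) : Plane :=
  v + (2 / (massRatio B α I σ + 1) * normalImpulse B α Θ σ v V Ω) • rot Θ (B.n σ)

/-- The velocity `V'` of the rigid body after the scattering. -/
def scatVel (B : RigidBody) (α I : ℝ) (Θ : Orientation) (σ : ℝ) (v V : Plane) (Ω : ℝ) : Plane :=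
  V - (2 / (massRatio B α I σ + 1) * (α * normalImpulse B α Θ σ v V Ω)) • rot Θ (B.n σ)

/-- The angular velocity `Ω'` of the rigid body after the scattering. -/
def scatAngVel (B : RigidBody) (α I : ℝ) (Θ : Orientation) (σ : ℝ) (v V : Plane) (Ω : ℝ) : ℝ :=
  Ω - 2 / ((massRatio B α I σ + 1) * I) * ⟪B.n σ, perp (B.r σ)⟫ *
    (α * normalImpulse B α Θ σ v V Ω)

/-- The collisional velocities `(v, V, Ω) ↔ (v', V', Ω')` are not pathological:
`|V' - V| ≥ α^{2+η}`, `max(|V|, |V'|, |Ω|, |Ω'|) ≤ |log α|`, `|v - αV| ≥ α^{2/3+η}` and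
`|v' - αV'| ≥ α^{2/3+η}`. -/
def GoodCollision (B : RigidBody) (α I η : ℝ) (Θ : Orientation) (σ : ℝ) (v V : Plane) (Ω : ℝ) :
    Prop :=
  α ^ (2 + η) ≤ ‖scatVel B α I Θ σ v V Ω - V‖ ∧
  (‖V‖ ≤ |Real.log α| ∧ ‖scatVel B α I Θ σ v V Ω‖ ≤ |Real.log α| ∧
    |Ω| ≤ |Real.log α| ∧ |scatAngVel B α I Θ σ v V Ω| ≤ |Real.log α|) ∧
  α ^ (2 / 3 + η) ≤ ‖v - α • V‖ ∧
  α ^ (2 / 3 + η) ≤ ‖scatAtom B α I Θ σ v V Ω - α • scatVel B α I Θ σ v V Ω‖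

/-- There is no direct recollision in the backward two-body evolution (in the whole plane) of the
atom and the rigid body that touch at the point `σ`. Lengths and times are counted in units
`ε/α`, in the frame centered at the center of mass of the body: the body rotates at speed `Ω`, the
center of the atom moves at velocity `v/α - V`, and a contact means that it is at distance `α/2`
from the body. -/
def NoBackwardRecollision (B : RigidBody) (α : ℝ) (Θ : Orientation) (σ : ℝ) (v V : Plane) (Ω : ℝ) :
    Prop :=
  ∀ s : ℝ, 0 < s →
    α / 2 < Metric.infDist (rot Θ (B.rEnlarged α σ) - s • (α⁻¹ • v - V))
      (rot (Θ - ((s * Ω : ℝ) : Orientation)) '' B.carrier)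

/-- The collision operator `ℒ_α` of the linear Boltzmann equation; `max (-x) 0` is the negative part
`x_-`. -/
def boltzmannOp (B : RigidBody) (α β I : ℝ) (g : Phase → ℝ) : Phase → ℝ := fun (X, V, Θ, Ω) =>
  1 / α * ∫ p : ℝ × Plane,
    maxwellian β p.2 *
      (g (X, scatVel B α I Θ p.1 p.2 V Ω, Θ, scatAngVel B α I Θ p.1 p.2 V Ω) *
          max (-normalVelocity B α Θ p.1 (scatAtom B α I Θ p.1 p.2 V Ω)
            (scatVel B α I Θ p.1 p.2 V Ω) (scatAngVel B α I Θ p.1 p.2 V Ω)) 0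
        - g (X, V, Θ, Ω) * max (-normalVelocity B α Θ p.1 p.2 V Ω) 0)
    ∂B.collisionMeasure α

/-- The collision operator of the truncated linear Boltzmann equation. -/
def truncatedBoltzmannOp (B : RigidBody) (α β I η : ℝ) (g : Phase → ℝ) : Phase → ℝ :=
  fun (X, V, Θ, Ω) =>
  1 / α * ∫ p : ℝ × Plane,
    maxwellian β p.2 *
      ({q : ℝ × Plane | GoodCollision B α I η Θ q.1 q.2 V Ω}.indicator 1 p *
          g (X, scatVel B α I Θ p.1 p.2 V Ω, Θ, scatAngVel B α I Θ p.1 p.2 V Ω) *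
          max (-normalVelocity B α Θ p.1 (scatAtom B α I Θ p.1 p.2 V Ω)
            (scatVel B α I Θ p.1 p.2 V Ω) (scatAngVel B α I Θ p.1 p.2 V Ω)) 0
        - {q : ℝ × Plane | NoBackwardRecollision B α Θ q.1 q.2 V Ω}.indicator 1 p *
          g (X, V, Θ, Ω) * max (-normalVelocity B α Θ p.1 p.2 V Ω) 0)
    ∂B.collisionMeasure α

/-- The flow of `V · ∇_X + (α/ε) Ω ∂_Θ`. -/
def freeFlow (α ε t : ℝ) : Phase → Phase := fun (X, V, Θ, Ω) =>
  (X + fun i => ((t * V i : ℝ) : UnitAddCircle), V,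
    Θ + ((t * (α / ε * Ω) : ℝ) : Orientation), Ω)

/-- `g` is a (mild) solution on `[0, ∞)` of `∂ₜg + V · ∇_X g + (α/ε) Ω ∂_Θ g = Q g` with `g(0) = g₀`:
the equation is integrated along the characteristics of the transport operator, and for every `T`
`g` has a finite integral over `[0, T]` against the equilibrium times `1 + |V| + |Ω|`, which is the
growth of the collision rate, so that gain and loss terms converge absolutely almost
everywhere. -/
structure IsMildSolution (α ε β I : ℝ) (Q : (Phase → ℝ) → Phase → ℝ) (g₀ : Phase → ℝ)
    (g : ℝ → Phase → ℝ) : Prop where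
  measurable : Measurable (fun p : ℝ × Phase => g p.1 p.2)
  integrable : ∀ T : ℝ, IntegrableOn
    (fun p : ℝ × Phase => (1 + ‖p.2.2.1‖ + |p.2.2.2.2|) * bodyMaxwellian β I p.2 * g p.1 p.2)
    (Set.Icc 0 T ×ˢ Set.univ)
  duhamel : ∀ t : ℝ, 0 ≤ t → ∀ᵐ Y : Phase,
    g t Y = g₀ (freeFlow α ε (-t) Y) + ∫ s in (0 : ℝ)..t, Q (g s) (freeFlow α ε (s - t) Y)

/-- The admissible initial data: bounded by `C`, with gradient bounded by `C`, and of integral one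
against `M_{β,I} / (2π)`. -/
structure IsInitialDatum (β I : ℝ) (C : ℝ≥0) (g₀ : Phase → ℝ) : Prop where
  bounded : ∀ Y, |g₀ Y| ≤ C
  lipschitz : LipschitzWith C g₀
  integral_eq_one : ∫ Y, 1 / (2 * Real.pi) * bodyMaxwellian β I Y * g₀ Y = 1

end

end RigidBodyGas

open RigidBodyGas

/-! At a fixed contact (X, Θ, σ) the scattering is a linear involution of (v, V, Ω) which conserves
the energy and reverses the normal relative velocity. It therefore preserves both Lebesgue measure
and the product of the two Maxwellians. After multiplication by the body Maxwellian, the gain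
density is the incoming density composed with the scattering
(`bodyMaxwellian_mul_collisionIntegrand`, `measurePreserving_scatter`). Hence the full operator
conserves the total mass of any function. Since (G) is symmetric under scattering, the truncated
gain can also be carried back to incoming collisions.

Both estimates come from one balance law. Along almost every characteristic a mild solution is a
primitive of its source, so the weighted integral of its negative part is driven by the source on
the set where the solution is negative (`negPart_primitive`, `IsTransported.negPart`).

For the uniform bound this is applied to C ± g̃, and two facts make the negative part vanish. The
first is geometric (`exists_noBackwardRecollision`): an incoming atom with |v/α − V| ≥ K|Ω| has not
met the body before. Indeed the body lies in a disc of fixed radius touching it at the contact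
point. Going back in time, the atom leaves that disc to first order, and the second order effect of
the rotation is dominated by the square of the displacement. Under (G) one has |v/α − V| ≥
α^(−1/3+η) and |Ω| ≤ |log α|, so for small α every good incoming collision satisfies (R), and the
restricted loss of a nonnegative function dominates its restricted gain in total mass. The second
fact (`integral_gain_sub_loss_nonpos`) handles constants pointwise in Y: the difference of gain and
loss is bounded by a flux through the closed curve ∂Σ_α weighted by a function of v only, and this
flux vanishes by `integral_normalVelocity`.

For the comparison, g − g̃ solves the full equation with an extra source, namely the removed
collisions acting on the bounded function g̃. Its two signed parts have mass at most
C·T·`truncationError`, which gives a factor 2. The removed collisions lie in four regions. Grazing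
ones cost α^(2η): a strip of width α^(1+η), times the normal velocity α^η, times the prefactor 1/α.
Fast bodies have exponentially small weight in |log α| and cost at most order α. Slow relative
velocities occupy a disc of radius α^(2/3+η) and cost α^(3η) + α^(1/3+2η). Collisions dominated by
the rotation occupy a disc of radius αK|Ω| and cost α. Conditions on the outgoing velocities cost
the same as those on the incoming ones, by invariance of `totalRate`. -/

namespace RigidBodyGas

/-! ### Negative parts of absolutely continuous functions. -/

/-- The negative part of a primitive is the primitive of the negative part. -/
theorem negPart_primitive {φ : ℝ → ℝ} {T : ℝ} (hφ : IntervalIntegrable φ volume 0 T)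
    (y₀ : ℝ) :
    max (-(y₀ + ∫ s in (0 : ℝ)..T, φ s)) 0 =
      max (-y₀) 0 - ∫ s in (0 : ℝ)..T, {s | y₀ + ∫ u in (0 : ℝ)..s, φ u < 0}.indicator φ s := by
  set y : ℝ → ℝ := fun s => y₀ + ∫ u in (0 : ℝ)..s, φ u with hy
  have hac : AbsolutelyContinuousOnInterval y 0 T := by
    have h1 := hφ.absolutelyContinuousOnInterval_intervalIntegral (c := 0) (by simp)
    have h2 : AbsolutelyContinuousOnInterval (fun _ : ℝ => y₀) 0 T :=
      (LipschitzWith.const y₀ |>.lipschitzOnWith).absolutelyContinuousOnInterval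
    exact h2.add h1
  set z : ℝ → ℝ := fun s => max (-(y s)) 0 with hz
  -- The map a ↦ max (−a) 0 is 1-Lipschitz, so the same δ works for `z` as for `y`.
  have hzac : AbsolutelyContinuousOnInterval z 0 T := by
    have hL : ∀ a b : ℝ, dist (max (-a) 0) (max (-b) 0) ≤ dist a b := by
      intro a b
      rw [Real.dist_eq, Real.dist_eq]
      refine (abs_max_sub_max_le_abs _ _ _).trans ?_
      rw [← abs_neg]; ring_nf; rfl
    rw [absolutelyContinuousOnInterval_iff] at hac ⊢
    intro ε hε
    obtain ⟨δ, hδ, h⟩ := hac ε hε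
    refine ⟨δ, hδ, fun E hE hE' => lt_of_le_of_lt ?_ (h E hE hE')⟩
    exact Finset.sum_le_sum fun i _ => hL _ _
  have hftc := hzac.integral_deriv_eq_sub
  have hd := hφ.ae_hasDerivAt_integral
  have hzd := hzac.ae_differentiableAt
  have key : ∫ s in (0 : ℝ)..T, deriv z s = - ∫ s in (0 : ℝ)..T, {s | y s < 0}.indicator φ s := by
    rw [← intervalIntegral.integral_neg]
    refine intervalIntegral.integral_congr_ae ?_
    filter_upwards [hd, hzd] with s hs hs' hsT
    have hmem : s ∈ uIcc 0 T := uIoc_subset_uIcc hsT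
    have hds : HasDerivAt y (φ s) s := (hs hmem 0 (by simp)).const_add y₀
    rcases lt_trichotomy (y s) 0 with h | h | h
    · have : z =ᶠ[nhds s] fun u => -(y u) := by
        filter_upwards [hds.continuousAt.eventually_lt continuousAt_const h] with u hu
        simp [hz, hu.le]
      rw [this.deriv_eq, hds.fun_neg.deriv, indicator_of_mem (by exact h)]
    -- A zero of `y` is a minimum of `z ≥ 0`, which forces the derivative to vanish; no bound on the
    -- size of the zero set is needed.
    · have hmin : IsLocalMin z s := by
        refine Filter.Eventually.of_forall fun u => ?_
        simp [hz, h]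
      rw [hmin.deriv_eq_zero, indicator_of_notMem (by simp [h])]; simp
    · have : z =ᶠ[nhds s] fun u => 0 := by
        filter_upwards [continuousAt_const.eventually_lt hds.continuousAt h] with u hu
        simp [hz, hu.le]
      rw [this.deriv_eq, indicator_of_notMem (by simp [h.le])]; simp
  rw [key] at hftc
  have h0 : z 0 = max (-y₀) 0 := by simp [hz, hy]
  have hTz : z T = max (-(y₀ + ∫ s in (0 : ℝ)..T, φ s)) 0 := rfl
  rw [← h0, ← hTz]
  linarith

/-! ### Plane geometry -/

theorem inner_plane (x y : Plane) : ⟪x, y⟫ = x 0 * y 0 + x 1 * y 1 := by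
  simp [PiLp.inner_apply, Fin.sum_univ_two, mul_comm]

theorem norm_sq_plane (x : Plane) : ‖x‖ ^ 2 = x 0 ^ 2 + x 1 ^ 2 := by
  rw [← real_inner_self_eq_norm_sq, inner_plane]; ring

@[simp] theorem perp_zero_apply (x : Plane) : perp x 0 = -x 1 := by simp [perp]

@[simp] theorem perp_one_apply (x : Plane) : perp x 1 = x 0 := by simp [perp]

@[simp] theorem rot_zero_apply (Θ : Orientation) (x : Plane) :
    rot Θ x 0 = cosO Θ * x 0 - sinO Θ * x 1 := by simp [rot]

@[simp] theorem rot_one_apply (Θ : Orientation) (x : Plane) :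
    rot Θ x 1 = sinO Θ * x 0 + cosO Θ * x 1 := by simp [rot]

theorem plane_ext {x y : Plane} (h0 : x 0 = y 0) (h1 : x 1 = y 1) : x = y := by
  ext i; fin_cases i <;> assumption

@[simp] theorem cosO_coe (t : ℝ) : cosO (t : Orientation) = Real.cos t :=
  Real.cos_periodic.lift_coe t

@[simp] theorem sinO_coe (t : ℝ) : sinO (t : Orientation) = Real.sin t :=
  Real.sin_periodic.lift_coe t

theorem cosO_sq_add_sinO_sq (Θ : Orientation) : cosO Θ ^ 2 + sinO Θ ^ 2 = 1 := by
  induction Θ using QuotientAddGroup.induction_on with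
  | H t => rw [cosO_coe, sinO_coe]; exact Real.cos_sq_add_sin_sq t

theorem cosO_sub_coe (Θ : Orientation) (t : ℝ) :
    cosO (Θ - (t : Orientation)) = cosO Θ * Real.cos t + sinO Θ * Real.sin t := by
  induction Θ using QuotientAddGroup.induction_on with
  | H s => rw [← AddCircle.coe_sub, cosO_coe, cosO_coe, sinO_coe, Real.cos_sub]

theorem sinO_sub_coe (Θ : Orientation) (t : ℝ) :
    sinO (Θ - (t : Orientation)) = sinO Θ * Real.cos t - cosO Θ * Real.sin t := by
  induction Θ using QuotientAddGroup.induction_on with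
  | H s => rw [← AddCircle.coe_sub, sinO_coe, cosO_coe, sinO_coe, Real.sin_sub]

theorem continuous_cosO : Continuous cosO :=
  continuous_quot_lift _ Real.continuous_cos

theorem continuous_sinO : Continuous sinO :=
  continuous_quot_lift _ Real.continuous_sin

theorem inner_rot_rot (Θ : Orientation) (x y : Plane) : ⟪rot Θ x, rot Θ y⟫ = ⟪x, y⟫ := by
  simp only [inner_plane, rot_zero_apply, rot_one_apply]
  linear_combination (x 0 * y 0 + x 1 * y 1) * cosO_sq_add_sinO_sq Θ

theorem norm_rot (Θ : Orientation) (x : Plane) : ‖rot Θ x‖ = ‖x‖ := by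
  rw [← sq_eq_sq₀ (norm_nonneg _) (norm_nonneg _), ← real_inner_self_eq_norm_sq,
    ← real_inner_self_eq_norm_sq, inner_rot_rot]

theorem perp_rot (Θ : Orientation) (x : Plane) : perp (rot Θ x) = rot Θ (perp x) := by
  apply plane_ext <;> simp <;> ring

theorem rot_sub (Θ : Orientation) (x y : Plane) : rot Θ (x - y) = rot Θ x - rot Θ y := by
  apply plane_ext <;> simp <;> ring

theorem rot_add (Θ : Orientation) (x y : Plane) : rot Θ (x + y) = rot Θ x + rot Θ y := by
  apply plane_ext <;> simp <;> ring

theorem rot_smul (Θ : Orientation) (a : ℝ) (x : Plane) : rot Θ (a • x) = a • rot Θ x := by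
  apply plane_ext <;> simp <;> ring

theorem inner_perp_perp (x y : Plane) : ⟪perp x, perp y⟫ = ⟪x, y⟫ := by
  simp [inner_plane]; ring

theorem norm_perp (x : Plane) : ‖perp x‖ = ‖x‖ := by
  rw [← sq_eq_sq₀ (norm_nonneg _) (norm_nonneg _), norm_sq_plane, norm_sq_plane]
  simp; ring

theorem inner_perp_self (x : Plane) : ⟪perp x, x⟫ = 0 := by
  simp [inner_plane]; ring

theorem rot_sub_coe (Θ : Orientation) (t : ℝ) (x : Plane) :
    rot (Θ - (t : Orientation)) x = Real.cos t • rot Θ x - Real.sin t • perp (rot Θ x) := by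
  apply plane_ext <;> simp [cosO_sub_coe, sinO_sub_coe] <;> ring

/-- `x ↦ x^⊥` as a continuous linear map. -/
noncomputable def perpCLM : Plane →L[ℝ] Plane :=
  LinearMap.toContinuousLinearMap
    { toFun := perp
      map_add' := fun x y => by apply plane_ext <;> simp; ring
      map_smul' := fun a x => by apply plane_ext <;> simp }

@[simp] theorem perpCLM_apply (x : Plane) : perpCLM x = perp x := rfl

/-! ### The boundary curve -/

namespace RigidBody

variable (B : RigidBody)

/-- The unit tangent vector. -/
noncomputable def tangent (σ : ℝ) : Plane := deriv B.r σ

/-- The curvature of the boundary. -/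
noncomputable def curvature (σ : ℝ) : ℝ := -⟪deriv B.tangent σ, B.n σ⟫

theorem n_eq (σ : ℝ) : B.n σ = -perp (B.tangent σ) := rfl

theorem curvature_pos' (σ : ℝ) : 0 < B.curvature σ := B.curvature_pos σ

theorem norm_tangent (σ : ℝ) : ‖B.tangent σ‖ = 1 := B.unit_speed σ

theorem norm_n (σ : ℝ) : ‖B.n σ‖ = 1 := by rw [n_eq, norm_neg, norm_perp, norm_tangent]

theorem hasDerivAt_r (σ : ℝ) : HasDerivAt B.r (B.tangent σ) σ :=
  (B.contDiff.differentiable (by norm_num) σ).hasDerivAt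

theorem contDiff_tangent : ContDiff ℝ 1 B.tangent := by
  have := B.contDiff
  rw [show (2 : WithTop ℕ∞) = 1 + 1 by norm_num] at this
  exact (contDiff_succ_iff_deriv.1 this).2.2

theorem hasDerivAt_tangent' (σ : ℝ) : HasDerivAt B.tangent (deriv B.tangent σ) σ :=
  (B.contDiff_tangent.differentiable (by norm_num) σ).hasDerivAt

theorem continuous_r : Continuous B.r := B.contDiff.continuous

theorem continuous_tangent : Continuous B.tangent := B.contDiff_tangent.continuous

theorem continuous_n : Continuous B.n := by
  have : B.n = fun σ => -perpCLM (B.tangent σ) := by ext1 σ; rw [n_eq, perpCLM_apply]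
  rw [this]
  exact (perpCLM.continuous.comp B.continuous_tangent).neg

theorem continuous_curvature : Continuous B.curvature :=
  ((B.contDiff_tangent.continuous_deriv le_rfl).inner B.continuous_n).neg

/-- Frenet formula: unit speed makes the second derivative orthogonal to the tangent, hence parallel
to the normal. -/
theorem deriv_tangent (σ : ℝ) : deriv B.tangent σ = -B.curvature σ • B.n σ := by
  have h0 : ⟪deriv B.tangent σ, B.tangent σ⟫ = 0 := by
    have h1 : HasDerivAt (fun s => ⟪B.tangent s, B.tangent s⟫)
        (⟪B.tangent σ, deriv B.tangent σ⟫ + ⟪deriv B.tangent σ, B.tangent σ⟫) σ :=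
      (B.hasDerivAt_tangent' σ).inner ℝ (B.hasDerivAt_tangent' σ)
    have h2 : (fun s => ⟪B.tangent s, B.tangent s⟫) = fun _ => (1 : ℝ) := by
      ext1 s; rw [real_inner_self_eq_norm_sq, norm_tangent]; norm_num
    rw [h2] at h1
    have h3 := h1.unique (hasDerivAt_const σ (1 : ℝ))
    rw [real_inner_comm] at h3; linarith
  have h1 : B.tangent σ 0 ^ 2 + B.tangent σ 1 ^ 2 = 1 := by
    rw [← norm_sq_plane, norm_tangent]; norm_num
  rw [inner_plane] at h0
  have hk : B.curvature σ = -(deriv B.tangent σ 0 * B.tangent σ 1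
      - deriv B.tangent σ 1 * B.tangent σ 0) := by
    rw [curvature, n_eq, inner_plane]; simp; ring
  rw [hk, n_eq]
  apply plane_ext <;> simp
  · linear_combination (-deriv B.tangent σ 0) * h1 + B.tangent σ 0 * h0
  · linear_combination (-deriv B.tangent σ 1) * h1 + B.tangent σ 1 * h0

theorem hasDerivAt_tangent (σ : ℝ) :
    HasDerivAt B.tangent (-B.curvature σ • B.n σ) σ :=
  B.deriv_tangent σ ▸ B.hasDerivAt_tangent' σ

theorem hasDerivAt_n (σ : ℝ) : HasDerivAt B.n (B.curvature σ • B.tangent σ) σ := by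
  have h := (perpCLM.hasFDerivAt.comp_hasDerivAt σ (B.hasDerivAt_tangent σ)).neg
  have h1 : -(perpCLM (-B.curvature σ • B.n σ)) = B.curvature σ • B.tangent σ := by
    rw [n_eq]; apply plane_ext <;> simp
  rw [h1] at h
  exact h

theorem hasDerivAt_rEnlarged (α σ : ℝ) :
    HasDerivAt (B.rEnlarged α) ((1 + α / 2 * B.curvature σ) • B.tangent σ) σ := by
  have h := (B.hasDerivAt_r σ).add ((B.hasDerivAt_n σ).const_smul (α / 2))
  rw [smul_smul] at h
  rw [add_smul, one_smul]
  exact h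

theorem inner_tangent_n (σ : ℝ) : ⟪B.tangent σ, B.n σ⟫ = 0 := by
  rw [n_eq, inner_neg_right, real_inner_comm, inner_perp_self, neg_zero]

theorem periodic_tangent : Function.Periodic B.tangent B.perimeter := by
  intro σ
  have h : (fun s => B.r (s + B.perimeter)) = B.r := funext B.periodic
  rw [tangent, tangent, ← deriv_comp_add_const, h]

theorem periodic_n : Function.Periodic B.n B.perimeter := fun σ => by
  rw [n_eq, n_eq, B.periodic_tangent]

theorem periodic_curvature : Function.Periodic B.curvature B.perimeter := by
  intro σ
  have h : (fun s => B.tangent (s + B.perimeter)) = B.tangent := funext B.periodic_tangent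
  rw [curvature, curvature, B.periodic_n, ← deriv_comp_add_const, h]

theorem exists_curvature_bounds :
    ∃ k K : ℝ, 0 < k ∧ ∀ σ, k ≤ B.curvature σ ∧ B.curvature σ ≤ K := by
  have hne : (Icc 0 B.perimeter).Nonempty := ⟨0, by simp [B.perimeter_pos.le]⟩
  obtain ⟨a, -, hmin⟩ := isCompact_Icc.exists_isMinOn hne B.continuous_curvature.continuousOn
  obtain ⟨b, -, hmax⟩ := isCompact_Icc.exists_isMaxOn hne B.continuous_curvature.continuousOn
  refine ⟨B.curvature a, B.curvature b, B.curvature_pos' a, fun σ => ?_⟩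
  obtain ⟨s, hs, h⟩ := B.periodic_curvature.exists_mem_Ico₀ B.perimeter_pos σ
  rw [h]
  exact ⟨hmin (Ico_subset_Icc_self hs), hmax (Ico_subset_Icc_self hs)⟩

theorem r_mem (σ : ℝ) : B.r σ ∈ B.carrier := by
  have h : B.r σ ∈ frontier B.carrier := B.range_eq ▸ mem_range_self σ
  exact B.isCompact.isClosed.frontier_subset h

theorem exists_norm_bound : ∃ D : ℝ, 0 < D ∧ ∀ x ∈ B.carrier, ‖x‖ ≤ D :=
  let ⟨D, hD, h⟩ := B.isCompact.isBounded.exists_pos_norm_le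
  ⟨D, hD, h⟩

/-- Quantitative strict convexity. -/
theorem half_curvature_mul_sq_le {k : ℝ} (hk : ∀ σ, k ≤ B.curvature σ) {x : Plane}
    (hx : x ∈ B.carrier) (σ : ℝ) :
    k / 2 * ⟪x - B.r σ, B.tangent σ⟫ ^ 2 ≤ ⟪B.r σ - x, B.n σ⟫ := by
  -- The Frenet equations give G' = κH and H' = −κG − 1. As G ≤ 0, H decreases at speed at most 1.
  set G : ℝ → ℝ := fun t => ⟪x - B.r t, B.n t⟫ with hG
  set H : ℝ → ℝ := fun t => ⟪x - B.r t, B.tangent t⟫ with hH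
  have hG0 : ∀ t, G t ≤ 0 := fun t => B.outward t x hx
  have hx' : ∀ t, HasDerivAt (fun t => x - B.r t) (-B.tangent t) t := fun t =>
    (B.hasDerivAt_r t).const_sub x
  have hdG : ∀ t, HasDerivAt G (B.curvature t * H t) t := by
    intro t
    have h := (hx' t).inner ℝ (B.hasDerivAt_n t)
    rw [inner_smul_right, inner_neg_left, inner_tangent_n, neg_zero, add_zero] at h
    exact h
  have hdH : ∀ t, HasDerivAt H (-B.curvature t * G t - 1) t := by
    intro t
    have h := (hx' t).inner ℝ (B.hasDerivAt_tangent t)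
    rw [inner_smul_right, inner_neg_left, real_inner_self_eq_norm_sq, norm_tangent] at h
    refine h.congr_deriv ?_
    simp only [hG]; ring
  have hmono : Monotone fun t => H t + t := by
    refine monotone_of_deriv_nonneg (fun t => ((hdH t).add (hasDerivAt_id t)).differentiableAt)
      fun t => ?_
    have h := ((hdH t).add (hasDerivAt_id t)).deriv
    have h' : deriv (fun t => H t + t) t = -B.curvature t * G t - 1 + 1 := h
    rw [h']
    nlinarith [hG0 t, B.curvature_pos' t]
  set a := H σ with ha
  -- Between σ and σ + a, H stays beyond the line a − (t − σ), on the side of the sign of a.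
  -- Integrating κH from σ to σ + a thus raises G by at least k a²/2, while G remains nonpositive at
  -- the end.
  set Φ : ℝ → ℝ := fun t => G t - k * (a * (t - σ) - (t - σ) ^ 2 / 2) with hΦ
  have hdΦ : ∀ t, HasDerivAt Φ (B.curvature t * H t - k * (a - (t - σ))) t := by
    intro t
    have h1 : HasDerivAt (fun t => t - σ) 1 t := (hasDerivAt_id t).sub_const σ
    have h2 := ((h1.const_mul a).sub ((h1.pow 2).div_const 2)).const_mul k
    refine ((hdG t).sub h2).congr_deriv ?_
    norm_num
  have hcont : Continuous Φ := continuous_iff_continuousAt.2 fun t => (hdΦ t).continuousAt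
  have hend : Φ σ ≤ Φ (σ + a) := by
    rcases le_total 0 a with h0 | h0
    · have : MonotoneOn Φ (Icc σ (σ + a)) := by
        refine monotoneOn_of_deriv_nonneg (convex_Icc _ _) hcont.continuousOn
          (fun t _ => (hdΦ t).differentiableAt.differentiableWithinAt) fun t ht => ?_
        rw [interior_Icc] at ht
        rw [(hdΦ t).deriv]
        have h1 : H σ + σ ≤ H t + t := hmono ht.1.le
        have h2 : 0 ≤ a - (t - σ) := by linarith [ht.2]
        nlinarith [hk t, B.curvature_pos' t]
      exact this (left_mem_Icc.2 (by linarith)) (right_mem_Icc.2 (by linarith)) (by linarith)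
    · have : AntitoneOn Φ (Icc (σ + a) σ) := by
        refine antitoneOn_of_deriv_nonpos (convex_Icc _ _) hcont.continuousOn
          (fun t _ => (hdΦ t).differentiableAt.differentiableWithinAt) fun t ht => ?_
        rw [interior_Icc] at ht
        rw [(hdΦ t).deriv]
        have h1 : H t + t ≤ H σ + σ := hmono ht.2.le
        have h2 : a - (t - σ) ≤ 0 := by linarith [ht.1]
        nlinarith [hk t, B.curvature_pos' t]
      exact this (left_mem_Icc.2 (by linarith)) (right_mem_Icc.2 (by linarith)) (by linarith)
  have e1 : Φ σ = G σ := by simp [hΦ]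
  have e2 : Φ (σ + a) = G (σ + a) - k / 2 * a ^ 2 := by simp [hΦ]; ring
  have e3 : ⟪B.r σ - x, B.n σ⟫ = -G σ := by
    rw [hG, ← neg_sub x, inner_neg_left]
  rw [e3]
  have := hG0 (σ + a)
  linarith

theorem norm_sq_eq_tangent_n (σ : ℝ) (y : Plane) :
    ‖y‖ ^ 2 = ⟪y, B.tangent σ⟫ ^ 2 + ⟪y, B.n σ⟫ ^ 2 := by
  have h1 : B.tangent σ 0 ^ 2 + B.tangent σ 1 ^ 2 = 1 := by
    rw [← norm_sq_plane, norm_tangent]; norm_num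
  rw [n_eq, inner_plane, inner_plane, norm_sq_plane]
  simp
  linear_combination (-(y 0 ^ 2 + y 1 ^ 2)) * h1

/-- A disc of fixed radius, tangent to the boundary from inside at an arbitrary point, contains the
body. -/
theorem exists_enclosing_disc : ∃ ρ : ℝ, 0 < ρ ∧ ∀ σ, ∀ x ∈ B.carrier,
    ‖x - (B.r σ - ρ • B.n σ)‖ ≤ ρ := by
  obtain ⟨k, _, hk0, hk⟩ := B.exists_curvature_bounds
  obtain ⟨D, hD0, hD⟩ := B.exists_norm_bound
  -- With tangential coordinate a and depth b, the claim reads a² + b² ≤ 2ρb. The term 1/k pays for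
  -- a² ≤ (2/k) b, and D pays for b² ≤ 2D b.
  refine ⟨1 / k + D, by positivity, fun σ x hx => ?_⟩
  set ρ := 1 / k + D with hρ
  have hρ0 : 0 < ρ := by positivity
  refine le_of_sq_le_sq ?_ hρ0.le
  set b := ⟪B.r σ - x, B.n σ⟫ with hb
  have h1 := B.half_curvature_mul_sq_le (fun σ => (hk σ).1) hx σ
  have hb' : ⟪x - B.r σ, B.n σ⟫ = -b := by rw [hb, ← neg_sub x, inner_neg_left, neg_neg]
  have hb0 : 0 ≤ b := by rw [hb]; exact le_trans (by positivity) h1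
  have hb2 : b ≤ 2 * D := by
    calc b ≤ ‖B.r σ - x‖ * ‖B.n σ‖ := real_inner_le_norm _ _
      _ = ‖B.r σ - x‖ := by rw [norm_n, mul_one]
      _ ≤ ‖B.r σ‖ + ‖x‖ := norm_sub_le _ _
      _ ≤ 2 * D := by linarith [hD x hx, hD _ (B.r_mem σ)]
  have h2 := B.norm_sq_eq_tangent_n σ (x - (B.r σ - ρ • B.n σ))
  have e : x - (B.r σ - ρ • B.n σ) = (x - B.r σ) + ρ • B.n σ := by abel
  rw [e, inner_add_left, inner_add_left, inner_smul_left, inner_smul_left,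
    real_inner_self_eq_norm_sq, norm_n, real_inner_comm (B.tangent σ) (B.n σ),
    inner_tangent_n, hb'] at h2
  rw [e, h2]
  simp only [conj_trivial]
  set a := ⟪x - B.r σ, B.tangent σ⟫
  have h3 : a ^ 2 ≤ 2 / k * b := by
    rw [div_mul_eq_mul_div, le_div_iff₀ hk0]; nlinarith
  have h4 : 2 * ρ * b = 2 / k * b + 2 * D * b := by rw [hρ]; ring
  nlinarith

end RigidBody

/-! ### Absence of recollisions -/

/-- A quadratic remainder valid for all angles spares any restriction on the elapsed time: the
Taylor bound serves for |x| ≤ 2, the trivial bound 2|x| beyond. -/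
theorem abs_sub_sin_le_sq (x : ℝ) : |x - Real.sin x| ≤ x ^ 2 := by
  have h1 := Real.abs_sub_sin_le x
  have h2 : |x - Real.sin x| ≤ 2 * |x| := by
    calc |x - Real.sin x| ≤ |x| + |Real.sin x| := abs_sub _ _
      _ ≤ 2 * |x| := by linarith [Real.abs_sin_le_abs (x := x)]
  have h0 := abs_nonneg x
  rw [← sq_abs x]
  rcases le_total |x| 2 with h | h
  · nlinarith [mul_nonneg h0 (sub_nonneg.2 h), sq_nonneg |x|,
      mul_nonneg (mul_nonneg h0 h0) (sub_nonneg.2 h)]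
  · nlinarith

/-- An incoming atom whose relative velocity dominates the angular velocity of the body has not met
the body before. -/
theorem exists_noBackwardRecollision (B : RigidBody) : ∃ K : ℝ, 0 < K ∧
    ∀ (α : ℝ), 0 < α → α ≤ 1 → ∀ (Θ : Orientation) (σ : ℝ) (v V : Plane) (Ω : ℝ),
      normalVelocity B α Θ σ v V Ω < 0 → K * |Ω| ≤ ‖α⁻¹ • v - V‖ →
      NoBackwardRecollision B α Θ σ v V Ω := by
  obtain ⟨ρ, hρ0, hρ⟩ := B.exists_enclosing_disc
  obtain ⟨D, hD0, hD⟩ := B.exists_norm_bound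
  -- The summand D + ρ compensates the rotation of the centre of the disc. The rest leaves a
  -- displacement large compared with |ψ|, whose square absorbs the second order error.
  refine ⟨(D + ρ) + 3 * (ρ + 1 + (D + ρ)), by positivity, ?_⟩
  intro α hα hα1 Θ σ v V Ω hnv hK s hs
  set u : Plane := α⁻¹ • v - V with hu
  set ψ : ℝ := s * Ω with hψ
  set p : Plane := B.r σ - ρ • B.n σ with hp
  set P : Plane := rot Θ p with hP
  set N : Plane := rot Θ (B.n σ) with hN
  set ρ' : ℝ := ρ + α / 2 with hρ'
  set W : Plane := ((1 - Real.cos ψ) • P + Real.sin ψ • perp P) - s • u with hW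
  have hN1 : ‖N‖ = 1 := by rw [hN, norm_rot, B.norm_n]
  have hPn : ‖P‖ ≤ D + ρ := by
    rw [hP, norm_rot, hp]
    calc ‖B.r σ - ρ • B.n σ‖ ≤ ‖B.r σ‖ + ‖ρ • B.n σ‖ := norm_sub_le _ _
      _ ≤ D + ρ := by
        rw [norm_smul, B.norm_n, Real.norm_of_nonneg hρ0.le, mul_one]
        linarith [hD _ (B.r_mem σ)]
  -- Vector from the centre of the rotated disc to the atom: initially ρ'N, then displaced by W.
  have hcen : rot Θ (B.rEnlarged α σ) - s • u - rot (Θ - (ψ : Orientation)) p = ρ' • N + W := by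
    rw [rot_sub_coe, ← hP]
    have : rot Θ (B.rEnlarged α σ) = P + ρ' • N := by
      rw [hP, hN, ← rot_smul, ← rot_add, hp, hρ', RigidBody.rEnlarged, add_smul]
      congr 1; abel
    rw [this, hW, sub_smul, one_smul]; abel
  have hdisp : ‖(1 - Real.cos ψ) • P + Real.sin ψ • perp P‖ ≤ |ψ| * ‖P‖ := by
    refine le_of_sq_le_sq ?_ (by positivity)
    have h1 : ‖(1 - Real.cos ψ) • P + Real.sin ψ • perp P‖ ^ 2 = (2 - 2 * Real.cos ψ) * ‖P‖ ^ 2 := by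
      rw [norm_sq_plane, norm_sq_plane]; simp
      linear_combination (P 0 ^ 2 + P 1 ^ 2) * Real.cos_sq_add_sin_sq ψ
    rw [h1, mul_pow, sq_abs]
    have := Real.one_sub_sq_div_two_le_cos (x := ψ)
    gcongr; linarith
  have hWn : 3 * (ρ + 1 + (D + ρ)) * |ψ| ≤ ‖W‖ := by
    have h1 : s * ‖u‖ - |ψ| * ‖P‖ ≤ ‖W‖ := by
      have h2 : ‖s • u‖ - ‖(1 - Real.cos ψ) • P + Real.sin ψ • perp P‖ ≤ ‖W‖ := by
        rw [hW, norm_sub_rev]; exact norm_sub_norm_le _ _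
      rw [norm_smul, Real.norm_of_nonneg hs.le] at h2
      linarith
    have h3 : ((D + ρ) + 3 * (ρ + 1 + (D + ρ))) * |ψ| ≤ s * ‖u‖ := by
      rw [hψ, abs_mul, abs_of_pos hs]
      nlinarith
    have h4 : |ψ| * ‖P‖ ≤ (D + ρ) * |ψ| := by
      rw [mul_comm]; gcongr
    linarith
  -- The first order part of ⟨N, W⟩ is exactly −s times the normal velocity, which is positive.
  -- Replacing r by the disc centre p does not change it, since they differ along the normal and N^⊥
  -- is orthogonal to N.
  have hNW : -(3 / 2 * ψ ^ 2 * (D + ρ)) < ⟪N, W⟫ := by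
    have hnv' : normalVelocity B α Θ σ v V Ω = ⟪N, u⟫ - Ω * ⟪N, perp P⟫ := by
      rw [normalVelocity, ← hu, ← hN, real_inner_comm, inner_sub_right, inner_smul_right]
      have : rot Θ (B.r σ) = P + ρ • N := by
        rw [hP, hN, ← rot_smul, ← rot_add, hp]; congr 1; abel
      have h2 : perp (P + ρ • N) = perp P + ρ • perp N := by
        apply plane_ext <;> simp; ring
      rw [this, h2, inner_add_right, inner_smul_right, real_inner_comm (perp N) N,
        inner_perp_self]
      ring
    have h1 : ⟪N, W⟫ = (1 - Real.cos ψ) * ⟪N, P⟫ + (Real.sin ψ - ψ) * ⟪N, perp P⟫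
        - s * normalVelocity B α Θ σ v V Ω := by
      rw [hnv', hW, inner_sub_right, inner_add_right, inner_smul_right, inner_smul_right,
        inner_smul_right, hψ]
      ring
    have b1 : |⟪N, P⟫| ≤ D + ρ := by
      calc |⟪N, P⟫| ≤ ‖N‖ * ‖P‖ := abs_real_inner_le_norm _ _
        _ ≤ D + ρ := by rw [hN1, one_mul]; exact hPn
    have b2 : |⟪N, perp P⟫| ≤ D + ρ := by
      calc |⟪N, perp P⟫| ≤ ‖N‖ * ‖perp P‖ := abs_real_inner_le_norm _ _
        _ ≤ D + ρ := by rw [hN1, one_mul, norm_perp]; exact hPn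
    have c1 : |(1 - Real.cos ψ) * ⟪N, P⟫| ≤ ψ ^ 2 / 2 * (D + ρ) := by
      rw [abs_mul]
      have : |1 - Real.cos ψ| ≤ ψ ^ 2 / 2 := by
        rw [abs_of_nonneg (by linarith [Real.cos_le_one ψ])]
        linarith [Real.one_sub_sq_div_two_le_cos (x := ψ)]
      gcongr
    have c2 : |(Real.sin ψ - ψ) * ⟪N, perp P⟫| ≤ ψ ^ 2 * (D + ρ) := by
      rw [abs_mul, abs_sub_comm]
      gcongr
      exact abs_sub_sin_le_sq ψ
    have c3 : 0 < -(s * normalVelocity B α Θ σ v V Ω) := by nlinarith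
    rw [h1]
    linarith [neg_abs_le ((1 - Real.cos ψ) * ⟪N, P⟫),
      neg_abs_le ((Real.sin ψ - ψ) * ⟪N, perp P⟫)]
  have hρ'0 : 0 < ρ' := by positivity
  have hρ'1 : ρ' ≤ ρ + 1 := by rw [hρ']; linarith
  -- In ρ'² + 2ρ'⟨N, W⟩ + |W|² the negative contribution is at most 3ρ'(D + ρ)ψ², which |W|² covers.
  -- Strictness comes from ⟨N, W⟩, so ψ = 0 is included.
  have hdist : ρ' < ‖ρ' • N + W‖ := by
    refine lt_of_pow_lt_pow_left₀ 2 (norm_nonneg _) ?_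
    rw [norm_add_sq_real, norm_smul, hN1, inner_smul_left, Real.norm_of_nonneg hρ'0.le]
    simp only [conj_trivial, mul_one]
    have h1 : (3 * (ρ + 1 + (D + ρ)) * |ψ|) ^ 2 ≤ ‖W‖ ^ 2 := by gcongr
    rw [mul_pow, sq_abs] at h1
    have h2 : 2 * (ρ' * -(3 / 2 * ψ ^ 2 * (D + ρ))) < 2 * (ρ' * ⟪N, W⟫) := by gcongr
    have h3 : 3 * ρ' * (D + ρ) ≤ (3 * (ρ + 1 + (D + ρ))) ^ 2 := by
      have : 3 * ρ' * (D + ρ) ≤ 3 * (ρ + 1) * (D + ρ) := by gcongr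
      nlinarith [mul_pos hD0 hρ0, mul_pos hρ0 hρ0, mul_pos hD0 hD0]
    nlinarith [mul_le_mul_of_nonneg_right h3 (sq_nonneg ψ)]
  have hlow : ‖ρ' • N + W‖ - ρ ≤ Metric.infDist (rot Θ (B.rEnlarged α σ) - s • u)
      (rot (Θ - (ψ : Orientation)) '' B.carrier) := by
    refine (Metric.le_infDist ⟨_, mem_image_of_mem _ (B.r_mem 0)⟩).2 ?_
    rintro _ ⟨x, hx, rfl⟩
    have h1 := dist_triangle_right (rot Θ (B.rEnlarged α σ) - s • u)
      (rot (Θ - (ψ : Orientation)) p) (rot (Θ - (ψ : Orientation)) x)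
    rw [dist_eq_norm _ (rot (Θ - (ψ : Orientation)) p), hcen,
      dist_eq_norm (rot (Θ - (ψ : Orientation)) p), ← rot_sub, norm_rot, norm_sub_rev] at h1
    linarith [hρ σ x hx]
  refine lt_of_lt_of_le ?_ hlow
  rw [hρ'] at hdist
  linarith

/-! ### Continuity and measurability of the collision parameters -/

theorem rot_eq (Θ : Orientation) (x : Plane) : rot Θ x = cosO Θ • x + sinO Θ • perp x := by
  apply plane_ext <;> simp <;> ring

@[fun_prop]
theorem continuous_perp : Continuous perp := perpCLM.continuous

attribute [fun_prop] continuous_cosO continuous_sinO RigidBody.continuous_r RigidBody.continuous_n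
  RigidBody.continuous_curvature RigidBody.continuous_tangent

theorem continuous_rot : Continuous fun q : Orientation × Plane => rot q.1 q.2 := by
  simp only [rot_eq]
  fun_prop

@[fun_prop]
theorem _root_.Continuous.rot {X : Type*} [TopologicalSpace X] {f : X → Orientation}
    {g : X → Plane} (hf : Continuous f) (hg : Continuous g) :
    Continuous fun x => RigidBodyGas.rot (f x) (g x) :=
  continuous_rot.comp (hf.prodMk hg)

theorem RigidBody.continuous_rEnlarged (B : RigidBody) (α : ℝ) : Continuous (B.rEnlarged α) := by
  unfold RigidBody.rEnlarged
  fun_prop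

/-- The normal velocity as a function of the state of the body and of the collision parameters. -/
noncomputable def normalVel (B : RigidBody) (α : ℝ) (w : Phase × ℝ × Plane) : ℝ :=
  normalVelocity B α w.1.2.2.1 w.2.1 w.2.2 w.1.2.1 w.1.2.2.2

/-- The scattering, as a map on the states of the body and the collision parameters. -/
noncomputable def scatter (B : RigidBody) (α I : ℝ) (w : Phase × ℝ × Plane) : Phase × ℝ × Plane :=
  ((w.1.1, scatVel B α I w.1.2.2.1 w.2.1 w.2.2 w.1.2.1 w.1.2.2.2, w.1.2.2.1,
    scatAngVel B α I w.1.2.2.1 w.2.1 w.2.2 w.1.2.1 w.1.2.2.2),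
    w.2.1, scatAtom B α I w.1.2.2.1 w.2.1 w.2.2 w.1.2.1 w.1.2.2.2)

section Continuity

variable (B : RigidBody) (α I : ℝ)

theorem continuous_normalVelocity :
    Continuous fun x : Orientation × ℝ × Plane × Plane × ℝ =>
      normalVelocity B α x.1 x.2.1 x.2.2.1 x.2.2.2.1 x.2.2.2.2 := by
  unfold normalVelocity
  fun_prop

theorem continuous_normalImpulse :
    Continuous fun x : Orientation × ℝ × Plane × Plane × ℝ =>
      normalImpulse B α x.1 x.2.1 x.2.2.1 x.2.2.2.1 x.2.2.2.2 := by
  unfold normalImpulse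
  fun_prop

theorem continuous_massRatio : Continuous (massRatio B α I) := by
  unfold massRatio
  fun_prop

theorem measurable_scatAtom :
    Measurable fun x : Orientation × ℝ × Plane × Plane × ℝ =>
      scatAtom B α I x.1 x.2.1 x.2.2.1 x.2.2.2.1 x.2.2.2.2 := by
  have h1 := (continuous_normalImpulse B α).measurable
  have h2 := (continuous_massRatio B α I).measurable
  have h3 : Measurable fun x : Orientation × ℝ × Plane × Plane × ℝ => rot x.1 (B.n x.2.1) :=
    Continuous.measurable (by fun_prop)
  unfold scatAtom
  fun_prop

theorem measurable_scatVel :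
    Measurable fun x : Orientation × ℝ × Plane × Plane × ℝ =>
      scatVel B α I x.1 x.2.1 x.2.2.1 x.2.2.2.1 x.2.2.2.2 := by
  have h1 := (continuous_normalImpulse B α).measurable
  have h2 := (continuous_massRatio B α I).measurable
  have h3 : Measurable fun x : Orientation × ℝ × Plane × Plane × ℝ => rot x.1 (B.n x.2.1) :=
    Continuous.measurable (by fun_prop)
  unfold scatVel
  fun_prop

theorem measurable_scatAngVel :
    Measurable fun x : Orientation × ℝ × Plane × Plane × ℝ =>
      scatAngVel B α I x.1 x.2.1 x.2.2.1 x.2.2.2.1 x.2.2.2.2 := by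
  have h1 := (continuous_normalImpulse B α).measurable
  have h2 := (continuous_massRatio B α I).measurable
  have h3 : Measurable fun x : Orientation × ℝ × Plane × Plane × ℝ =>
      ⟪B.n x.2.1, perp (B.r x.2.1)⟫ :=
    Continuous.measurable (by fun_prop)
  unfold scatAngVel
  fun_prop

theorem continuous_normalVel : Continuous (normalVel B α) :=
  (continuous_normalVelocity B α).comp
    (f := fun w : Phase × ℝ × Plane => (w.1.2.2.1, w.2.1, w.2.2, w.1.2.1, w.1.2.2.2)) (by fun_prop)

theorem measurable_scatter : Measurable (scatter B α I) := by
  have h : Measurable fun w : Phase × ℝ × Plane =>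
      (w.1.2.2.1, w.2.1, w.2.2, w.1.2.1, w.1.2.2.2) := by fun_prop
  have h1 := (measurable_scatAtom B α I).comp h
  have h2 := (measurable_scatVel B α I).comp h
  have h3 := (measurable_scatAngVel B α I).comp h
  simp only [Function.comp_def] at h1 h2 h3
  unfold scatter
  fun_prop

end Continuity

/-! ### Algebra of the scattering -/

section Algebra

variable (B : RigidBody) {α I : ℝ} (hα : 0 < α) (hI : 0 < I) (Θ : Orientation) (σ : ℝ)
  (v V : Plane) (Ω : ℝ)

theorem massRatio_nonneg (hI : 0 < I) : 0 ≤ massRatio B α I σ := by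
  unfold massRatio; positivity

theorem inner_perp_rot_rot :
    ⟪perp (rot Θ (B.r σ)), rot Θ (B.n σ)⟫ = ⟪B.n σ, perp (B.r σ)⟫ := by
  rw [perp_rot, inner_rot_rot, real_inner_comm]

theorem normalImpulse_eq : normalImpulse B α Θ σ v V Ω =
    α * ⟪V, rot Θ (B.n σ)⟫ + α * Ω * ⟪B.n σ, perp (B.r σ)⟫ - ⟪v, rot Θ (B.n σ)⟫ := by
  rw [normalImpulse, inner_sub_left, inner_add_left, inner_smul_left, inner_smul_left,
    inner_perp_rot_rot]
  simp

include hα in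
theorem normalVelocity_eq : normalVelocity B α Θ σ v V Ω =
    -(α⁻¹ * normalImpulse B α Θ σ v V Ω) := by
  rw [normalImpulse_eq, normalVelocity, inner_sub_left, inner_sub_left, inner_smul_left,
    inner_smul_left, inner_perp_rot_rot]
  simp
  field_simp
  ring

theorem inner_rot_n_self : ⟪rot Θ (B.n σ), rot Θ (B.n σ)⟫ = 1 := by
  rw [inner_rot_rot, real_inner_self_eq_norm_sq, B.norm_n]; norm_num

include hI in
-- The factor 2/(A + 1) is tuned for this: an impulse along the normal changes q by −(A + 1) times
-- its size, because A·I = α²(I + (n·r^⊥)²). The reversal makes the scattering an involution.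
theorem normalImpulse_scat : normalImpulse B α Θ σ (scatAtom B α I Θ σ v V Ω)
    (scatVel B α I Θ σ v V Ω) (scatAngVel B α I Θ σ v V Ω) = -normalImpulse B α Θ σ v V Ω := by
  have hA := massRatio_nonneg B (α := α) σ hI
  rw [normalImpulse_eq, scatAtom, scatVel, scatAngVel, inner_sub_left, inner_add_left,
    inner_smul_left, inner_smul_left, inner_rot_n_self]
  have h := normalImpulse_eq B (α := α) Θ σ v V Ω
  set q := normalImpulse B α Θ σ v V Ω
  set a := ⟪V, rot Θ (B.n σ)⟫
  set b := ⟪v, rot Θ (B.n σ)⟫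
  set k := ⟪B.n σ, perp (B.r σ)⟫ with hk
  have hA' : massRatio B α I σ * I = α ^ 2 * (I + k ^ 2) := by
    rw [massRatio, ← hk]; field_simp
  set A := massRatio B α I σ
  have hA1 : A + 1 ≠ 0 := by positivity
  simp only [conj_trivial]
  field_simp
  linear_combination (-(I * (A + 1))) * h + (2 * q) * hA'

include hI in
theorem scatAtom_scat : scatAtom B α I Θ σ (scatAtom B α I Θ σ v V Ω)
    (scatVel B α I Θ σ v V Ω) (scatAngVel B α I Θ σ v V Ω) = v := by
  rw [scatAtom, normalImpulse_scat B hI, scatAtom]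
  module

include hI in
theorem scatVel_scat : scatVel B α I Θ σ (scatAtom B α I Θ σ v V Ω)
    (scatVel B α I Θ σ v V Ω) (scatAngVel B α I Θ σ v V Ω) = V := by
  rw [scatVel, normalImpulse_scat B hI, scatVel]
  module

include hI in
theorem scatAngVel_scat : scatAngVel B α I Θ σ (scatAtom B α I Θ σ v V Ω)
    (scatVel B α I Θ σ v V Ω) (scatAngVel B α I Θ σ v V Ω) = Ω := by
  rw [scatAngVel, normalImpulse_scat B hI, scatAngVel]
  ring

include hI in
theorem energy_scat : ‖scatAtom B α I Θ σ v V Ω‖ ^ 2 +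
    (‖scatVel B α I Θ σ v V Ω‖ ^ 2 + I * scatAngVel B α I Θ σ v V Ω ^ 2) =
    ‖v‖ ^ 2 + (‖V‖ ^ 2 + I * Ω ^ 2) := by
  have hA := massRatio_nonneg B (α := α) σ hI
  rw [scatAtom, scatVel, scatAngVel, norm_add_sq_real, norm_sub_sq_real, inner_smul_right,
    inner_smul_right, norm_smul, norm_smul, norm_rot, B.norm_n, mul_one, mul_one,
    Real.norm_eq_abs, Real.norm_eq_abs, sq_abs, sq_abs]
  have h := normalImpulse_eq B (α := α) Θ σ v V Ω
  set q := normalImpulse B α Θ σ v V Ω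
  set a := ⟪V, rot Θ (B.n σ)⟫
  set b := ⟪v, rot Θ (B.n σ)⟫
  set k := ⟪B.n σ, perp (B.r σ)⟫ with hk
  have hA' : massRatio B α I σ * I = α ^ 2 * (I + k ^ 2) := by
    rw [massRatio, ← hk]; field_simp
  set A := massRatio B α I σ
  have hA1 : A + 1 ≠ 0 := by positivity
  field_simp
  linear_combination (4 * I * q * (A + 1)) * h + (-4 * q ^ 2) * hA'

include hα hI in
theorem normalVel_scatter (w : Phase × ℝ × Plane) :
    normalVel B α (scatter B α I w) = -normalVel B α w := by
  rw [normalVel, normalVel, normalVelocity_eq B hα, normalVelocity_eq B hα]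
  simp only [scatter]
  rw [normalImpulse_scat B hI]
  ring

end Algebra

/-- Detailed balance: the product of Maxwellians depends only on the conserved energy. -/
theorem maxwellian_mul_bodyMaxwellian_scatter (B : RigidBody) {α I : ℝ} (hI : 0 < I) (β : ℝ)
    (w : Phase × ℝ × Plane) :
    bodyMaxwellian β I (scatter B α I w).1 * maxwellian β (scatter B α I w).2.2 =
      bodyMaxwellian β I w.1 * maxwellian β w.2.2 := by
  have h := energy_scat B (α := α) hI w.1.2.2.1 w.2.1 w.2.2 w.1.2.1 w.1.2.2.2
  have e : ∀ (Y : Phase) (v : Plane), bodyMaxwellian β I Y * maxwellian β v =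
      β / (2 * Real.pi) * Real.sqrt (β * I / (2 * Real.pi)) * (β / (2 * Real.pi)) *
        Real.exp (-(β / 2) * (‖v‖ ^ 2 + (‖Y.2.1‖ ^ 2 + I * Y.2.2.2 ^ 2))) := by
    intro Y v
    rw [mul_add, Real.exp_add, bodyMaxwellian, maxwellian]
    ring
  rw [e, e]
  simp only [scatter]
  rw [h]

/-! ### The scattering preserves the measure -/

theorem measurePreserving_leftComm {X Y Z : Type*} [MeasurableSpace X] [MeasurableSpace Y]
    [MeasurableSpace Z] (μ : Measure X) (ν : Measure Y) (ξ : Measure Z) [SFinite μ] [SFinite ν]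
    [SFinite ξ] :
    MeasurePreserving (fun p : X × Y × Z => (p.2.1, p.1, p.2.2)) (μ.prod (ν.prod ξ))
      (ν.prod (μ.prod ξ)) :=
  (measurePreserving_prodAssoc ν μ ξ).comp
    (((Measure.measurePreserving_swap (μ := μ) (ν := ν)).prod (MeasurePreserving.id ξ)).comp
      (measurePreserving_prodAssoc μ ν ξ).symm)

/-- Regrouping of the variables of a collision: `(X, Θ, σ)` is left unchanged by the scattering. -/
def regroup (X Y Z W S R : Type*) [MeasurableSpace X] [MeasurableSpace Y] [MeasurableSpace Z]
    [MeasurableSpace W] [MeasurableSpace S] [MeasurableSpace R] :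
    (X × Y × Z × W) × (S × R) ≃ᵐ ((X × Z) × S) × (R × Y × W) where
  toFun w := (((w.1.1, w.1.2.2.1), w.2.1), (w.2.2, w.1.2.1, w.1.2.2.2))
  invFun w := ((w.1.1.1, w.2.2.1, w.1.1.2, w.2.2.2), (w.1.2, w.2.1))
  left_inv _ := rfl
  right_inv _ := rfl
  measurable_toFun := by
    simp only [Equiv.coe_fn_mk]; fun_prop
  measurable_invFun := by
    simp only [Equiv.coe_fn_symm_mk]; fun_prop

theorem measurePreserving_regroup {X Y Z W S R : Type*} [MeasurableSpace X] [MeasurableSpace Y]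
    [MeasurableSpace Z] [MeasurableSpace W] [MeasurableSpace S] [MeasurableSpace R]
    (a : Measure X) (b : Measure Y) (c : Measure Z) (d : Measure W) (e : Measure S) (f : Measure R)
    [SFinite a] [SFinite b] [SFinite c] [SFinite d] [SFinite e] [SFinite f] :
    MeasurePreserving (regroup X Y Z W S R) ((a.prod (b.prod (c.prod d))).prod (e.prod f))
      (((a.prod c).prod e).prod (f.prod (b.prod d))) := by
  have m1 : MeasurePreserving (fun w : X × Y × Z × W => ((w.1, w.2.2.1), (w.2.1, w.2.2.2)))
      (a.prod (b.prod (c.prod d))) ((a.prod c).prod (b.prod d)) :=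
    (measurePreserving_prodAssoc a c (b.prod d)).symm.comp
      ((MeasurePreserving.id a).prod (measurePreserving_leftComm b c d))
  have m2 : MeasurePreserving
      (fun w : ((X × Z) × (Y × W)) × (S × R) => ((w.1.1, w.2.1), (w.2.2, w.1.2)))
      (((a.prod c).prod (b.prod d)).prod (e.prod f))
      (((a.prod c).prod e).prod (f.prod (b.prod d))) :=
    (measurePreserving_prodAssoc (a.prod c) e (f.prod (b.prod d))).symm.comp
      (((MeasurePreserving.id (a.prod c)).prod
        (((MeasurePreserving.id e).prod Measure.measurePreserving_swap).comp
          (measurePreserving_leftComm (b.prod d) e f))).comp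
        (measurePreserving_prodAssoc (a.prod c) (b.prod d) (e.prod f)))
  exact m2.comp (m1.prod (MeasurePreserving.id (e.prod f)))

/-- The scattering of the velocities at a given contact, as a linear map. -/
noncomputable def scatLinear (B : RigidBody) (α I : ℝ) (Θ : Orientation) (σ : ℝ) :
    Plane × Plane × ℝ →ₗ[ℝ] Plane × Plane × ℝ where
  toFun x := (scatAtom B α I Θ σ x.1 x.2.1 x.2.2, scatVel B α I Θ σ x.1 x.2.1 x.2.2,
    scatAngVel B α I Θ σ x.1 x.2.1 x.2.2)
  map_add' x y := by
    have h : normalImpulse B α Θ σ (x + y).1 (x + y).2.1 (x + y).2.2 =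
        normalImpulse B α Θ σ x.1 x.2.1 x.2.2 + normalImpulse B α Θ σ y.1 y.2.1 y.2.2 := by
      simp only [normalImpulse_eq, Prod.fst_add, Prod.snd_add, inner_add_left]; ring
    simp only [scatAtom, scatVel, scatAngVel, h]
    refine Prod.ext ?_ (Prod.ext ?_ ?_)
    · simp only [Prod.fst_add]; module
    · simp only [Prod.fst_add, Prod.snd_add]; module
    · simp only [Prod.snd_add]; ring
  map_smul' c x := by
    have h : normalImpulse B α Θ σ (c • x).1 (c • x).2.1 (c • x).2.2 =
        c * normalImpulse B α Θ σ x.1 x.2.1 x.2.2 := by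
      simp only [normalImpulse_eq, Prod.smul_fst, Prod.smul_snd, inner_smul_left, smul_eq_mul,
        conj_trivial]
      ring
    simp only [scatAtom, scatVel, scatAngVel, h, RingHom.id_apply]
    refine Prod.ext ?_ (Prod.ext ?_ ?_)
    · simp only [Prod.smul_fst]; module
    · simp only [Prod.smul_fst, Prod.smul_snd]; module
    · simp only [Prod.smul_snd, smul_eq_mul]; ring

/-- The determinant squares to 1, so its absolute value is 1. -/
theorem measurePreserving_of_involutive {E : Type*} [NormedAddCommGroup E] [NormedSpace ℝ E]
    [MeasurableSpace E] [BorelSpace E] [FiniteDimensional ℝ E] (μ : Measure E)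
    [μ.IsAddHaarMeasure] (f : E →ₗ[ℝ] E) (hf : ∀ x, f (f x) = x) : MeasurePreserving f μ μ := by
  have h1 : LinearMap.det f * LinearMap.det f = 1 := by
    rw [← LinearMap.det_comp, show f ∘ₗ f = LinearMap.id from LinearMap.ext hf, LinearMap.det_id]
  have h0 : LinearMap.det f ≠ 0 := fun h => by simp [h] at h1
  have h2 : |(LinearMap.det f)⁻¹| = 1 := by
    rw [abs_inv, inv_eq_one]
    rcases mul_self_eq_one_iff.1 h1 with h | h <;> simp [h]
  refine ⟨(LinearMap.continuous_of_finiteDimensional f).measurable, ?_⟩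
  rw [Measure.map_linearMap_addHaar_eq_smul_addHaar μ h0, h2, ENNReal.ofReal_one, one_smul]

namespace RigidBody

/-- The arc length of the enlarged body. -/
noncomputable def arcMeasure (B : RigidBody) (α : ℝ) : Measure ℝ :=
  (volume.restrict (Set.Ioc 0 B.perimeter)).withDensity (fun σ => ‖deriv (B.rEnlarged α) σ‖ₑ)

theorem collisionMeasure_eq (B : RigidBody) (α : ℝ) :
    B.collisionMeasure α = (B.arcMeasure α).prod volume := rfl

/-- Thickening by α/2 stretches the arc length element by 1 + ακ/2, because n' = κ times the
tangent. -/
theorem arcMeasure_eq (B : RigidBody) {α : ℝ} (hα : 0 < α) :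
    B.arcMeasure α = (volume.restrict (Set.Ioc 0 B.perimeter)).withDensity
      (fun σ => ENNReal.ofReal (1 + α / 2 * B.curvature σ)) := by
  rw [arcMeasure]
  congr 1
  ext1 σ
  have := B.curvature_pos' σ
  rw [(B.hasDerivAt_rEnlarged α σ).deriv, enorm_smul, ← ofReal_norm (B.tangent σ),
    B.norm_tangent, ENNReal.ofReal_one, mul_one, Real.enorm_of_nonneg (by positivity)]

theorem exists_arcMeasure_univ_le (B : RigidBody) : ∃ Λ : ℝ, 0 < Λ ∧ ∀ α, 0 < α → α ≤ 1 →
    B.arcMeasure α univ ≤ ENNReal.ofReal Λ := by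
  obtain ⟨k, K, hk, hK⟩ := B.exists_curvature_bounds
  have hK0 : 0 < K := hk.trans_le ((hK 0).1.trans (hK 0).2)
  refine ⟨(1 + K) * B.perimeter, mul_pos (by linarith) B.perimeter_pos, fun α hα hα1 => ?_⟩
  rw [B.arcMeasure_eq hα, withDensity_apply _ MeasurableSet.univ, Measure.restrict_univ]
  calc ∫⁻ σ in Ioc 0 B.perimeter, ENNReal.ofReal (1 + α / 2 * B.curvature σ)
      ≤ ∫⁻ _ in Ioc 0 B.perimeter, ENNReal.ofReal (1 + K) := by
        refine lintegral_mono fun σ => ENNReal.ofReal_le_ofReal ?_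
        have := (hK σ).2
        have h0 := B.curvature_pos' σ
        nlinarith
    _ = ENNReal.ofReal ((1 + K) * B.perimeter) := by
        rw [lintegral_const, Measure.restrict_apply_univ, Real.volume_Ioc, sub_zero,
          ENNReal.ofReal_mul (by linarith)]

instance (B : RigidBody) (α : ℝ) : SFinite (B.arcMeasure α) := by
  unfold arcMeasure; infer_instance

instance (B : RigidBody) (α : ℝ) : SFinite (B.collisionMeasure α) := by
  rw [collisionMeasure_eq]; infer_instance

end RigidBody

theorem measurePreserving_fiberwise {X E : Type*} [MeasurableSpace X] [MeasurableSpace E]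
    (μ : Measure X) (ν : Measure E) [SFinite μ] [SFinite ν] (g : X → E → E)
    (hgm : Measurable fun p : X × E => g p.1 p.2) (hg : ∀ a, MeasurePreserving (g a) ν ν) :
    MeasurePreserving (fun p : X × E => (p.1, g p.1 p.2)) (μ.prod ν) (μ.prod ν) :=
  (MeasurePreserving.id μ).skew_product hgm (Filter.Eventually.of_forall fun a => (hg a).map_eq)

theorem measurePreserving_scatLinear (B : RigidBody) {α I : ℝ} (hI : 0 < I) (Θ : Orientation)
    (σ : ℝ) : MeasurePreserving (scatLinear B α I Θ σ)
      ((volume : Measure Plane).prod ((volume : Measure Plane).prod (volume : Measure ℝ)))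
      ((volume : Measure Plane).prod ((volume : Measure Plane).prod (volume : Measure ℝ))) :=
  haveI : ((volume : Measure Plane).prod
      ((volume : Measure Plane).prod (volume : Measure ℝ))).IsAddHaarMeasure :=
    Measure.prod.instIsAddHaarMeasure _ _
  measurePreserving_of_involutive _ _ fun _ => Prod.ext (scatAtom_scat B hI _ _ _ _ _)
    (Prod.ext (scatVel_scat B hI _ _ _ _ _) (scatAngVel_scat B hI _ _ _ _ _))

/-- Once the variables are regrouped, (X, Θ, σ) is a parameter and each fibre carries a linear
involution of the velocities. -/
theorem measurePreserving_scatter (B : RigidBody) {α I : ℝ} (hI : 0 < I) :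
    MeasurePreserving (scatter B α I) ((volume : Measure Phase).prod (B.collisionMeasure α))
      ((volume : Measure Phase).prod (B.collisionMeasure α)) := by
  have he := measurePreserving_regroup (volume : Measure (UnitAddTorus (Fin 2)))
    (volume : Measure Plane) (volume : Measure Orientation) (volume : Measure ℝ) (B.arcMeasure α)
    (volume : Measure Plane)
  have h : Measurable fun p : ((UnitAddTorus (Fin 2) × Orientation) × ℝ) × (Plane × Plane × ℝ)
      => (p.1.1.2, p.1.2, p.2.1, p.2.2.1, p.2.2.2) := by fun_prop
  have hm : Measurable fun p : ((UnitAddTorus (Fin 2) × Orientation) × ℝ) × (Plane × Plane × ℝ) =>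
      scatLinear B α I p.1.1.2 p.1.2 p.2 :=
    ((measurable_scatAtom B α I).comp h).prodMk
      (((measurable_scatVel B α I).comp h).prodMk ((measurable_scatAngVel B α I).comp h))
  have hK := measurePreserving_fiberwise
    (((volume : Measure (UnitAddTorus (Fin 2))).prod (volume : Measure Orientation)).prod
      (B.arcMeasure α))
    ((volume : Measure Plane).prod ((volume : Measure Plane).prod (volume : Measure ℝ)))
    (fun a x => scatLinear B α I a.1.2 a.2 x) hm
    (fun a => measurePreserving_scatLinear B hI a.1.2 a.2)
  exact (he.symm _).comp (hK.comp he)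

/-! ### Balance of the fluxes -/

/-- The rotation `R_Θ` as a continuous linear map. -/
noncomputable def rotCLM (Θ : Orientation) : Plane →L[ℝ] Plane :=
  cosO Θ • ContinuousLinearMap.id ℝ Plane + sinO Θ • perpCLM

theorem rotCLM_apply (Θ : Orientation) (x : Plane) : rotCLM Θ x = rot Θ x := by
  rw [rot_eq]; rfl

/-- The flux of a uniform flow through the boundary of a body in rotation vanishes. -/
theorem integral_normalVelocity (B : RigidBody) {α : ℝ} (hα : 0 < α) (Θ : Orientation)
    (v V : Plane) (Ω : ℝ) : ∫ σ, normalVelocity B α Θ σ v V Ω ∂B.arcMeasure α = 0 := by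
  simp only [normalVelocity]
  generalize α⁻¹ • v - V = u
  have hd : ∀ σ, 0 ≤ 1 + α / 2 * B.curvature σ := fun σ => by
    have := B.curvature_pos' σ; positivity
  have hcm : Measurable fun σ => ENNReal.ofReal (1 + α / 2 * B.curvature σ) :=
    (Continuous.measurable (by fun_prop)).ennreal_ofReal
  rw [B.arcMeasure_eq hα, integral_withDensity_eq_integral_toReal_smul hcm (by simp),
    ← intervalIntegral.integral_of_le B.perimeter_pos.le]
  -- A periodic primitive of the integrand including the density 1 + ακ/2. The rotational part uses
  -- −⟨r^⊥, n⟩ = ⟨r, τ⟩ with τ the tangent, and ⟨r, τ⟩(1 + ακ/2) is the derivative of |r|²/2 +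
  -- (α/2)⟨r, n⟩.
  set F : ℝ → ℝ := fun σ => -⟪u, rotCLM Θ (perpCLM (B.rEnlarged α σ))⟫ +
    Ω * (⟪B.r σ, B.r σ⟫ / 2 + α / 2 * ⟪B.r σ, B.n σ⟫) with hF
  have hdF : ∀ σ, HasDerivAt F
      ((ENNReal.ofReal (1 + α / 2 * B.curvature σ)).toReal •
        ⟪u - Ω • perp (rot Θ (B.r σ)), rot Θ (B.n σ)⟫) σ := by
    intro σ
    have h1 := ((hasDerivAt_const σ u).inner ℝ ((rotCLM Θ).hasFDerivAt.comp_hasDerivAt σ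
      (perpCLM.hasFDerivAt.comp_hasDerivAt σ (B.hasDerivAt_rEnlarged α σ)))).neg
    have h2 := (((B.hasDerivAt_r σ).inner ℝ (B.hasDerivAt_r σ)).div_const 2).add
      (((B.hasDerivAt_r σ).inner ℝ (B.hasDerivAt_n σ)).const_mul (α / 2))
    refine (h1.add (h2.const_mul Ω)).congr_deriv ?_
    rw [ENNReal.toReal_ofReal (hd σ), perp_rot, inner_sub_left,
      inner_smul_left, inner_rot_rot, B.inner_tangent_n, B.n_eq, map_smul, map_smul,
      rotCLM_apply, perpCLM_apply, inner_neg_right, inner_perp_perp, inner_zero_left, add_zero,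
      inner_smul_right, inner_smul_right, real_inner_comm (B.r σ) (B.tangent σ),
      show rot Θ (-perp (B.tangent σ)) = -rot Θ (perp (B.tangent σ)) by
        rw [← rotCLM_apply, map_neg, rotCLM_apply], inner_neg_right]
    simp only [conj_trivial, smul_eq_mul]
    ring
  have hcont : Continuous fun σ =>
      (ENNReal.ofReal (1 + α / 2 * B.curvature σ)).toReal •
        ⟪u - Ω • perp (rot Θ (B.r σ)), rot Θ (B.n σ)⟫ := by
    simp only [fun σ => ENNReal.toReal_ofReal (hd σ)]
    fun_prop
  rw [intervalIntegral.integral_eq_sub_of_hasDerivAt (fun σ _ => hdF σ)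
    (hcont.intervalIntegrable _ _)]
  have hp : B.r B.perimeter = B.r 0 := by simpa using B.periodic 0
  have hn : B.n B.perimeter = B.n 0 := by simpa using B.periodic_n 0
  simp only [hF, RigidBody.rEnlarged, hp, hn, sub_self]

/-! ### The free flow -/

theorem integral_comp_measurePreserving {X Y : Type*} [MeasurableSpace X] [MeasurableSpace Y]
    {μ : Measure X} {ν : Measure Y} {f : X → Y} (hf : MeasurePreserving f μ ν) {g : Y → ℝ}
    (hg : AEStronglyMeasurable g ν) : ∫ x, g (f x) ∂μ = ∫ y, g y ∂ν := by
  rw [← hf.map_eq, integral_map hf.measurable.aemeasurable (by rwa [hf.map_eq])]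

theorem measurePreserving_shear {G Z : Type*} [AddGroup G] [MeasurableSpace G] [MeasurableAdd₂ G]
    [MeasurableSpace Z] (μ : Measure G) (ν : Measure Z) [SFinite μ] [SFinite ν]
    [μ.IsAddRightInvariant] {φ : Z → G} (hφ : Measurable φ) :
    MeasurePreserving (fun p : G × Z => (p.1 + φ p.2, p.2)) (μ.prod ν) (μ.prod ν) :=
  Measure.measurePreserving_swap.comp
    ((measurePreserving_fiberwise ν μ (fun z x => x + φ z) (by fun_prop)
      (fun z => measurePreserving_add_right μ (φ z))).comp Measure.measurePreserving_swap)

theorem freeFlow_apply (α ε t : ℝ) (Y : Phase) : freeFlow α ε t Y =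
    (Y.1 + fun i => ((t * Y.2.1 i : ℝ) : UnitAddCircle), Y.2.1,
      Y.2.2.1 + ((t * (α / ε * Y.2.2.2) : ℝ) : Orientation), Y.2.2.2) := rfl

theorem freeFlow_freeFlow (α ε s t : ℝ) (Y : Phase) :
    freeFlow α ε s (freeFlow α ε t Y) = freeFlow α ε (s + t) Y := by
  simp only [freeFlow_apply]
  refine Prod.ext ?_ (Prod.ext rfl (Prod.ext ?_ rfl))
  · ext i
    simp only [Pi.add_apply, add_assoc, ← AddCircle.coe_add]
    congr 2; ring
  · simp only [add_assoc, ← AddCircle.coe_add]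
    congr 2; ring

theorem freeFlow_zero (α ε : ℝ) (Y : Phase) : freeFlow α ε 0 Y = Y := by
  simp only [freeFlow_apply, zero_mul, AddCircle.coe_zero, add_zero]
  refine Prod.ext ?_ rfl
  ext i; simp

theorem bodyMaxwellian_freeFlow (β I α ε t : ℝ) (Y : Phase) :
    bodyMaxwellian β I (freeFlow α ε t Y) = bodyMaxwellian β I Y := rfl

theorem measurable_coe_addCircle {p : ℝ} : Measurable fun t : ℝ => (t : AddCircle p) :=
  (AddCircle.continuous_mk' p).measurable

theorem measurable_freeFlow (α ε : ℝ) :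
    Measurable fun p : ℝ × Phase => freeFlow α ε p.1 p.2 := by
  simp only [freeFlow_apply]
  have h1 : Measurable fun p : ℝ × Phase => fun i : Fin 2 =>
      ((p.1 * p.2.2.1 i : ℝ) : UnitAddCircle) :=
    measurable_pi_lambda _ fun i => measurable_coe_addCircle.comp (by fun_prop)
  have h2 : Measurable fun p : ℝ × Phase =>
      ((p.1 * (α / ε * p.2.2.2.2) : ℝ) : Orientation) :=
    measurable_coe_addCircle.comp (by fun_prop)
  fun_prop

/-- The flow is a composition of two shears, translating X by tV and Θ by t(α/ε)Ω with V and Ω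
frozen. -/
theorem measurePreserving_freeFlow (α ε t : ℝ) :
    MeasurePreserving (freeFlow α ε t) volume volume := by
  have h1 : Measurable fun Z : Plane × Orientation × ℝ => fun i : Fin 2 =>
      ((t * Z.1 i : ℝ) : UnitAddCircle) :=
    measurable_pi_lambda _ fun i => measurable_coe_addCircle.comp (by fun_prop)
  have h2 : Measurable fun Ω : ℝ => ((t * (α / ε * Ω) : ℝ) : Orientation) :=
    measurable_coe_addCircle.comp (by fun_prop)
  have m1 := measurePreserving_shear (volume : Measure (UnitAddTorus (Fin 2)))
    (volume : Measure (Plane × Orientation × ℝ)) h1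
  have m2 := measurePreserving_shear (volume : Measure Orientation) (volume : Measure ℝ) h2
  exact m1.comp ((MeasurePreserving.id volume).prod ((MeasurePreserving.id volume).prod m2))

theorem measurePreserving_timeFlow (α ε T : ℝ) :
    MeasurePreserving (fun p : ℝ × Phase => (p.1, freeFlow α ε p.1 p.2))
      ((volume.restrict (Icc 0 T)).prod volume) ((volume.restrict (Icc 0 T)).prod volume) :=
  measurePreserving_fiberwise _ _ (fun t Y => freeFlow α ε t Y) (measurable_freeFlow α ε)
    (measurePreserving_freeFlow α ε)

theorem measurable_bodyMaxwellian (β I : ℝ) : Measurable (bodyMaxwellian β I) := by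
  have : Continuous (bodyMaxwellian β I) := by
    unfold bodyMaxwellian
    fun_prop
  exact this.measurable

theorem bodyMaxwellian_pos {β I : ℝ} (hβ : 0 < β) (hI : 0 < I) (Y : Phase) :
    0 < bodyMaxwellian β I Y := by
  unfold bodyMaxwellian; positivity

/-! ### Transport equations with a source -/

/-- `f` solves on `[0, T]` the transport equation with source `q` and initial datum `f₀`. -/
structure IsTransported (α ε β I T : ℝ) (f₀ : Phase → ℝ) (f q : ℝ → Phase → ℝ) : Prop where
  measurable_init : Measurable f₀
  measurable : Measurable fun p : ℝ × Phase => f p.1 p.2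
  measurable_source : Measurable fun p : ℝ × Phase => q p.1 p.2
  integrable_source : Integrable (fun p : ℝ × Phase => bodyMaxwellian β I p.2 * q p.1 p.2)
    ((volume.restrict (Icc 0 T)).prod volume)
  duhamel : ∀ t ∈ Icc 0 T, ∀ᵐ Y : Phase,
    f t Y = f₀ (freeFlow α ε (-t) Y) + ∫ s in (0 : ℝ)..t, q s (freeFlow α ε (s - t) Y)

namespace IsTransported

variable {α ε β I T : ℝ} {f₀ : Phase → ℝ} {f q : ℝ → Phase → ℝ}

/-- Fubini after the measure preserving change of variables of the flow; the Maxwellian is a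
positive constant on each characteristic and can be divided out. -/
theorem integrable_characteristic (h : IsTransported α ε β I T f₀ f q) (hβ : 0 < β) (hI : 0 < I) :
    ∀ᵐ Z : Phase, IntegrableOn (fun s => q s (freeFlow α ε s Z)) (Icc 0 T) := by
  have h1 := (measurePreserving_timeFlow α ε T).integrable_comp_of_integrable h.integrable_source
  filter_upwards [h1.prod_left_ae] with Z hZ
  have hm := (bodyMaxwellian_pos hβ hI Z).ne'
  refine (hZ.const_mul (bodyMaxwellian β I Z)⁻¹).congr (Filter.Eventually.of_forall fun s => ?_)
  simp only [Function.comp_apply, bodyMaxwellian_freeFlow]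
  field_simp

theorem duhamel_characteristic (h : IsTransported α ε β I T f₀ f q) {t : ℝ} (ht : t ∈ Icc 0 T) :
    ∀ᵐ Z : Phase, f t (freeFlow α ε t Z) =
      f₀ Z + ∫ s in (0 : ℝ)..t, q s (freeFlow α ε s Z) := by
  have h1 := (measurePreserving_freeFlow α ε t).quasiMeasurePreserving.ae (h.duhamel t ht)
  filter_upwards [h1] with Z hZ
  simp only [hZ, freeFlow_freeFlow, sub_add_cancel, neg_add_cancel, freeFlow_zero]

/-- The Duhamel formula has an exceptional set depending on t, whereas the argument along a
characteristic needs one exceptional set of characteristics. Exchanging the quantifiers requires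
joint measurability of the time integral, provided by `J`. -/
theorem ae_duhamel_characteristic (h : IsTransported α ε β I T f₀ f q) :
    ∀ᵐ Z : Phase, ∀ᵐ t ∂volume.restrict (Icc 0 T), f t (freeFlow α ε t Z) =
      f₀ Z + ∫ s in (0 : ℝ)..t, q s (freeFlow α ε s Z) := by
  have hq : Measurable fun p : ℝ × Phase => q p.1 (freeFlow α ε p.1 p.2) :=
    h.measurable_source.comp (measurable_fst.prodMk (measurable_freeFlow α ε))
  have hf : Measurable fun p : ℝ × Phase => f p.1 (freeFlow α ε p.1 p.2) :=
    h.measurable.comp (measurable_fst.prodMk (measurable_freeFlow α ε))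
  set J : ℝ × Phase → ℝ := fun p => ∫ s, {x : (ℝ × Phase) × ℝ | 0 < x.2 ∧ x.2 ≤ x.1.1}.indicator
    (fun x => q x.2 (freeFlow α ε x.2 x.1.2)) (p, s) with hJ
  have hJm : Measurable J := by
    refine (StronglyMeasurable.integral_prod_right' (Measurable.stronglyMeasurable ?_)).measurable
    refine Measurable.indicator (hq.comp (by fun_prop : Measurable fun x : (ℝ × Phase) × ℝ =>
      (x.2, x.1.2))) ?_
    exact (measurableSet_lt measurable_const measurable_snd).inter
      (measurableSet_le measurable_snd (measurable_fst.comp measurable_fst))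
  have hJe : ∀ t ∈ Icc 0 T, ∀ Z, J (t, Z) = ∫ s in (0 : ℝ)..t, q s (freeFlow α ε s Z) := by
    intro t ht Z
    rw [intervalIntegral.integral_of_le ht.1, ← integral_indicator measurableSet_Ioc]
    rfl
  have hset : MeasurableSet {x : ℝ × Phase | f x.1 (freeFlow α ε x.1 x.2) = f₀ x.2 + J x} :=
    measurableSet_eq_fun hf ((h.measurable_init.comp measurable_snd).add hJm)
  have h1 : ∀ᵐ t ∂volume.restrict (Icc 0 T), ∀ᵐ Z : Phase, f t (freeFlow α ε t Z) =
      f₀ Z + J (t, Z) := by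
    refine (ae_restrict_iff' measurableSet_Icc).2 (Filter.Eventually.of_forall fun t ht => ?_)
    filter_upwards [h.duhamel_characteristic ht] with Z hZ
    rw [hZ, hJe t ht]
  have h2 := (Measure.ae_ae_comm (p := fun t Z => f t (freeFlow α ε t Z) = f₀ Z + J (t, Z))
    hset).1 h1
  filter_upwards [h2] with Z hZ
  filter_upwards [hZ, ae_restrict_mem measurableSet_Icc] with t ht ht'
  rw [ht, hJe t ht']

/-- The balance of the negative part of a solution. -/
theorem negPart (h : IsTransported α ε β I T f₀ f q) (hT : 0 ≤ T) (hβ : 0 < β) (hI : 0 < I)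
    (h₀ : Integrable fun Y => bodyMaxwellian β I Y * f₀ Y) :
    Integrable (fun Y => bodyMaxwellian β I Y * max (-f T Y) 0) ∧
    ∫ Y, bodyMaxwellian β I Y * max (-f T Y) 0 =
      (∫ Y, bodyMaxwellian β I Y * max (-f₀ Y) 0) -
        ∫ p : ℝ × Phase, {p : ℝ × Phase | f p.1 p.2 < 0}.indicator
          (fun p => bodyMaxwellian β I p.2 * q p.1 p.2) p
          ∂((volume.restrict (Icc 0 T)).prod volume) := by
  set m := bodyMaxwellian β I with hm
  have hm0 : ∀ Y, 0 < m Y := bodyMaxwellian_pos hβ hI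
  have hmm : Measurable m := measurable_bodyMaxwellian β I
  set F : ℝ × Phase → ℝ := {p : ℝ × Phase | f p.1 p.2 < 0}.indicator
    (fun p => m p.2 * q p.1 p.2) with hF
  have hFi : Integrable F ((volume.restrict (Icc 0 T)).prod volume) :=
    h.integrable_source.indicator (measurableSet_lt h.measurable measurable_const)
  have hmp := measurePreserving_timeFlow α ε T
  have hFc := hmp.integrable_comp_of_integrable hFi
  have hfT : Measurable fun Y => m Y * max (-f T Y) 0 := by
    have : Measurable fun Y => f T Y := h.measurable.comp measurable_prodMk_left
    fun_prop
  have h0i : Integrable fun Y => m Y * max (-f₀ Y) 0 := by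
    refine h₀.mono (hmm.mul ((h.measurable_init.neg).max measurable_const)).aestronglyMeasurable
      (Filter.Eventually.of_forall fun Y => ?_)
    rw [norm_mul, norm_mul]
    gcongr
    rw [Real.norm_of_nonneg (le_max_right _ _), Real.norm_eq_abs]
    exact max_le (neg_le_abs _) (abs_nonneg _)
  -- `negPart_primitive` on each characteristic, multiplied by the Maxwellian, which the flow leaves
  -- constant; integrating in Z then undoes the flow.
  have key : ∀ᵐ Z : Phase, m (freeFlow α ε T Z) * max (-f T (freeFlow α ε T Z)) 0 =
      m Z * max (-f₀ Z) 0 - ∫ s in Icc 0 T, F (s, freeFlow α ε s Z) := by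
    filter_upwards [h.integrable_characteristic hβ hI,
      h.duhamel_characteristic (right_mem_Icc.2 hT), h.ae_duhamel_characteristic] with Z h1 h2 h3
    have h4 := negPart_primitive (φ := fun s => q s (freeFlow α ε s Z)) (T := T)
      ((intervalIntegrable_iff_integrableOn_Icc_of_le hT).2 h1) (f₀ Z)
    rw [← h2] at h4
    rw [hm, bodyMaxwellian_freeFlow, ← hm, h4, mul_sub, ← intervalIntegral.integral_const_mul,
      intervalIntegral.integral_of_le hT, ← integral_Icc_eq_integral_Ioc]
    congr 1
    refine integral_congr_ae ?_
    filter_upwards [h3] with s hs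
    simp only [hF, indicator_apply, mem_ofPred_eq, hs, hm, bodyMaxwellian_freeFlow]
    split_ifs <;> simp
  have hFr : Integrable fun Z => ∫ s in Icc 0 T, F (s, freeFlow α ε s Z) :=
    hFc.integral_prod_right
  have hint : Integrable fun Z => m Z * max (-f₀ Z) 0 -
      ∫ s in Icc 0 T, F (s, freeFlow α ε s Z) := h0i.sub hFr
  have hflow := measurePreserving_freeFlow α ε T
  constructor
  · rw [← hflow.integrable_comp hfT.aestronglyMeasurable]
    exact hint.congr (key.mono fun Z hZ => hZ.symm)
  · rw [← integral_comp_measurePreserving hflow hfT.aestronglyMeasurable, integral_congr_ae key,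
      integral_sub h0i hFr,
      ← integral_comp_measurePreserving hmp hFi.aestronglyMeasurable]
    congr 1
    exact (integral_prod_symm _ hFc).symm

theorem smul (h : IsTransported α ε β I T f₀ f q) (c : ℝ) :
    IsTransported α ε β I T (fun Y => c * f₀ Y) (fun t Y => c * f t Y) (fun t Y => c * q t Y) where
  measurable_init := h.measurable_init.const_mul c
  measurable := h.measurable.const_mul c
  measurable_source := h.measurable_source.const_mul c
  integrable_source := (h.integrable_source.const_mul c).congr
    (Filter.Eventually.of_forall fun p => by ring)
  duhamel t ht := (h.duhamel t ht).mono fun Y hY => by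
    rw [hY, intervalIntegral.integral_const_mul, mul_add]

theorem const_add (h : IsTransported α ε β I T f₀ f q) (c : ℝ) :
    IsTransported α ε β I T (fun Y => c + f₀ Y) (fun t Y => c + f t Y) q where
  measurable_init := h.measurable_init.const_add c
  measurable := h.measurable.const_add c
  measurable_source := h.measurable_source
  integrable_source := h.integrable_source
  duhamel t ht := (h.duhamel t ht).mono fun Y hY => by rw [hY, add_assoc]

theorem integrable_backward (h : IsTransported α ε β I T f₀ f q) (hβ : 0 < β) (hI : 0 < I) {t : ℝ}
    (ht : t ∈ Icc 0 T) :
    ∀ᵐ Y : Phase, IntervalIntegrable (fun s => q s (freeFlow α ε (s - t) Y)) volume 0 t := by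
  have h1 := (measurePreserving_freeFlow α ε (-t)).quasiMeasurePreserving.ae
    (h.integrable_characteristic hβ hI)
  filter_upwards [h1] with Y hY
  simp only [freeFlow_freeFlow, ← sub_eq_add_neg] at hY
  exact (intervalIntegrable_iff_integrableOn_Icc_of_le ht.1).2
    (hY.mono_set (Icc_subset_Icc_right ht.2))

theorem add {g₀ : Phase → ℝ} {g r : ℝ → Phase → ℝ} (h : IsTransported α ε β I T f₀ f q)
    (h' : IsTransported α ε β I T g₀ g r) (hβ : 0 < β) (hI : 0 < I) :
    IsTransported α ε β I T (fun Y => f₀ Y + g₀ Y) (fun t Y => f t Y + g t Y)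
      (fun t Y => q t Y + r t Y) where
  measurable_init := h.measurable_init.add h'.measurable_init
  measurable := h.measurable.add h'.measurable
  measurable_source := h.measurable_source.add h'.measurable_source
  integrable_source := (h.integrable_source.add h'.integrable_source).congr
    (Filter.Eventually.of_forall fun p => by simp only [Pi.add_apply]; ring)
  duhamel t ht := by
    filter_upwards [h.duhamel t ht, h'.duhamel t ht, h.integrable_backward hβ hI ht,
      h'.integrable_backward hβ hI ht] with Y h1 h2 h3 h4
    rw [h1, h2, intervalIntegral.integral_add h3 h4]
    ring

end IsTransported

/-! ### Gaussian moments -/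

theorem integrable_exp_mul_gaussian {E : Type*} [NormedAddCommGroup E] [InnerProductSpace ℝ E]
    [FiniteDimensional ℝ E] [MeasurableSpace E] [BorelSpace E] {b : ℝ} (hb : 0 < b) (c : ℝ) :
    Integrable fun v : E => Real.exp (-b * ‖v‖ ^ 2) * Real.exp (c * ‖v‖) := by
  have h1 : Integrable fun v : E => Real.exp (-(b / 2) * ‖v‖ ^ 2) := by
    have h := (GaussianFourier.integrable_cexp_neg_mul_sq_norm_add (V := E) (b := ((b / 2 : ℝ) : ℂ))
      (by simpa using hb) 0 0).norm
    refine h.congr (Filter.Eventually.of_forall fun v => ?_)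
    simp only [Complex.norm_exp]
    norm_cast
    simp
  -- Completing the square costs half of the Gaussian exponent and the constant exp(c²/(2b)).
  refine (h1.const_mul (Real.exp (c ^ 2 / (2 * b)))).mono'
    (Continuous.aestronglyMeasurable (by fun_prop)) (Filter.Eventually.of_forall fun v => ?_)
  rw [Real.norm_of_nonneg (by positivity), ← Real.exp_add, ← Real.exp_add]
  refine Real.exp_le_exp.2 ?_
  have h2 : c ^ 2 / (2 * b) + -(b / 2) * ‖v‖ ^ 2 - (-b * ‖v‖ ^ 2 + c * ‖v‖) =
      (b * ‖v‖ - c) ^ 2 / (2 * b) := by field_simp; ring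
  have h3 : 0 ≤ (b * ‖v‖ - c) ^ 2 / (2 * b) := by positivity
  linarith

theorem continuous_maxwellian (β : ℝ) : Continuous (maxwellian β) := by
  unfold maxwellian; fun_prop

theorem maxwellian_pos {β : ℝ} (hβ : 0 < β) (v : Plane) : 0 < maxwellian β v := by
  unfold maxwellian; positivity

theorem integrable_maxwellian_mul_exp {β : ℝ} (hβ : 0 < β) (k : ℝ) :
    Integrable fun v : Plane => maxwellian β v * Real.exp (k * ‖v‖) := by
  refine ((integrable_exp_mul_gaussian (E := Plane) (half_pos hβ) k).const_mul
    (β / (2 * Real.pi))).congr (Filter.Eventually.of_forall fun v => ?_)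
  simp only [maxwellian, mul_assoc]

theorem integrable_bodyMaxwellian_mul_exp {β I : ℝ} (hβ : 0 < β) (hI : 0 < I) (k : ℝ) :
    Integrable fun Y : Phase => bodyMaxwellian β I Y *
      (Real.exp (k * ‖Y.2.1‖) * Real.exp (k * |Y.2.2.2|)) := by
  have h1 := integrable_exp_mul_gaussian (E := Plane) (half_pos hβ) k
  have h2 := integrable_exp_mul_gaussian (E := ℝ) (mul_pos (half_pos hβ) hI) k
  have h3 := (integrable_const (1 : ℝ) (μ := (volume : Measure (UnitAddTorus (Fin 2))))).mul_prod
    (h1.mul_prod ((integrable_const (1 : ℝ) (μ := (volume : Measure Orientation))).mul_prod h2))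
  refine (h3.const_mul (β / (2 * Real.pi) * Real.sqrt (β * I / (2 * Real.pi)))).congr
    (Filter.Eventually.of_forall fun Y => ?_)
  simp only [bodyMaxwellian, one_mul, Real.norm_eq_abs, sq_abs]
  rw [mul_add, Real.exp_add]
  ring_nf

/-! ### The collision rate -/

/-- The density of the incoming collisions. -/
noncomputable def collisionRate (B : RigidBody) (α β I : ℝ) (w : Phase × ℝ × Plane) : ℝ :=
  1 / α * (bodyMaxwellian β I w.1 * maxwellian β w.2.2 * max (-normalVel B α w) 0)

section Rate

variable (B : RigidBody) {α β I : ℝ}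

theorem measurable_collisionRate (α β I : ℝ) : Measurable (collisionRate B α β I) := by
  have h1 := (continuous_normalVel B α).measurable
  have h2 := (continuous_maxwellian β).measurable
  have h3 := measurable_bodyMaxwellian β I
  unfold collisionRate
  fun_prop

theorem collisionRate_nonneg (hα : 0 < α) (hβ : 0 < β) (hI : 0 < I) (w : Phase × ℝ × Plane) :
    0 ≤ collisionRate B α β I w := by
  have h1 := (bodyMaxwellian_pos hβ hI w.1).le
  have h2 := (maxwellian_pos hβ w.2.2).le
  unfold collisionRate
  positivity

/-- Scattering exchanges incoming and outgoing configurations. Thus gain minus loss of a constant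
carries the signed normal velocity, whose flux vanishes. -/
theorem collisionRate_scatter (hα : 0 < α) (hI : 0 < I) (w : Phase × ℝ × Plane) :
    collisionRate B α β I (scatter B α I w) =
      1 / α * (bodyMaxwellian β I w.1 * maxwellian β w.2.2 * max (normalVel B α w) 0) := by
  rw [collisionRate, normalVel_scatter B hα hI, neg_neg,
    maxwellian_mul_bodyMaxwellian_scatter B hI]

theorem abs_normalVel_le {D : ℝ} (hD : ∀ x ∈ B.carrier, ‖x‖ ≤ D) (w : Phase × ℝ × Plane) :
    |normalVel B α w| ≤ ‖α⁻¹ • w.2.2 - w.1.2.1‖ + D * |w.1.2.2.2| := by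
  rw [normalVel, normalVelocity]
  calc |⟪α⁻¹ • w.2.2 - w.1.2.1 - w.1.2.2.2 • perp (rot w.1.2.2.1 (B.r w.2.1)),
        rot w.1.2.2.1 (B.n w.2.1)⟫|
      ≤ ‖α⁻¹ • w.2.2 - w.1.2.1 - w.1.2.2.2 • perp (rot w.1.2.2.1 (B.r w.2.1))‖ *
        ‖rot w.1.2.2.1 (B.n w.2.1)‖ := abs_real_inner_le_norm _ _
    _ ≤ ‖α⁻¹ • w.2.2 - w.1.2.1‖ + ‖w.1.2.2.2 • perp (rot w.1.2.2.1 (B.r w.2.1))‖ := by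
        rw [norm_rot, B.norm_n, mul_one]; exact norm_sub_le _ _
    _ ≤ ‖α⁻¹ • w.2.2 - w.1.2.1‖ + D * |w.1.2.2.2| := by
        rw [norm_smul, norm_perp, norm_rot, Real.norm_eq_abs, mul_comm]
        gcongr
        exact hD _ (B.r_mem _)

/-- The product form separates body and atom for Fubini. The constant depends on α, so the bound
serves only for integrability. -/
theorem exists_abs_normalVel_le (hα : 0 < α) : ∃ c : ℝ, 0 < c ∧ ∀ w : Phase × ℝ × Plane,
    |normalVel B α w| ≤ c * ((1 + ‖w.1.2.1‖ + |w.1.2.2.2|) * (1 + ‖w.2.2‖)) := by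
  obtain ⟨D, hD0, hD⟩ := B.exists_norm_bound
  refine ⟨α⁻¹ + 1 + D, by positivity, fun w => (abs_normalVel_le B hD w).trans ?_⟩
  have h1 : ‖α⁻¹ • w.2.2 - w.1.2.1‖ ≤ α⁻¹ * ‖w.2.2‖ + ‖w.1.2.1‖ := by
    refine (norm_sub_le _ _).trans_eq ?_
    rw [norm_smul, Real.norm_of_nonneg (by positivity)]
  have ha : 0 < α⁻¹ := by positivity
  set a := ‖w.2.2‖
  set b := ‖w.1.2.1‖
  set o := |w.1.2.2.2|
  have ha0 : 0 ≤ a := norm_nonneg _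
  have hb0 : 0 ≤ b := norm_nonneg _
  have ho0 : 0 ≤ o := abs_nonneg _
  have h2 : a ≤ (1 + b + o) * (1 + a) := by nlinarith [mul_nonneg hb0 ha0, mul_nonneg ho0 ha0]
  have h3 : b ≤ (1 + b + o) * (1 + a) := by nlinarith [mul_nonneg hb0 ha0, mul_nonneg ho0 ha0]
  have h4 : o ≤ (1 + b + o) * (1 + a) := by nlinarith [mul_nonneg hb0 ha0, mul_nonneg ho0 ha0]
  nlinarith [mul_le_mul_of_nonneg_left h2 ha.le, mul_le_mul_of_nonneg_left h4 hD0.le]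

theorem integrable_maxwellian_mul_one_add (hβ : 0 < β) :
    Integrable fun v : Plane => maxwellian β v * (1 + ‖v‖) := by
  refine (integrable_maxwellian_mul_exp hβ 1).mono'
    ((continuous_maxwellian β).mul (by fun_prop)).aestronglyMeasurable
    (Filter.Eventually.of_forall fun v => ?_)
  have h := (maxwellian_pos hβ v).le
  rw [Real.norm_of_nonneg (by positivity)]
  gcongr
  rw [one_mul, add_comm]
  exact Real.add_one_le_exp _

theorem isFiniteMeasure_arcMeasure (hα : 0 < α) : IsFiniteMeasure (B.arcMeasure α) := by
  rw [B.arcMeasure_eq hα]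
  refine isFiniteMeasure_withDensity_ofReal ?_
  have hc : Continuous fun σ => 1 + α / 2 * B.curvature σ := by fun_prop
  exact (hc.integrableOn_Icc.mono_set Ioc_subset_Icc_self).2

theorem integrable_maxwellian_collisionMeasure (hα : 0 < α) (hβ : 0 < β) :
    Integrable (fun p : ℝ × Plane => maxwellian β p.2 * (1 + ‖p.2‖)) (B.collisionMeasure α) := by
  have := isFiniteMeasure_arcMeasure B hα
  rw [B.collisionMeasure_eq]
  exact (integrable_maxwellian_mul_one_add hβ).comp_snd _

theorem integrable_bodyMaxwellian_mul_one_add (hβ : 0 < β) (hI : 0 < I) :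
    Integrable fun Y : Phase => (1 + ‖Y.2.1‖ + |Y.2.2.2|) * bodyMaxwellian β I Y := by
  refine (integrable_bodyMaxwellian_mul_exp hβ hI 1).mono'
    (Measurable.aestronglyMeasurable ?_) (Filter.Eventually.of_forall fun Y => ?_)
  · have := measurable_bodyMaxwellian β I
    fun_prop
  have h := (bodyMaxwellian_pos hβ hI Y).le
  rw [Real.norm_of_nonneg (by positivity), mul_comm]
  gcongr
  rw [one_mul, one_mul, ← Real.exp_add]
  linarith [Real.add_one_le_exp (‖Y.2.1‖ + |Y.2.2.2|)]

end Rate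

/-! ### Space-time densities of collisions -/

/-- The measure `dt dY dσ_α dv` on `[0, T]`. -/
noncomputable def timeCollisionMeasure (B : RigidBody) (α T : ℝ) :
    Measure ((ℝ × Phase) × ℝ × Plane) :=
  ((volume.restrict (Icc 0 T)).prod volume).prod (B.collisionMeasure α)

/-- The scattering at fixed time. -/
noncomputable def timeScatter (B : RigidBody) (α I : ℝ) (x : (ℝ × Phase) × ℝ × Plane) :
    (ℝ × Phase) × ℝ × Plane :=
  ((x.1.1, (scatter B α I (x.1.2, x.2)).1), (scatter B α I (x.1.2, x.2)).2)

/-- The density of the incoming collisions of particles distributed according to `f`. -/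
noncomputable def incoming (B : RigidBody) (α β I : ℝ) (f : ℝ → Phase → ℝ)
    (x : (ℝ × Phase) × ℝ × Plane) : ℝ :=
  f x.1.1 x.1.2 * collisionRate B α β I (x.1.2, x.2)

/-- The density of gain minus loss, when the gain is restricted to `G` and the loss to `R`. -/
noncomputable def gainLoss (B : RigidBody) (α β I : ℝ) (G R : Set (Phase × ℝ × Plane))
    (f : ℝ → Phase → ℝ) (x : (ℝ × Phase) × ℝ × Plane) : ℝ :=
  G.indicator 1 (x.1.2, x.2) * incoming B α β I f (timeScatter B α I x) -
    R.indicator 1 (x.1.2, x.2) * incoming B α β I f x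

section SpaceTime

variable (B : RigidBody) {α β I T : ℝ}

theorem measurePreserving_timeScatter (hI : 0 < I) (T : ℝ) :
    MeasurePreserving (timeScatter B α I) (timeCollisionMeasure B α T)
      (timeCollisionMeasure B α T) :=
  (measurePreserving_prodAssoc (volume.restrict (Icc 0 T)) volume (B.collisionMeasure α)).symm.comp
    (((MeasurePreserving.id _).prod (measurePreserving_scatter B hI)).comp
      (measurePreserving_prodAssoc (volume.restrict (Icc 0 T)) volume (B.collisionMeasure α)))

theorem measurable_incoming (α β I : ℝ) {f : ℝ → Phase → ℝ}
    (hf : Measurable fun p : ℝ × Phase => f p.1 p.2) : Measurable (incoming B α β I f) :=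
  (hf.comp measurable_fst).mul ((measurable_collisionRate B α β I).comp
    ((measurable_snd.comp measurable_fst).prodMk measurable_snd))

theorem measurable_timeScatter (α I : ℝ) : Measurable (timeScatter B α I) := by
  have h := (measurable_scatter B α I).comp ((measurable_snd.comp measurable_fst).prodMk
    measurable_snd : Measurable fun x : (ℝ × Phase) × ℝ × Plane => (x.1.2, x.2))
  exact ((measurable_fst.comp measurable_fst).prodMk (measurable_fst.comp h)).prodMk
    (measurable_snd.comp h)

theorem measurable_indicator_collision {G : Set (Phase × ℝ × Plane)} (hG : MeasurableSet G) :
    Measurable fun x : (ℝ × Phase) × ℝ × Plane => G.indicator (1 : Phase × ℝ × Plane → ℝ) (x.1.2, x.2) :=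
  (measurable_one.indicator hG).comp ((measurable_snd.comp measurable_fst).prodMk measurable_snd)

theorem integrable_incoming (hα : 0 < α) (hβ : 0 < β) (hI : 0 < I) {f : ℝ → Phase → ℝ}
    (hf : Measurable fun p : ℝ × Phase => f p.1 p.2)
    (hfi : Integrable (fun p : ℝ × Phase =>
      (1 + ‖p.2.2.1‖ + |p.2.2.2.2|) * bodyMaxwellian β I p.2 * f p.1 p.2)
      ((volume.restrict (Icc 0 T)).prod volume)) :
    Integrable (incoming B α β I f) (timeCollisionMeasure B α T) := by
  obtain ⟨c, hc0, hc⟩ := exists_abs_normalVel_le B hα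
  refine ((hfi.mul_prod (integrable_maxwellian_collisionMeasure B hα hβ)).norm.const_mul
    (1 / α * c)).mono' (measurable_incoming B α β I hf).aestronglyMeasurable
    (Filter.Eventually.of_forall fun x => ?_)
  have h1 := (bodyMaxwellian_pos hβ hI x.1.2).le
  have h2 := (maxwellian_pos hβ x.2.2).le
  have h3 : max (-normalVel B α (x.1.2, x.2)) 0 ≤
      c * ((1 + ‖x.1.2.2.1‖ + |x.1.2.2.2.2|) * (1 + ‖x.2.2‖)) :=
    max_le ((neg_le_abs _).trans (hc _)) (by positivity)
  rw [incoming, norm_mul, Real.norm_of_nonneg (collisionRate_nonneg B hα hβ hI _), collisionRate]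
  simp only [norm_mul, Real.norm_of_nonneg h1, Real.norm_of_nonneg h2,
    Real.norm_of_nonneg (by positivity : 0 ≤ 1 + ‖x.1.2.2.1‖ + |x.1.2.2.2.2|),
    Real.norm_of_nonneg (by positivity : 0 ≤ 1 + ‖x.2.2‖)]
  calc ‖f x.1.1 x.1.2‖ * (1 / α * (bodyMaxwellian β I x.1.2 * maxwellian β x.2.2 *
        max (-normalVel B α (x.1.2, x.2)) 0))
      ≤ ‖f x.1.1 x.1.2‖ * (1 / α * (bodyMaxwellian β I x.1.2 * maxwellian β x.2.2 *
        (c * ((1 + ‖x.1.2.2.1‖ + |x.1.2.2.2.2|) * (1 + ‖x.2.2‖))))) := by gcongr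
    _ = _ := by ring

theorem integrable_indicator_collision_mul {μ : Measure ((ℝ × Phase) × ℝ × Plane)}
    {F : (ℝ × Phase) × ℝ × Plane → ℝ} (hF : Integrable F μ) {G : Set (Phase × ℝ × Plane)}
    (hG : MeasurableSet G) :
    Integrable (fun x => G.indicator (1 : Phase × ℝ × Plane → ℝ) (x.1.2, x.2) * F x) μ := by
  refine hF.mono ((measurable_indicator_collision hG).aestronglyMeasurable.mul
    hF.aestronglyMeasurable) (Filter.Eventually.of_forall fun x => ?_)
  rw [norm_mul]
  refine mul_le_of_le_one_left (norm_nonneg _) ?_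
  by_cases h : (x.1.2, x.2) ∈ G <;> simp [h]

theorem integrable_gainLoss (hI : 0 < I) {f : ℝ → Phase → ℝ}
    (hf : Integrable (incoming B α β I f) (timeCollisionMeasure B α T))
    {G R : Set (Phase × ℝ × Plane)} (hG : MeasurableSet G) (hR : MeasurableSet R) :
    Integrable (gainLoss B α β I G R f) (timeCollisionMeasure B α T) :=
  (integrable_indicator_collision_mul
    ((measurePreserving_timeScatter B hI T).integrable_comp_of_integrable hf) hG).sub
    (integrable_indicator_collision_mul hf hR)

theorem measurable_gainLoss (α β I : ℝ) {f : ℝ → Phase → ℝ}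
    (hf : Measurable fun p : ℝ × Phase => f p.1 p.2)
    {G R : Set (Phase × ℝ × Plane)} (hG : MeasurableSet G) (hR : MeasurableSet R) :
    Measurable (gainLoss B α β I G R f) :=
  ((measurable_indicator_collision hG).mul
    ((measurable_incoming B α β I hf).comp (measurable_timeScatter B α I))).sub
    ((measurable_indicator_collision hR).mul (measurable_incoming B α β I hf))

/-- `Q` is the collision operator with gain restricted to `G` and loss restricted to `R`. -/
def IsCollisionOp (B : RigidBody) (α β I : ℝ) (G R : Set (Phase × ℝ × Plane))
    (Q : (Phase → ℝ) → Phase → ℝ) : Prop :=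
  ∀ (f : ℝ → Phase → ℝ) (s : ℝ) (Y : Phase), bodyMaxwellian β I Y * Q (f s) Y =
    ∫ p, gainLoss B α β I G R f ((s, Y), p) ∂B.collisionMeasure α

/-- Detailed balance moves the Maxwellians to the scattered state, so gain and loss are the same
density evaluated at two points. -/
theorem bodyMaxwellian_mul_collisionIntegrand (hI : 0 < I) (g : Phase → ℝ) (a b : ℝ)
    (w : Phase × ℝ × Plane) :
    bodyMaxwellian β I w.1 * (1 / α * (maxwellian β w.2.2 *
      (a * g (scatter B α I w).1 * max (-normalVel B α (scatter B α I w)) 0 -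
        b * g w.1 * max (-normalVel B α w) 0))) =
    a * (g (scatter B α I w).1 * collisionRate B α β I (scatter B α I w)) -
      b * (g w.1 * collisionRate B α β I w) := by
  rw [collisionRate, collisionRate, maxwellian_mul_bodyMaxwellian_scatter B hI]
  ring

theorem isCollisionOp_boltzmannOp (hI : 0 < I) :
    IsCollisionOp B α β I univ univ (boltzmannOp B α β I) := by
  intro f s Y
  have h : boltzmannOp B α β I (f s) Y = 1 / α * ∫ p : ℝ × Plane, maxwellian β p.2 *
      (f s (scatter B α I (Y, p)).1 * max (-normalVel B α (scatter B α I (Y, p))) 0 -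
        f s Y * max (-normalVel B α (Y, p)) 0) ∂B.collisionMeasure α := rfl
  rw [h, ← integral_const_mul, ← integral_const_mul]
  refine integral_congr_ae (Filter.Eventually.of_forall fun p => ?_)
  have h1 := bodyMaxwellian_mul_collisionIntegrand B (α := α) (β := β) hI (f s) 1 1 (Y, p)
  simp only [one_mul] at h1
  simp only [gainLoss, indicator_univ, Pi.one_apply, one_mul]
  exact h1

/-- The collisions which are not pathological. -/
def goodSet (B : RigidBody) (α I η : ℝ) : Set (Phase × ℝ × Plane) :=
  {w | GoodCollision B α I η w.1.2.2.1 w.2.1 w.2.2 w.1.2.1 w.1.2.2.2}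

/-- The collisions without direct recollision in the backward evolution. -/
def firstSet (B : RigidBody) (α : ℝ) : Set (Phase × ℝ × Plane) :=
  {w | NoBackwardRecollision B α w.1.2.2.1 w.2.1 w.2.2 w.1.2.1 w.1.2.2.2}

theorem isCollisionOp_truncatedBoltzmannOp (hI : 0 < I) (η : ℝ) :
    IsCollisionOp B α β I (goodSet B α I η) (firstSet B α) (truncatedBoltzmannOp B α β I η) := by
  intro f s Y
  have h : truncatedBoltzmannOp B α β I η (f s) Y = 1 / α * ∫ p : ℝ × Plane, maxwellian β p.2 *
      ((goodSet B α I η).indicator 1 (Y, p) * f s (scatter B α I (Y, p)).1 *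
          max (-normalVel B α (scatter B α I (Y, p))) 0 -
        (firstSet B α).indicator 1 (Y, p) * f s Y * max (-normalVel B α (Y, p)) 0)
      ∂B.collisionMeasure α := rfl
  rw [h, ← integral_const_mul, ← integral_const_mul]
  refine integral_congr_ae (Filter.Eventually.of_forall fun p => ?_)
  exact bodyMaxwellian_mul_collisionIntegrand B (α := α) (β := β) hI (f s) _ _ (Y, p)

theorem IsMildSolution.integrable_weight {ε : ℝ} {Q : (Phase → ℝ) → Phase → ℝ} {g₀ : Phase → ℝ}
    {g : ℝ → Phase → ℝ} (h : IsMildSolution α ε β I Q g₀ g) (T : ℝ) :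
    Integrable (fun p : ℝ × Phase =>
      (1 + ‖p.2.2.1‖ + |p.2.2.2.2|) * bodyMaxwellian β I p.2 * g p.1 p.2)
      ((volume.restrict (Icc 0 T)).prod volume) := by
  have h1 := h.integrable T
  rw [IntegrableOn, Measure.volume_eq_prod, ← Measure.prod_restrict, Measure.restrict_univ] at h1
  exact h1

theorem IsMildSolution.isTransported {ε : ℝ} {Q : (Phase → ℝ) → Phase → ℝ} {g₀ : Phase → ℝ}
    {g : ℝ → Phase → ℝ} (h : IsMildSolution α ε β I Q g₀ g) {G R : Set (Phase × ℝ × Plane)}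
    (hG : MeasurableSet G) (hR : MeasurableSet R) (hQ : IsCollisionOp B α β I G R Q)
    (hα : 0 < α) (hβ : 0 < β) (hI : 0 < I) (hg₀ : Measurable g₀) (T : ℝ) :
    IsTransported α ε β I T g₀ g (fun s => Q (g s)) := by
  have hm : Measurable fun p : ℝ × Phase =>
      ∫ y, gainLoss B α β I G R g (p, y) ∂B.collisionMeasure α :=
    (StronglyMeasurable.integral_prod_right'
      (measurable_gainLoss B α β I h.measurable hG hR).stronglyMeasurable).measurable
  have hi := integrable_gainLoss B hI
    (integrable_incoming B hα hβ hI h.measurable (h.integrable_weight T)) hG hR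
  refine ⟨hg₀, h.measurable, ?_, ?_, fun t ht => h.duhamel t ht.1⟩
  · have h1 : (fun p : ℝ × Phase => Q (g p.1) p.2) = fun p => (bodyMaxwellian β I p.2)⁻¹ *
        ∫ y, gainLoss B α β I G R g (p, y) ∂B.collisionMeasure α := by
      ext1 p
      rw [← hQ g p.1 p.2, inv_mul_cancel_left₀ (bodyMaxwellian_pos hβ hI _).ne']
    rw [h1]
    exact ((measurable_bodyMaxwellian β I).comp measurable_snd).inv.mul hm
  · refine hi.integral_prod_left.congr (Filter.Eventually.of_forall fun p => ?_)
    exact (hQ g p.1 p.2).symm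

/-- The balance of the negative part of a solution, in terms of a density of collisions. -/
theorem IsTransported.integral_negPart_le {ε : ℝ} {f₀ : Phase → ℝ} {f q : ℝ → Phase → ℝ}
    (h : IsTransported α ε β I T f₀ f q) (hT : 0 ≤ T) (hβ : 0 < β) (hI : 0 < I)
    (h₀ : Integrable fun Y => bodyMaxwellian β I Y * f₀ Y) (hpos : ∀ Y, 0 ≤ f₀ Y)
    {e A : (ℝ × Phase) × ℝ × Plane → ℝ} (he : Integrable e (timeCollisionMeasure B α T))
    (heq : ∀ᵐ p ∂(volume.restrict (Icc 0 T)).prod (volume : Measure Phase), bodyMaxwellian β I p.2 * q p.1 p.2 =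
      ∫ y, e (p, y) ∂B.collisionMeasure α)
    (hA : Integrable A (timeCollisionMeasure B α T))
    (heA : ∀ᵐ x ∂timeCollisionMeasure B α T, (f x.1.1 x.1.2 < 0 → -e x ≤ A x) ∧
      (0 ≤ f x.1.1 x.1.2 → 0 ≤ A x)) :
    Integrable (fun Y => bodyMaxwellian β I Y * max (-f T Y) 0) ∧
    ∫ Y, bodyMaxwellian β I Y * max (-f T Y) 0 ≤ ∫ x, A x ∂timeCollisionMeasure B α T := by
  obtain ⟨hi, hb⟩ := h.negPart hT hβ hI h₀
  refine ⟨hi, ?_⟩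
  have hz : ∫ Y, bodyMaxwellian β I Y * max (-f₀ Y) 0 = 0 := by
    simp [fun Y => max_eq_right (neg_nonpos.2 (hpos Y))]
  set P : Set (ℝ × Phase) := {p : ℝ × Phase | f p.1 p.2 < 0} with hP
  have hPm : MeasurableSet P := measurableSet_lt h.measurable measurable_const
  have hei : Integrable (fun x => (Prod.fst ⁻¹' P).indicator e x) (timeCollisionMeasure B α T) :=
    he.indicator (hPm.preimage measurable_fst)
  have h1 : ∫ p, P.indicator (fun p => bodyMaxwellian β I p.2 * q p.1 p.2) p
      ∂((volume.restrict (Icc 0 T)).prod volume) =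
      ∫ x, (Prod.fst ⁻¹' P).indicator e x ∂timeCollisionMeasure B α T := by
    rw [timeCollisionMeasure, integral_prod _ hei]
    refine integral_congr_ae (heq.mono fun p hep => ?_)
    by_cases hp : p ∈ P
    · simp [indicator, hp, hep]
    · simp [indicator, hp]
  rw [hb, hz, h1, zero_sub, ← integral_neg]
  -- `A` need only dominate −e where f is negative and be nonnegative elsewhere.
  refine integral_mono_ae hei.neg hA ?_
  filter_upwards [heA] with x hx
  by_cases hp : x.1 ∈ P
  · simpa [indicator, hp] using hx.1 hp
  · simpa [indicator, hp] using hx.2 (not_lt.1 hp)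

end SpaceTime

/-! ### The truncations -/

theorem rot_neg_rot (Θ : Orientation) (x : Plane) : rot Θ (rot (-Θ) x) = x := by
  have hc : cosO (-Θ) = cosO Θ := by
    induction Θ using QuotientAddGroup.induction_on with
    | H t => rw [← AddCircle.coe_neg, cosO_coe, cosO_coe, Real.cos_neg]
  have hs : sinO (-Θ) = -sinO Θ := by
    induction Θ using QuotientAddGroup.induction_on with
    | H t => rw [← AddCircle.coe_neg, sinO_coe, sinO_coe, Real.sin_neg]
  have h := cosO_sq_add_sinO_sq Θ
  apply plane_ext <;> simp only [rot_zero_apply, rot_one_apply, hc, hs]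
  · linear_combination x 0 * h
  · linear_combination x 1 * h

theorem isometry_rot (Θ : Orientation) : Isometry (rot Θ) :=
  Isometry.of_dist_eq fun x y => by rw [dist_eq_norm, dist_eq_norm, ← rot_sub, norm_rot]

theorem infDist_rot_image (Θ : Orientation) (x : Plane) (s : Set Plane) :
    Metric.infDist x (rot Θ '' s) = Metric.infDist (rot (-Θ) x) s := by
  rw [← Metric.infDist_image (isometry_rot Θ) (x := rot (-Θ) x), rot_neg_rot]

section Sets

variable (B : RigidBody) {α β I η : ℝ}

theorem measurableSet_goodSet (α I η : ℝ) : MeasurableSet (goodSet B α I η) := by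
  have h : Measurable fun w : Phase × ℝ × Plane =>
      (w.1.2.2.1, w.2.1, w.2.2, w.1.2.1, w.1.2.2.2) := by fun_prop
  have h1 := (measurable_scatAtom B α I).comp h
  have h2 := (measurable_scatVel B α I).comp h
  have h3 := (measurable_scatAngVel B α I).comp h
  simp only [Function.comp_def] at h1 h2 h3
  have hV : Measurable fun w : Phase × ℝ × Plane => w.1.2.1 := by fun_prop
  have hΩ : Measurable fun w : Phase × ℝ × Plane => w.1.2.2.2 := by fun_prop
  have hv : Measurable fun w : Phase × ℝ × Plane => w.2.2 := by fun_prop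
  refine (measurableSet_le measurable_const (h2.sub hV).norm).inter
    (((measurableSet_le hV.norm measurable_const).inter
      ((measurableSet_le h2.norm measurable_const).inter
        ((measurableSet_le hΩ.abs measurable_const).inter
          (measurableSet_le h3.abs measurable_const)))).inter
      ((measurableSet_le measurable_const (hv.sub (hV.const_smul α)).norm).inter
        (measurableSet_le measurable_const (h1.sub (h2.const_smul α)).norm)))

/-- The times s > 0 form an uncountable, noncompact family. Exhausting them by compact intervals
writes the complement as a countable union of projections of closed sets along compact factors,
which are closed. Rotating the point back instead of the body makes the distance jointly continuous.
-/
theorem measurableSet_firstSet (α : ℝ) : MeasurableSet (firstSet B α) := by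
  set F : ℝ × (Phase × ℝ × Plane) → ℝ := fun x =>
    Metric.infDist (rot (-(x.2.1.2.2.1 - ((x.1 * x.2.1.2.2.2 : ℝ) : Orientation)))
      (rot x.2.1.2.2.1 (B.rEnlarged α x.2.2.1) - x.1 • (α⁻¹ • x.2.2.2 - x.2.1.2.1))) B.carrier
    with hF
  have hFc : Continuous F := by
    have h1 : Continuous fun x : ℝ × (Phase × ℝ × Plane) =>
        ((x.1 * x.2.1.2.2.2 : ℝ) : Orientation) :=
      (AddCircle.continuous_mk' _).comp (by fun_prop)
    have h2 := B.continuous_rEnlarged α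
    exact (Metric.continuous_infDist_pt B.carrier).comp (by fun_prop)
  have hcompl : (firstSet B α)ᶜ = ⋃ k : ℕ, {w | ∃ s : Icc (1 / ((k : ℝ) + 1)) ((k : ℝ) + 1),
      F (s, w) ≤ α / 2} := by
    ext w
    simp only [firstSet, NoBackwardRecollision, mem_compl_iff, mem_ofPred_eq, not_forall, not_lt,
      mem_iUnion, infDist_rot_image]
    constructor
    · rintro ⟨s, hs, h⟩
      obtain ⟨k, hk⟩ := exists_nat_ge (max s (1 / s))
      have hk1 : s ≤ k := (le_max_left _ _).trans hk
      have hk2 : 1 / s ≤ k := (le_max_right _ _).trans hk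
      refine ⟨k, ⟨s, ?_, by linarith⟩, h⟩
      rw [div_le_iff₀ (by positivity)]
      rw [div_le_iff₀ hs] at hk2
      nlinarith
    · rintro ⟨k, ⟨s, hs⟩, h⟩
      exact ⟨s, lt_of_lt_of_le (by positivity) hs.1, h⟩
  rw [← compl_compl (firstSet B α), hcompl]
  refine (MeasurableSet.iUnion fun k => ?_).compl
  have hcl : IsClosed {x : Icc (1 / ((k : ℝ) + 1)) ((k : ℝ) + 1) × (Phase × ℝ × Plane) |
      F (x.1, x.2) ≤ α / 2} := isClosed_le (hFc.comp (by fun_prop)) continuous_const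
  have himg := isClosedMap_snd_of_compactSpace _ hcl
  convert himg.measurableSet using 1
  ext w
  simp

/-- As scattering is an involution, it merely exchanges primed and unprimed velocities, in which the
conditions of (G) are symmetric. -/
theorem goodSet_scatter (hI : 0 < I) (w : Phase × ℝ × Plane) :
    scatter B α I w ∈ goodSet B α I η ↔ w ∈ goodSet B α I η := by
  simp only [goodSet, mem_ofPred_eq, GoodCollision, scatter, scatVel_scat B hI, scatAtom_scat B hI,
    scatAngVel_scat B hI]
  rw [norm_sub_rev]
  tauto

theorem norm_inv_smul_sub (hα : 0 < α) (v V : Plane) :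
    ‖α⁻¹ • v - V‖ = α⁻¹ * ‖v - α • V‖ := by
  have : α⁻¹ • v - V = α⁻¹ • (v - α • V) := by
    rw [smul_sub, inv_smul_smul₀ hα.ne']
  rw [this, norm_smul, Real.norm_of_nonneg (by positivity)]

/-- The constant `K` and the smallness of `α` allow to exclude recollisions. -/
def ExcludesRecollision (B : RigidBody) (α η : ℝ) : Prop :=
  ∀ w : Phase × ℝ × Plane, normalVel B α w < 0 → |w.1.2.2.2| ≤ |Real.log α| →
    α ^ (2 / 3 + η) ≤ ‖w.2.2 - α • w.1.2.1‖ → w ∈ firstSet B α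

theorem excludesRecollision {K : ℝ} (hK0 : 0 < K)
    (hK : ∀ (Θ : Orientation) (σ : ℝ) (v V : Plane) (Ω : ℝ),
      normalVelocity B α Θ σ v V Ω < 0 → K * |Ω| ≤ ‖α⁻¹ • v - V‖ →
      NoBackwardRecollision B α Θ σ v V Ω)
    (hα : 0 < α) (hsmall : K * |Real.log α| ≤ α ^ (-(1 / 3) + η)) :
    ExcludesRecollision B α η := by
  intro w h1 h2 h3
  refine hK _ _ _ _ _ h1 ?_
  rw [norm_inv_smul_sub hα]
  calc K * |w.1.2.2.2| ≤ K * |Real.log α| := by gcongr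
    _ ≤ α ^ (-(1 / 3) + η) := hsmall
    _ = α⁻¹ * α ^ (2 / 3 + η) := by
        rw [← Real.rpow_neg_one, ← Real.rpow_add hα]; congr 1; ring
    _ ≤ α⁻¹ * ‖w.2.2 - α • w.1.2.1‖ := by gcongr

/-- A good collision is either incoming, hence free of recollision, or has zero rate. -/
theorem goodSet_indicator_le (hα : 0 < α) (hβ : 0 < β) (hI : 0 < I)
    (hex : ExcludesRecollision B α η) (w : Phase × ℝ × Plane) :
    (goodSet B α I η).indicator 1 w * collisionRate B α β I w ≤
      (firstSet B α).indicator 1 w * collisionRate B α β I w := by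
  have hr := collisionRate_nonneg B hα hβ hI w
  by_cases hG : w ∈ goodSet B α I η
  · by_cases hn : normalVel B α w < 0
    · have hf := hex w hn hG.2.1.2.2.1 hG.2.2.1
      simp [hG, hf]
    · have : collisionRate B α β I w = 0 := by
        rw [collisionRate, max_eq_right (by linarith [not_lt.1 hn])]; simp
      simp [this]
  · rw [indicator_of_notMem hG, zero_mul]
    exact mul_nonneg (indicator_nonneg (fun _ _ => zero_le_one) _) hr

theorem integrable_collisionRate_section (hα : 0 < α) (hβ : 0 < β) (Y : Phase) :
    Integrable (fun p : ℝ × Plane => maxwellian β p.2 * normalVel B α (Y, p))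
      (B.collisionMeasure α) := by
  obtain ⟨c, hc0, hc⟩ := exists_abs_normalVel_le B hα
  refine ((integrable_maxwellian_collisionMeasure B hα hβ).const_mul
    (c * (1 + ‖Y.2.1‖ + |Y.2.2.2|))).mono' ?_ (Filter.Eventually.of_forall fun p => ?_)
  · have h1 := (continuous_normalVel B α).measurable
    have h2 := (continuous_maxwellian β).measurable
    fun_prop
  · have h2 := (maxwellian_pos hβ p.2).le
    rw [norm_mul, Real.norm_of_nonneg h2, Real.norm_eq_abs]
    calc maxwellian β p.2 * |normalVel B α (Y, p)|
        ≤ maxwellian β p.2 * (c * ((1 + ‖Y.2.1‖ + |Y.2.2.2|) * (1 + ‖p.2‖))) := by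
          gcongr; exact hc (Y, p)
      _ = _ := by ring

/-- The restricted gain of a constant is at most its restricted loss. -/
theorem integral_gain_sub_loss_nonpos (hα : 0 < α) (hβ : 0 < β) (hI : 0 < I)
    (hex : ExcludesRecollision B α η) (Y : Phase) :
    ∫ p, ((goodSet B α I η).indicator 1 (Y, p) * collisionRate B α β I (scatter B α I (Y, p)) -
      (firstSet B α).indicator 1 (Y, p) * collisionRate B α β I (Y, p)) ∂B.collisionMeasure α
      ≤ 0 := by
  have hm := (bodyMaxwellian_pos hβ hI Y).le
  have hM : ∀ v, 0 ≤ maxwellian β v := fun v => (maxwellian_pos hβ v).le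
  have hF0 : ∀ p, 0 ≤ (firstSet B α).indicator 1 (Y, p) * collisionRate B α β I (Y, p) := fun p =>
    mul_nonneg (indicator_nonneg (fun _ _ => zero_le_one) _) (collisionRate_nonneg B hα hβ hI _)
  by_cases hΩ : |Y.2.2.2| ≤ |Real.log α|
  swap
  · refine integral_nonpos fun p => ?_
    have : (Y, p) ∉ goodSet B α I η := fun h => hΩ h.2.1.2.2.1
    rw [Pi.zero_apply, indicator_of_notMem this, zero_mul]
    linarith [hF0 p]
  -- Of all the conditions in (G), only the one on |v − αV| is kept: it does not involve σ, so it
  -- survives the flux cancellation, and it suffices to exclude recollisions.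
  set Z : Set Plane := {v | α ^ (2 / 3 + η) ≤ ‖v - α • Y.2.1‖} with hZ
  have hZm : MeasurableSet Z := measurableSet_le measurable_const (by fun_prop)
  set a : ℝ × Plane → ℝ := fun p => Z.indicator 1 p.2 * maxwellian β p.2 with ha
  have ha0 : ∀ p, 0 ≤ a p := fun p =>
    mul_nonneg (indicator_nonneg (fun _ _ => zero_le_one) _) (hM _)
  have hint : Integrable (fun p : ℝ × Plane => a p * normalVel B α (Y, p))
      (B.collisionMeasure α) := by
    refine ((integrable_collisionRate_section B hα hβ Y).indicator
      (hZm.preimage measurable_snd)).congr (Filter.Eventually.of_forall fun p => ?_)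
    by_cases hp : p.2 ∈ Z <;> simp [ha, hp, indicator]
  -- On `Z` the gain is at most the full gain and the loss is the full loss; off `Z` there is no
  -- gain.
  have hbound : ∀ p, (goodSet B α I η).indicator 1 (Y, p) *
      collisionRate B α β I (scatter B α I (Y, p)) -
      (firstSet B α).indicator 1 (Y, p) * collisionRate B α β I (Y, p) ≤
      1 / α * bodyMaxwellian β I Y * (a p * normalVel B α (Y, p)) := by
    intro p
    have e1 : collisionRate B α β I (scatter B α I (Y, p)) - collisionRate B α β I (Y, p) =
        1 / α * bodyMaxwellian β I Y * (maxwellian β p.2 * normalVel B α (Y, p)) := by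
      rw [collisionRate_scatter B hα hI, collisionRate]
      rcases le_total (normalVel B α (Y, p)) 0 with h | h
      · rw [max_eq_right h, max_eq_left (by linarith)]; ring
      · rw [max_eq_left h, max_eq_right (by linarith)]; ring
    have g0 := collisionRate_nonneg B hα hβ hI (scatter B α I (Y, p))
    have r0 := collisionRate_nonneg B hα hβ hI (Y, p)
    by_cases hp : p.2 ∈ Z
    · have e2 : a p = maxwellian β p.2 := by simp [ha, hp]
      have e3 : collisionRate B α β I (Y, p) ≤
          (firstSet B α).indicator 1 (Y, p) * collisionRate B α β I (Y, p) := by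
        by_cases hn : normalVel B α (Y, p) < 0
        · simp [hex (Y, p) hn hΩ hp]
        · have : collisionRate B α β I (Y, p) = 0 := by
            rw [collisionRate, max_eq_right (by linarith [not_lt.1 hn])]; simp
          simp [this]
      have e4 : (goodSet B α I η).indicator 1 (Y, p) *
          collisionRate B α β I (scatter B α I (Y, p)) ≤
          collisionRate B α β I (scatter B α I (Y, p)) :=
        mul_le_of_le_one_left g0 (indicator_le_self' (fun _ _ => zero_le_one) _)
      rw [e2, ← e1]
      linarith
    · have e2 : a p = 0 := by simp [ha, hp]
      have : (Y, p) ∉ goodSet B α I η := fun h => hp h.2.2.1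
      rw [e2, indicator_of_notMem this]
      linarith [hF0 p]
  have hzero : ∫ p, 1 / α * bodyMaxwellian β I Y * (a p * normalVel B α (Y, p))
      ∂B.collisionMeasure α = 0 := by
    -- At fixed v the weight is constant in σ, so the flux over the closed boundary is zero.
    have h0 : ∀ v, ∫ σ, a (σ, v) * normalVel B α (Y, σ, v) ∂B.arcMeasure α = 0 := fun v => by
      have e : ∀ σ, a (σ, v) * normalVel B α (Y, σ, v) =
        Z.indicator 1 v * maxwellian β v * normalVelocity B α Y.2.2.1 σ v Y.2.1 Y.2.2.2 :=
        fun σ => rfl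
      simp_rw [e]
      rw [integral_const_mul, integral_normalVelocity B hα, mul_zero]
    rw [B.collisionMeasure_eq] at hint
    rw [integral_const_mul, B.collisionMeasure_eq, integral_prod_symm _ hint,
      integral_congr_ae (Filter.Eventually.of_forall h0), integral_zero, mul_zero]
  rw [← hzero]
  -- Without integrability the Bochner integral is 0 by convention, and the bound is still true.
  by_cases hi : Integrable (fun p => (goodSet B α I η).indicator 1 (Y, p) *
      collisionRate B α β I (scatter B α I (Y, p)) -
      (firstSet B α).indicator 1 (Y, p) * collisionRate B α β I (Y, p)) (B.collisionMeasure α)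
  · exact integral_mono hi (hint.const_mul _) hbound
  · rw [integral_undef hi, hzero]

end Sets

/-! ### Comparison principles -/

section Comparison

variable (B : RigidBody) {α β I η ε T : ℝ}

/-- Integrability against the equilibrium with the weight `1 + |V| + |Ω|`. -/
def WeightIntegrable (β I T : ℝ) (f : ℝ → Phase → ℝ) : Prop :=
  Integrable (fun p : ℝ × Phase =>
    (1 + ‖p.2.2.1‖ + |p.2.2.2.2|) * bodyMaxwellian β I p.2 * f p.1 p.2)
    ((volume.restrict (Icc 0 T)).prod volume)

theorem weightIntegrable_const (hβ : 0 < β) (hI : 0 < I) (T c : ℝ) :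
    WeightIntegrable β I T fun _ _ => c :=
  ((integrable_bodyMaxwellian_mul_one_add hβ hI).comp_snd _).mul_const c

theorem WeightIntegrable.add {f g : ℝ → Phase → ℝ} (hf : WeightIntegrable β I T f)
    (hg : WeightIntegrable β I T g) : WeightIntegrable β I T fun t Y => f t Y + g t Y :=
  (Integrable.add hf hg).congr (Filter.Eventually.of_forall fun p => by
    simp only [Pi.add_apply]; ring)

theorem WeightIntegrable.const_mul {f : ℝ → Phase → ℝ} (hf : WeightIntegrable β I T f) (c : ℝ) :
    WeightIntegrable β I T fun t Y => c * f t Y :=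
  (Integrable.const_mul hf c).congr (Filter.Eventually.of_forall fun p => by ring)

theorem WeightIntegrable.negPart {f : ℝ → Phase → ℝ} (hβ : 0 < β) (hI : 0 < I)
    (hf : WeightIntegrable β I T f) : WeightIntegrable β I T fun t Y => max (-f t Y) 0 :=
  (Integrable.neg_part hf).congr (Filter.Eventually.of_forall fun p => by
    have h := (bodyMaxwellian_pos hβ hI p.2).le
    simp only
    rw [mul_max_of_nonneg _ _ (by positivity), mul_zero, mul_neg])

/-- Change of variables by the scattering; the symmetric set `G` is its own preimage. -/
theorem integral_indicator_timeScatter (hI : 0 < I) {G : Set (Phase × ℝ × Plane)}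
    (hG : MeasurableSet G) (hsymm : ∀ w, scatter B α I w ∈ G ↔ w ∈ G)
    {F : (ℝ × Phase) × ℝ × Plane → ℝ} (hF : Measurable F) :
    ∫ x, G.indicator 1 (x.1.2, x.2) * F (timeScatter B α I x) ∂timeCollisionMeasure B α T =
      ∫ x, G.indicator 1 (x.1.2, x.2) * F x ∂timeCollisionMeasure B α T := by
  have e := integral_comp_measurePreserving (measurePreserving_timeScatter B (α := α) hI T)
    (g := fun x => G.indicator 1 (x.1.2, x.2) * F x)
    ((measurable_indicator_collision hG).mul hF).aestronglyMeasurable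
  rw [← e]
  refine integral_congr_ae (Filter.Eventually.of_forall fun x => ?_)
  have h : G.indicator (1 : Phase × ℝ × Plane → ℝ)
      ((timeScatter B α I x).1.2, (timeScatter B α I x).2) = G.indicator 1 (x.1.2, x.2) := by
    have h1 := hsymm (x.1.2, x.2)
    by_cases h2 : (x.1.2, x.2) ∈ G
    · rw [indicator_of_mem h2, indicator_of_mem (by exact h1.2 h2)]; rfl
    · rw [indicator_of_notMem h2, indicator_of_notMem (by exact fun h3 => h2 (h1.1 h3))]
  simp only [h]

theorem integral_gainLoss (hI : 0 < I) {G R : Set (Phase × ℝ × Plane)} (hG : MeasurableSet G)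
    (hR : MeasurableSet R) (hsymm : ∀ w, scatter B α I w ∈ G ↔ w ∈ G) {f : ℝ → Phase → ℝ}
    (hf : Measurable fun p : ℝ × Phase => f p.1 p.2)
    (hfi : Integrable (incoming B α β I f) (timeCollisionMeasure B α T)) :
    ∫ x, gainLoss B α β I G R f x ∂timeCollisionMeasure B α T =
      (∫ x, G.indicator 1 (x.1.2, x.2) * incoming B α β I f x ∂timeCollisionMeasure B α T) -
        ∫ x, R.indicator 1 (x.1.2, x.2) * incoming B α β I f x ∂timeCollisionMeasure B α T := by
  rw [← integral_indicator_timeScatter B hI hG hsymm (measurable_incoming B α β I hf)]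
  exact integral_sub (integrable_indicator_collision_mul
    ((measurePreserving_timeScatter B hI T).integrable_comp_of_integrable hfi) hG)
    (integrable_indicator_collision_mul hfi hR)

theorem integrable_bodyMaxwellian_mul_of_bounded (hβ : 0 < β) (hI : 0 < I) {f : Phase → ℝ}
    (hf : Measurable f) {C : ℝ} (hC : ∀ Y, |f Y| ≤ C) :
    Integrable fun Y => bodyMaxwellian β I Y * f Y := by
  have hm := measurable_bodyMaxwellian β I
  refine ((integrable_bodyMaxwellian_mul_exp hβ hI 0).const_mul C).mono'
    (hm.mul hf).aestronglyMeasurable (Filter.Eventually.of_forall fun Y => ?_)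
  rw [norm_mul, Real.norm_of_nonneg (bodyMaxwellian_pos hβ hI Y).le, mul_comm]
  simp only [zero_mul, Real.exp_zero, mul_one]
  exact mul_le_mul_of_nonneg_right (hC Y) (bodyMaxwellian_pos hβ hI Y).le

/-- Maximum principle for the truncated equation. -/
theorem IsMildSolution.nonneg_const_add {g₀ : Phase → ℝ} {g : ℝ → Phase → ℝ}
    (h : IsMildSolution α ε β I (truncatedBoltzmannOp B α β I η) g₀ g)
    (hα : 0 < α) (hβ : 0 < β) (hI : 0 < I) (hex : ExcludesRecollision B α η)
    (hg₀ : Measurable g₀) {C c : ℝ} (hC : 0 ≤ C) (hb : ∀ Y, |g₀ Y| ≤ C) (hc : |c| = 1)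
    (hT : 0 ≤ T) : ∀ᵐ Y, 0 ≤ C + c * g T Y := by
  have hGm := measurableSet_goodSet B α I η
  have hRm := measurableSet_firstSet B α
  have hQ := isCollisionOp_truncatedBoltzmannOp B (α := α) (β := β) hI η
  set G := goodSet B α I η with hG
  set R := firstSet B α with hR
  have ht := h.isTransported B hGm hRm hQ hα hβ hI hg₀ T
  have hw : WeightIntegrable β I T g := h.integrable_weight T
  have htr := (ht.smul c).const_add C
  set f : ℝ → Phase → ℝ := fun t Y => C + c * g t Y with hf
  set n : ℝ → Phase → ℝ := fun t Y => max (-f t Y) 0 with hn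
  have hfm : Measurable fun p : ℝ × Phase => f p.1 p.2 := htr.measurable
  have hnm : Measurable fun p : ℝ × Phase => n p.1 p.2 := hfm.neg.max measurable_const
  have hnw : WeightIntegrable β I T n :=
    ((weightIntegrable_const hβ hI T C).add (hw.const_mul c)).negPart hβ hI
  have hni := integrable_incoming B hα hβ hI hnm hnw
  have hCm : Measurable fun _ : ℝ × Phase => C := measurable_const
  have hCi := integrable_incoming B hα hβ hI (f := fun _ _ => C) hCm (weightIntegrable_const hβ hI T C)
  have hgi := integrable_incoming B hα hβ hI h.measurable hw
  set P : Set (ℝ × Phase) := {p : ℝ × Phase | f p.1 p.2 < 0} with hP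
  have hPm : MeasurableSet P := measurableSet_lt hfm measurable_const
  have hA1 : Integrable ((Prod.fst ⁻¹' P).indicator (gainLoss B α β I G R fun _ _ => C))
      (timeCollisionMeasure B α T) :=
    (integrable_gainLoss B hI hCi hGm hRm).indicator (hPm.preimage measurable_fst)
  have hA2 := integrable_gainLoss B hI hni hGm hRm
  have hr := fun w => collisionRate_nonneg B hα hβ hI w
  have hb0 : ∀ Y, 0 ≤ C + c * g₀ Y := fun Y => by
    have h1 : |c * g₀ Y| ≤ C := by rw [abs_mul, hc, one_mul]; exact hb Y
    linarith [neg_abs_le (c * g₀ Y)]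
  have hi0 : Integrable fun Y => bodyMaxwellian β I Y * (C + c * g₀ Y) := by
    refine integrable_bodyMaxwellian_mul_of_bounded hβ hI (by fun_prop) (C := 2 * C) fun Y => ?_
    have h1 : |c * g₀ Y| ≤ C := by rw [abs_mul, hc, one_mul]; exact hb Y
    rw [abs_of_nonneg (hb0 Y)]
    linarith [le_abs_self (c * g₀ Y)]
  -- Write c g = f − C. The source of f is the operator at f minus the operator at the constant C.
  -- Where f < 0, −f equals n at Y and is at most n at Y', which gives the majorant `A`; where f ≥ 0
  -- only the gain of n remains.
  have hmain := htr.integral_negPart_le B hT hβ hI hi0 hb0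
    (e := fun x => c * gainLoss B α β I G R g x)
    (A := fun x => (Prod.fst ⁻¹' P).indicator (gainLoss B α β I G R fun _ _ => C) x +
      gainLoss B α β I G R n x)
    ((integrable_gainLoss B hI hgi hGm hRm).const_mul c)
    (Filter.Eventually.of_forall fun p => by
      rw [integral_const_mul, ← hQ g p.1 p.2]; ring)
    (hA1.add hA2) (Filter.Eventually.of_forall fun x => by
      have i1 : 0 ≤ G.indicator (1 : Phase × ℝ × Plane → ℝ) (x.1.2, x.2) :=
        indicator_nonneg (fun _ _ => zero_le_one) _
      have r1 := hr (scatter B α I (x.1.2, x.2))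
      set r := collisionRate B α β I (x.1.2, x.2)
      set r' := collisionRate B α β I (scatter B α I (x.1.2, x.2))
      set Y' := (scatter B α I (x.1.2, x.2)).1
      have n' : -f x.1.1 Y' ≤ n x.1.1 Y' := le_max_left _ _
      have n0 : 0 ≤ n x.1.1 Y' := le_max_right _ _
      have e1 : gainLoss B α β I G R g x = G.indicator 1 (x.1.2, x.2) * (g x.1.1 Y' * r') -
        R.indicator 1 (x.1.2, x.2) * (g x.1.1 x.1.2 * r) := rfl
      have e2 : gainLoss B α β I G R n x = G.indicator 1 (x.1.2, x.2) * (n x.1.1 Y' * r') -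
        R.indicator 1 (x.1.2, x.2) * (n x.1.1 x.1.2 * r) := rfl
      have e3 : gainLoss B α β I G R (fun _ _ => C) x = G.indicator 1 (x.1.2, x.2) * (C * r') -
        R.indicator 1 (x.1.2, x.2) * (C * r) := rfl
      constructor
      · intro hx
        have hxP : x ∈ Prod.fst ⁻¹' P := hx
        have n2 : n x.1.1 x.1.2 = -f x.1.1 x.1.2 := max_eq_left (by linarith)
        rw [indicator_of_mem hxP, e1, e2, e3, n2]
        simp only [hf] at n' ⊢
        nlinarith [mul_nonneg (mul_nonneg i1 r1) (sub_nonneg.2 n')]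
      · intro hx
        have hxP : x ∉ Prod.fst ⁻¹' P := fun h => absurd hx (not_le.2 h)
        have n2 : n x.1.1 x.1.2 = 0 := max_eq_right (by linarith)
        rw [indicator_of_notMem hxP, e2, n2]
        have := mul_nonneg i1 (mul_nonneg n0 r1)
        linarith)
  have hle : ∫ x, ((Prod.fst ⁻¹' P).indicator (gainLoss B α β I G R fun _ _ => C) x +
      gainLoss B α β I G R n x) ∂timeCollisionMeasure B α T ≤ 0 := by
    rw [integral_add hA1 hA2]
    have l1 : ∫ x, (Prod.fst ⁻¹' P).indicator (gainLoss B α β I G R fun _ _ => C) x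
        ∂timeCollisionMeasure B α T ≤ 0 := by
      rw [timeCollisionMeasure, integral_prod _ hA1]
      refine integral_nonpos fun p => ?_
      by_cases hp : p ∈ P
      · have e : ∀ y, (Prod.fst ⁻¹' P).indicator (gainLoss B α β I G R fun _ _ => C) (p, y) =
            C * (G.indicator 1 (p.2, y) * collisionRate B α β I (scatter B α I (p.2, y)) -
              R.indicator 1 (p.2, y) * collisionRate B α β I (p.2, y)) := by
          intro y
          rw [indicator_of_mem (by exact hp)]
          simp only [gainLoss, incoming, timeScatter]
          ring
        simp only [e, Pi.zero_apply]
        rw [integral_const_mul]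
        exact mul_nonpos_of_nonneg_of_nonpos hC
          (integral_gain_sub_loss_nonpos B hα hβ hI hex p.2)
      · have e : ∀ y, (Prod.fst ⁻¹' P).indicator (gainLoss B α β I G R fun _ _ => C) (p, y) = 0 :=
          fun y => indicator_of_notMem (by exact hp) _
        simp [e]
    -- Symmetry of `G` turns the gain of n into an incoming integral restricted to `G`, which the
    -- loss dominates by `goodSet_indicator_le`.
    have l2 : ∫ x, gainLoss B α β I G R n x ∂timeCollisionMeasure B α T ≤ 0 := by
      rw [integral_gainLoss B hI hGm hRm (goodSet_scatter B hI) hnm hni, sub_nonpos]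
      refine integral_mono (integrable_indicator_collision_mul hni hGm)
        (integrable_indicator_collision_mul hni hRm) fun x => ?_
      have l3 := goodSet_indicator_le B hα hβ hI hex (x.1.2, x.2)
      have n0 : 0 ≤ n x.1.1 x.1.2 := le_max_right _ _
      simp only [incoming]
      nlinarith [mul_le_mul_of_nonneg_left l3 n0]
    linarith
  have hpos : ∀ Y, 0 ≤ bodyMaxwellian β I Y * max (-f T Y) 0 := fun Y =>
    mul_nonneg (bodyMaxwellian_pos hβ hI Y).le (le_max_right _ _)
  have hz := (integral_eq_zero_iff_of_nonneg hpos hmain.1).1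
    (le_antisymm (hmain.2.trans hle) (integral_nonneg hpos))
  filter_upwards [hz] with Y hY
  by_contra hneg
  have h1 : 0 < max (-f T Y) 0 := lt_max_of_lt_left (by simp only [hf]; linarith [not_le.1 hneg])
  exact absurd hY (mul_pos (bodyMaxwellian_pos hβ hI Y) h1).ne'

/-- The mass of the collisions removed by the truncation. -/
noncomputable def truncationError (B : RigidBody) (α β I η : ℝ) : ℝ :=
  ∫ w, ((goodSet B α I η)ᶜ.indicator 1 w + (firstSet B α)ᶜ.indicator 1 w) *
    collisionRate B α β I w ∂((volume : Measure Phase).prod (B.collisionMeasure α))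

/-- Stability: the truncated solution differs from the solution by the truncated mass. -/
theorem integral_negPart_sub_le {g₀ : Phase → ℝ} {g gt : ℝ → Phase → ℝ}
    (h : IsMildSolution α ε β I (boltzmannOp B α β I) g₀ g)
    (ht : IsMildSolution α ε β I (truncatedBoltzmannOp B α β I η) g₀ gt)
    (hα : 0 < α) (hβ : 0 < β) (hI : 0 < I)
    (hg₀ : Measurable g₀) {C c : ℝ} (hc : |c| = 1)
    (hbd : ∀ t, 0 ≤ t → ∀ᵐ Y, |gt t Y| ≤ C) (hT : 0 ≤ T) :
    Integrable (fun Y => bodyMaxwellian β I Y * max (-(c * g T Y + -c * gt T Y)) 0) ∧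
    ∫ Y, bodyMaxwellian β I Y * max (-(c * g T Y + -c * gt T Y)) 0 ≤
      C * (T * truncationError B α β I η) := by
  have hGm := measurableSet_goodSet B α I η
  have hRm := measurableSet_firstSet B α
  have hQt := isCollisionOp_truncatedBoltzmannOp B (α := α) (β := β) hI η
  have hQ := isCollisionOp_boltzmannOp B (α := α) (β := β) hI
  have hGs := goodSet_scatter B (α := α) (I := I) (η := η) hI
  rw [truncationError]
  set G := goodSet B α I η with hG
  set R := firstSet B α with hR
  have t1 := h.isTransported B MeasurableSet.univ MeasurableSet.univ hQ hα hβ hI hg₀ T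
  have t2 := ht.isTransported B hGm hRm hQt hα hβ hI hg₀ T
  have hw : WeightIntegrable β I T g := h.integrable_weight T
  have hwt : WeightIntegrable β I T gt := ht.integrable_weight T
  have htr := (t1.smul c).add (t2.smul (-c)) hβ hI
  set f : ℝ → Phase → ℝ := fun t Y => c * g t Y + -c * gt t Y with hf
  set n : ℝ → Phase → ℝ := fun t Y => max (-f t Y) 0 with hn
  have hfm : Measurable fun p : ℝ × Phase => f p.1 p.2 := htr.measurable
  have hnm : Measurable fun p : ℝ × Phase => n p.1 p.2 := hfm.neg.max measurable_const
  have hnw : WeightIntegrable β I T n :=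
    ((hw.const_mul c).add (hwt.const_mul (-c))).negPart hβ hI
  have hni := integrable_incoming B hα hβ hI hnm hnw
  have h1m : Measurable fun _ : ℝ × Phase => (1 : ℝ) := measurable_const
  set one : ℝ → Phase → ℝ := fun _ _ => 1 with hone
  have h1i := integrable_incoming B hα hβ hI (f := one) h1m (weightIntegrable_const hβ hI T 1)
  have hgi := integrable_incoming B hα hβ hI h.measurable hw
  have hgti := integrable_incoming B hα hβ hI ht.measurable hwt
  have hr := fun w => collisionRate_nonneg B hα hβ hI w
  have hmp := measurePreserving_timeScatter B (α := α) hI T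
  have hbd' : ∀ᵐ x ∂timeCollisionMeasure B α T, |gt x.1.1 x.1.2| ≤ C := by
    have hset : MeasurableSet {p : ℝ × Phase | |gt p.1 p.2| ≤ C} :=
      measurableSet_le ht.measurable.abs measurable_const
    have b1 : ∀ᵐ p ∂(volume.restrict (Icc 0 T)).prod (volume : Measure Phase),
        |gt p.1 p.2| ≤ C :=
      (Measure.ae_prod_iff_ae_ae (p := fun p : ℝ × Phase => |gt p.1 p.2| ≤ C) hset).2
        ((ae_restrict_iff' measurableSet_Icc).2
          (Filter.Eventually.of_forall fun t ht => hbd t ht.1))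
    exact Measure.quasiMeasurePreserving_fst.ae b1
  have hA1 := integrable_gainLoss B hI hni MeasurableSet.univ MeasurableSet.univ
  have hA2 := integrable_indicator_collision_mul (hmp.integrable_comp_of_integrable h1i) hGm.compl
  have hA3 := integrable_indicator_collision_mul h1i hRm.compl
  have gi1 := integrable_gainLoss B hI hgi MeasurableSet.univ MeasurableSet.univ
  have gi2 := integrable_gainLoss B hI hgti hGm hRm
  -- The source of f = c(g − g̃) is the full operator at f plus c times the removed collisions
  -- acting on g̃. The latter are bounded by C times their rates: outside `G` at the scattered
  -- state, outside `R` at the state itself.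
  have hmain := htr.integral_negPart_le B hT hβ hI (by simp) (fun Y => by simp)
    (e := fun x => c * gainLoss B α β I univ univ g x + -c * gainLoss B α β I G R gt x)
    (A := fun x => gainLoss B α β I univ univ n x +
      C * (Gᶜ.indicator 1 (x.1.2, x.2) * (incoming B α β I one ∘ timeScatter B α I) x +
        Rᶜ.indicator 1 (x.1.2, x.2) * incoming B α β I one x))
    ((gi1.const_mul c).add (gi2.const_mul (-c)))
    (by
      filter_upwards [gi1.prod_right_ae, gi2.prod_right_ae] with p h1 h2
      rw [integral_add (h1.const_mul c) (h2.const_mul (-c)), integral_const_mul,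
        integral_const_mul, ← hQ g p.1 p.2, ← hQt gt p.1 p.2]
      ring)
    (hA1.add ((hA2.add hA3).const_mul C)) (by
      -- The almost everywhere bound on g̃ is also needed at Y', and scattering preserves null sets.
      filter_upwards [hbd', hmp.quasiMeasurePreserving.ae hbd'] with x hx1 hx2
      have r0 := hr (x.1.2, x.2)
      have r1 := hr (scatter B α I (x.1.2, x.2))
      change |gt x.1.1 (scatter B α I (x.1.2, x.2)).1| ≤ C at hx2
      set r := collisionRate B α β I (x.1.2, x.2)
      set r' := collisionRate B α β I (scatter B α I (x.1.2, x.2))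
      set Y' := (scatter B α I (x.1.2, x.2)).1
      have n' : -f x.1.1 Y' ≤ n x.1.1 Y' := le_max_left _ _
      have n0 : 0 ≤ n x.1.1 Y' := le_max_right _ _
      have hC : 0 ≤ C := (abs_nonneg _).trans hx1
      have e1 : gainLoss B α β I univ univ g x = g x.1.1 Y' * r' - g x.1.1 x.1.2 * r := by
        simp only [gainLoss, indicator_univ, Pi.one_apply, one_mul]; rfl
      have e2 : gainLoss B α β I univ univ n x = n x.1.1 Y' * r' - n x.1.1 x.1.2 * r := by
        simp only [gainLoss, indicator_univ, Pi.one_apply, one_mul]; rfl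
      have e3 : gainLoss B α β I G R gt x = G.indicator 1 (x.1.2, x.2) * (gt x.1.1 Y' * r') -
        R.indicator 1 (x.1.2, x.2) * (gt x.1.1 x.1.2 * r) := rfl
      have e4 : incoming B α β I one x = r := one_mul _
      have e5 : (incoming B α β I one ∘ timeScatter B α I) x = r' := one_mul _
      have e6 : ∀ (S : Set (Phase × ℝ × Plane)) w, Sᶜ.indicator (1 : Phase × ℝ × Plane → ℝ) w =
          1 - S.indicator 1 w := fun S w => by
        by_cases hw : w ∈ S <;> simp [hw]
      have j1 : 0 ≤ 1 - G.indicator (1 : Phase × ℝ × Plane → ℝ) (x.1.2, x.2) := by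
        rw [← e6]; exact indicator_nonneg (fun _ _ => zero_le_one) _
      have j2 : 0 ≤ 1 - R.indicator (1 : Phase × ℝ × Plane → ℝ) (x.1.2, x.2) := by
        rw [← e6]; exact indicator_nonneg (fun _ _ => zero_le_one) _
      rw [e2, e4, e5, e6, e6]
      have p1 := mul_nonneg j1 r1
      have p2 := mul_nonneg j2 r0
      constructor
      · intro hx
        have n2 : n x.1.1 x.1.2 = -f x.1.1 x.1.2 := max_eq_left (by linarith)
        have c1 : -(c * gt x.1.1 Y') ≤ C := by
          refine (neg_le_abs _).trans ?_
          rwa [abs_mul, hc, one_mul]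
        have c2 : c * gt x.1.1 x.1.2 ≤ C := by
          refine (le_abs_self _).trans ?_
          rwa [abs_mul, hc, one_mul]
        rw [e1, e3, n2]
        simp only [hf] at n' ⊢
        nlinarith [mul_nonneg p1 (sub_nonneg.2 c1), mul_nonneg p2 (sub_nonneg.2 c2),
          mul_nonneg r1 (sub_nonneg.2 n')]
      · intro hx
        have n2 : n x.1.1 x.1.2 = 0 := max_eq_right (by linarith)
        rw [n2]
        have q1 := mul_nonneg n0 r1
        have q2 := mul_nonneg hC (add_nonneg p1 p2)
        linarith)
  refine ⟨hmain.1, hmain.2.trans_eq ?_⟩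
  -- Conservation of mass by the full operator removes any growth term, so no Gronwall argument is
  -- needed.
  have hz : ∫ x, gainLoss B α β I univ univ n x ∂timeCollisionMeasure B α T = 0 := by
    rw [integral_gainLoss B hI MeasurableSet.univ MeasurableSet.univ (by simp) hnm hni, sub_self]
  have hA2' := integrable_indicator_collision_mul h1i hGm.compl
  have hGc : ∀ w, scatter B α I w ∈ Gᶜ ↔ w ∈ Gᶜ := fun w => not_congr (hGs w)
  have hA2e : ∫ x, Gᶜ.indicator 1 (x.1.2, x.2) * (incoming B α β I one ∘ timeScatter B α I) x
      ∂timeCollisionMeasure B α T =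
      ∫ x, Gᶜ.indicator 1 (x.1.2, x.2) * incoming B α β I one x ∂timeCollisionMeasure B α T :=
    integral_indicator_timeScatter B hI hGm.compl hGc (measurable_incoming B α β I h1m)
  have hA23 : Integrable (fun x => C *
      (Gᶜ.indicator 1 (x.1.2, x.2) * (incoming B α β I one ∘ timeScatter B α I) x +
        Rᶜ.indicator 1 (x.1.2, x.2) * incoming B α β I one x)) (timeCollisionMeasure B α T) :=
    (hA2.add hA3).const_mul C
  rw [integral_add hA1 hA23, hz, zero_add, integral_const_mul,
    integral_add hA2 hA3, hA2e, ← integral_add hA2' hA3]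
  congr 1
  set F : Phase × ℝ × Plane → ℝ := fun w =>
    (Gᶜ.indicator 1 w + Rᶜ.indicator 1 w) * collisionRate B α β I w with hF
  have hFm : Measurable F := ((measurable_one.indicator hGm.compl).add
    (measurable_one.indicator hRm.compl)).mul (measurable_collisionRate B α β I)
  have e : ∀ x : (ℝ × Phase) × ℝ × Plane, Gᶜ.indicator 1 (x.1.2, x.2) * incoming B α β I one x +
      Rᶜ.indicator 1 (x.1.2, x.2) * incoming B α β I one x = F (x.1.2, x.2) := fun x => by
    simp only [hF, incoming, hone]; ring
  simp only [e]
  have e' := integral_comp_measurePreserving (measurePreserving_prodAssoc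
    (volume.restrict (Icc 0 T)) (volume : Measure Phase) (B.collisionMeasure α))
    (g := fun y => F y.2) (hFm.comp measurable_snd).aestronglyMeasurable
  have e'' : ∫ x : (ℝ × Phase) × ℝ × Plane, F (x.1.2, x.2) ∂timeCollisionMeasure B α T =
    ∫ y : ℝ × Phase × ℝ × Plane, F y.2 ∂(volume.restrict (Icc 0 T)).prod
      ((volume : Measure Phase).prod (B.collisionMeasure α)) := e'
  rw [e'', integral_fun_snd, measureReal_restrict_apply_univ, Real.volume_real_Icc_of_le hT,
    sub_zero, smul_eq_mul]

end Comparison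

/-! ### The mass of the truncated collisions -/

section Sections

variable {β : ℝ}

theorem maxwellian_le (hβ : 0 < β) (v : Plane) : maxwellian β v ≤ β / (2 * Real.pi) := by
  unfold maxwellian
  refine mul_le_of_le_one_right (by positivity) (Real.exp_le_one_iff.2 ?_)
  have := sq_nonneg ‖v‖
  nlinarith

theorem lintegral_maxwellian_closedBall_le (hβ : 0 < β) (a : Plane) {ρ : ℝ} (hρ : 0 ≤ ρ) :
    ∫⁻ v in {v | ‖v - a‖ ≤ ρ}, ENNReal.ofReal (maxwellian β v) ≤
      ENNReal.ofReal (β / 2 * ρ ^ 2) := by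
  have hs : {v : Plane | ‖v - a‖ ≤ ρ} = Metric.closedBall a ρ := by
    ext v; simp [dist_eq_norm]
  calc ∫⁻ v in {v | ‖v - a‖ ≤ ρ}, ENNReal.ofReal (maxwellian β v)
      ≤ ∫⁻ _ in {v | ‖v - a‖ ≤ ρ}, ENNReal.ofReal (β / (2 * Real.pi)) :=
        lintegral_mono fun v => ENNReal.ofReal_le_ofReal (maxwellian_le hβ v)
    _ = ENNReal.ofReal (β / 2 * ρ ^ 2) := by
        rw [lintegral_const, Measure.restrict_apply_univ, hs,
          EuclideanSpace.volume_closedBall_fin_two, ← ENNReal.ofReal_pow hρ,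
          ← ENNReal.ofReal_mul (by positivity), ← ENNReal.ofReal_mul (by positivity)]
        congr 1
        have := Real.pi_pos.ne'
        field_simp

/-- The coordinates in the frame `(ν, ν^⊥)`. -/
noncomputable def frameIsometry (ν : Plane) (hν : ‖ν‖ = 1) : Plane →ₗᵢ[ℝ] Plane where
  toFun x := x 0 • ν + x 1 • perp ν
  map_add' x y := by simp only [PiLp.add_apply]; module
  map_smul' c x := by simp only [PiLp.smul_apply, smul_eq_mul, RingHom.id_apply]; module
  norm_map' x := by
    have h1 : ν 0 ^ 2 + ν 1 ^ 2 = 1 := by rw [← norm_sq_plane, hν]; norm_num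
    change ‖x 0 • ν + x 1 • perp ν‖ = ‖x‖
    rw [← sq_eq_sq₀ (norm_nonneg _) (norm_nonneg _), norm_sq_plane, norm_sq_plane]
    simp
    linear_combination (x 0 ^ 2 + x 1 ^ 2) * h1

theorem inner_frameIsometry (ν : Plane) (hν : ‖ν‖ = 1) (x : Plane) :
    ⟪frameIsometry ν hν x, ν⟫ = x 0 := by
  change ⟪x 0 • ν + x 1 • perp ν, ν⟫ = x 0
  rw [inner_add_left, inner_smul_left, inner_smul_left, inner_perp_self,
    real_inner_self_eq_norm_sq, hν]
  simp

theorem measurePreserving_frame (ν : Plane) (hν : ‖ν‖ = 1) :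
    MeasurePreserving (fun y : ℝ × ℝ => frameIsometry ν hν !₂[y.1, y.2])
      (volume.prod volume) volume := by
  have h1 := ((frameIsometry ν hν).toLinearIsometryEquiv rfl).measurePreserving
  have h2 := (EuclideanSpace.volume_preserving_symm_measurableEquiv_toLp (Fin 2)).symm
  have h3 := (volume_preserving_finTwoArrow ℝ).symm
  exact h1.comp (h2.comp h3)

/-- In the frame (ν, ν^⊥) the Gaussian factor along ν is bounded by 1 on an interval of length 2w,
while the transverse factor is integrated. -/
theorem lintegral_maxwellian_strip_le (hβ : 0 < β) {ν : Plane} (hν : ‖ν‖ = 1) (t : ℝ) {w : ℝ}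
    (hw : 0 ≤ w) :
    ∫⁻ v in {v | |⟪v, ν⟫ - t| ≤ w}, ENNReal.ofReal (maxwellian β v) ≤
      ENNReal.ofReal (β / (2 * Real.pi) * (∫ y : ℝ, Real.exp (-(β / 2) * y ^ 2)) * (2 * w)) := by
  have hS : MeasurableSet {v : Plane | |⟪v, ν⟫ - t| ≤ w} :=
    measurableSet_le (Continuous.measurable (by fun_prop)) measurable_const
  have hS' : MeasurableSet {y : ℝ | |y - t| ≤ w} :=
    measurableSet_le (Continuous.measurable (by fun_prop)) measurable_const
  have hM := (continuous_maxwellian β).measurable.ennreal_ofReal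
  have hg : Integrable fun y : ℝ => Real.exp (-(β / 2) * y ^ 2) :=
    integrable_exp_neg_mul_sq (half_pos hβ)
  have hgm : Measurable fun y : ℝ => ENNReal.ofReal (Real.exp (-(β / 2) * y ^ 2)) := by fun_prop
  rw [← lintegral_indicator hS, ← (measurePreserving_frame ν hν).lintegral_comp
    (hM.indicator hS)]
  calc ∫⁻ y : ℝ × ℝ, {v : Plane | |⟪v, ν⟫ - t| ≤ w}.indicator
        (fun v => ENNReal.ofReal (maxwellian β v)) (frameIsometry ν hν !₂[y.1, y.2])
        ∂volume.prod volume
      ≤ ∫⁻ y : ℝ × ℝ, {y : ℝ | |y - t| ≤ w}.indicator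
          (fun _ => ENNReal.ofReal (β / (2 * Real.pi))) y.1 *
          ENNReal.ofReal (Real.exp (-(β / 2) * y.2 ^ 2)) ∂volume.prod volume := by
        refine lintegral_mono fun y => ?_
        have e : ⟪frameIsometry ν hν !₂[y.1, y.2], ν⟫ = y.1 := by
          rw [inner_frameIsometry]; simp
        by_cases hy : |y.1 - t| ≤ w
        · rw [indicator_of_mem (by rwa [mem_ofPred_eq, e]), indicator_of_mem (by exact hy),
            ← ENNReal.ofReal_mul (by positivity)]
          refine ENNReal.ofReal_le_ofReal ?_
          rw [maxwellian, LinearIsometry.norm_map, norm_sq_plane]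
          have : (0 : ℝ) ≤ y.1 ^ 2 := sq_nonneg _
          refine mul_le_mul_of_nonneg_left (Real.exp_le_exp.2 ?_) (by positivity)
          simp only [Matrix.cons_val_zero, Matrix.cons_val_one]
          nlinarith
        · rw [indicator_of_notMem (by rwa [mem_ofPred_eq, e])]
          exact zero_le
    _ = ENNReal.ofReal (β / (2 * Real.pi) * (∫ y : ℝ, Real.exp (-(β / 2) * y ^ 2)) * (2 * w)) := by
        rw [lintegral_prod_mul (measurable_const.indicator hS').aemeasurable hgm.aemeasurable,
          lintegral_indicator hS', lintegral_const, Measure.restrict_apply_univ,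
          ← ofReal_integral_eq_lintegral_ofReal hg
            (Filter.Eventually.of_forall fun y => (Real.exp_pos _).le)]
        have hI : {y : ℝ | |y - t| ≤ w} = Icc (t - w) (t + w) := by
          ext y
          simp only [mem_ofPred_eq, abs_le, mem_Icc]
          constructor <;> rintro ⟨h1, h2⟩ <;> constructor <;> linarith
        rw [hI, Real.volume_Icc, ← ENNReal.ofReal_mul (by positivity),
          ← ENNReal.ofReal_mul (mul_nonneg (by positivity) (by linarith))]
        congr 1
        ring

end Sections

/-- The density of all collisions, incoming or outgoing. -/
noncomputable def totalRate (B : RigidBody) (α β I : ℝ) (w : Phase × ℝ × Plane) : ℝ :=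
  1 / α * (bodyMaxwellian β I w.1 * (maxwellian β w.2.2 * |normalVel B α w|))

/-- An exponential moment of the equilibrium. -/
noncomputable def equilibriumMoment (β I : ℝ) : ℝ :=
  ∫ Y, bodyMaxwellian β I Y * (Real.exp (4 * ‖Y.2.1‖) * Real.exp (4 * |Y.2.2.2|))

section Total

variable (B : RigidBody) {α β I η : ℝ}

theorem measurable_totalRate (α β I : ℝ) : Measurable (totalRate B α β I) := by
  have h1 := (continuous_normalVel B α).measurable
  have h2 := (continuous_maxwellian β).measurable
  have h3 := measurable_bodyMaxwellian β I
  unfold totalRate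
  fun_prop

/-- The absolute value, instead of the negative part, makes the rate invariant, so conditions on
(v', V', Ω') cost the same as those on (v, V, Ω). -/
theorem totalRate_scatter (hα : 0 < α) (hI : 0 < I) (w : Phase × ℝ × Plane) :
    totalRate B α β I (scatter B α I w) = totalRate B α β I w := by
  rw [totalRate, totalRate, normalVel_scatter B hα hI, abs_neg, ← mul_assoc (bodyMaxwellian _ _ _),
    maxwellian_mul_bodyMaxwellian_scatter B hI, mul_assoc (bodyMaxwellian _ _ _)]

theorem collisionRate_le_totalRate (hα : 0 < α) (hβ : 0 < β) (hI : 0 < I) (w : Phase × ℝ × Plane) :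
    collisionRate B α β I w ≤ totalRate B α β I w := by
  have h1 := (bodyMaxwellian_pos hβ hI w.1).le
  have h2 := (maxwellian_pos hβ w.2.2).le
  rw [collisionRate, totalRate, mul_assoc (bodyMaxwellian _ _ _)]
  gcongr
  exact max_le (neg_le_abs _) (abs_nonneg _)

theorem lintegral_totalRate_scatter (hα : 0 < α) (hI : 0 < I) {A : Set (Phase × ℝ × Plane)}
    (hA : MeasurableSet A) :
    ∫⁻ w in scatter B α I ⁻¹' A, ENNReal.ofReal (totalRate B α β I w)
      ∂((volume : Measure Phase).prod (B.collisionMeasure α)) =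
    ∫⁻ w in A, ENNReal.ofReal (totalRate B α β I w)
      ∂((volume : Measure Phase).prod (B.collisionMeasure α)) := by
  rw [← (measurePreserving_scatter B hI).setLIntegral_comp_preimage hA
    (measurable_totalRate B α β I).ennreal_ofReal]
  simp only [totalRate_scatter B hα hI]

/-- Reduces each region to an estimate in v alone. The exponential weight, finite against the
equilibrium, absorbs all growth in V and Ω; the prefactor 1/α remains to be beaten by Q. -/
theorem lintegral_totalRate_le (hα : 0 < α) (hβ : 0 < β) (hI : 0 < I)
    {A : Set (Phase × ℝ × Plane)} (hA : MeasurableSet A) {Q Λ : ℝ} (hQ : 0 ≤ Q) (hΛ : 0 ≤ Λ)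
    (hL : B.arcMeasure α univ ≤ ENNReal.ofReal Λ)
    (hsec : ∀ (Y : Phase) (σ : ℝ), ∫⁻ v in {v | (Y, σ, v) ∈ A},
      ENNReal.ofReal (maxwellian β v * |normalVel B α (Y, σ, v)|) ≤
        ENNReal.ofReal (Q * (Real.exp (4 * ‖Y.2.1‖) * Real.exp (4 * |Y.2.2.2|)))) :
    ∫⁻ w in A, ENNReal.ofReal (totalRate B α β I w)
      ∂((volume : Measure Phase).prod (B.collisionMeasure α)) ≤
      ENNReal.ofReal (α⁻¹ * Q * Λ * equilibriumMoment β I) := by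
  have hm := fun Y => (bodyMaxwellian_pos hβ hI Y).le
  have hF : Measurable (A.indicator fun w => ENNReal.ofReal (totalRate B α β I w)) :=
    (measurable_totalRate B α β I).ennreal_ofReal.indicator hA
  have hMm := (continuous_maxwellian β).measurable
  have hNm := (continuous_normalVel B α).measurable
  rw [← lintegral_indicator hA, lintegral_prod _ hF.aemeasurable]
  have hv : ∀ Y σ, ∫⁻ v, A.indicator (fun w => ENNReal.ofReal (totalRate B α β I w)) (Y, σ, v) ≤
      ENNReal.ofReal (α⁻¹ * Q * (bodyMaxwellian β I Y *
        (Real.exp (4 * ‖Y.2.1‖) * Real.exp (4 * |Y.2.2.2|)))) := by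
    intro Y σ
    have hsm : MeasurableSet {v | (Y, σ, v) ∈ A} :=
      hA.preimage (measurable_prodMk_left.comp measurable_prodMk_left)
    have e1 : ∀ v, A.indicator (fun w => ENNReal.ofReal (totalRate B α β I w)) (Y, σ, v) =
        {v | (Y, σ, v) ∈ A}.indicator (fun v => ENNReal.ofReal (α⁻¹ * bodyMaxwellian β I Y) *
          ENNReal.ofReal (maxwellian β v * |normalVel B α (Y, σ, v)|)) v := by
      intro v
      by_cases hvA : (Y, σ, v) ∈ A
      · have := hm Y
        rw [indicator_of_mem hvA, indicator_of_mem (by exact hvA), ← ENNReal.ofReal_mul (by positivity), totalRate, one_div, mul_assoc]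
      · rw [indicator_of_notMem hvA, indicator_of_notMem (by exact hvA)]
    rw [lintegral_congr e1, lintegral_indicator hsm, lintegral_const_mul _ (by fun_prop)]
    calc _ ≤ ENNReal.ofReal (α⁻¹ * bodyMaxwellian β I Y) *
          ENNReal.ofReal (Q * (Real.exp (4 * ‖Y.2.1‖) * Real.exp (4 * |Y.2.2.2|))) := by
          gcongr; exact hsec Y σ
      _ = _ := by
          have := hm Y
          rw [← ENNReal.ofReal_mul (by positivity)]
          congr 1; ring
  have hY : ∀ Y, ∫⁻ p, A.indicator (fun w => ENNReal.ofReal (totalRate B α β I w)) (Y, p)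
      ∂B.collisionMeasure α ≤ ENNReal.ofReal (α⁻¹ * Q * Λ * (bodyMaxwellian β I Y *
        (Real.exp (4 * ‖Y.2.1‖) * Real.exp (4 * |Y.2.2.2|)))) := by
    intro Y
    have hF' : Measurable fun p : ℝ × Plane =>
        A.indicator (fun w => ENNReal.ofReal (totalRate B α β I w)) (Y, p) :=
      hF.comp measurable_prodMk_left
    rw [B.collisionMeasure_eq, lintegral_prod _ hF'.aemeasurable]
    refine (lintegral_mono fun σ => hv Y σ).trans ?_
    rw [lintegral_const]
    have := hm Y
    calc _ ≤ ENNReal.ofReal (α⁻¹ * Q * (bodyMaxwellian β I Y *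
        (Real.exp (4 * ‖Y.2.1‖) * Real.exp (4 * |Y.2.2.2|)))) * ENNReal.ofReal Λ := by gcongr
      _ = _ := by
        rw [← ENNReal.ofReal_mul (by positivity)]
        congr 1; ring
  refine (lintegral_mono hY).trans_eq ?_
  rw [equilibriumMoment, ← integral_const_mul, ofReal_integral_eq_lintegral_ofReal
    ((integrable_bodyMaxwellian_mul_exp hβ hI 4).const_mul _)
    (Filter.Eventually.of_forall fun Y => by
      have := hm Y
      simp only [Pi.zero_apply]
      positivity)]

end Total

section Error

variable (B : RigidBody) {α β I η : ℝ}

/-- The impulse given to the body is proportional to the normal velocity. -/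
theorem norm_scatVel_sub (hα : 0 < α) (hI : 0 < I) (w : Phase × ℝ × Plane) :
    ‖(scatter B α I w).1.2.1 - w.1.2.1‖ =
      2 / (massRatio B α I w.2.1 + 1) * α ^ 2 * |normalVel B α w| := by
  have hA := massRatio_nonneg B (α := α) w.2.1 hI
  have hq : normalImpulse B α w.1.2.2.1 w.2.1 w.2.2 w.1.2.1 w.1.2.2.2 = -(α * normalVel B α w) := by
    rw [normalVel, normalVelocity_eq B hα]; field_simp
  change ‖scatVel B α I _ _ _ _ _ - _‖ = _
  rw [scatVel, sub_sub_cancel_left, norm_neg, norm_smul, norm_rot, B.norm_n, mul_one, hq,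
    Real.norm_eq_abs, abs_mul, abs_of_nonneg (by positivity), mul_neg, abs_neg, ← mul_assoc,
    abs_mul, abs_of_pos (by positivity : 0 < α * α)]
  ring

/-- The body's velocity jump is 2α²/(A + 1) times the normal speed and A ≤ 1 + D²/I, so the
threshold α^(2+η) amounts to a normal speed of order α^η. -/
theorem abs_normalVel_lt_of_not_impulse {D : ℝ} (hD : ∀ x ∈ B.carrier, ‖x‖ ≤ D) (hα : 0 < α)
    (hα1 : α ≤ 1) (hI : 0 < I) {w : Phase × ℝ × Plane}
    (hw : ‖(scatter B α I w).1.2.1 - w.1.2.1‖ < α ^ (2 + η)) :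
    |normalVel B α w| ≤ (1 + D ^ 2 / I + 1) / 2 * α ^ η := by
  have hA := massRatio_nonneg B (α := α) w.2.1 hI
  have hA1 : massRatio B α I w.2.1 ≤ 1 + D ^ 2 / I := by
    have h1 : ⟪B.n w.2.1, perp (B.r w.2.1)⟫ ^ 2 ≤ D ^ 2 := by
      rw [← sq_abs]
      have h2 : |⟪B.n w.2.1, perp (B.r w.2.1)⟫| ≤ D := by
        refine (abs_real_inner_le_norm _ _).trans ?_
        rw [B.norm_n, norm_perp, one_mul]
        exact hD _ (B.r_mem _)
      gcongr
    have h3 : α ^ 2 ≤ 1 := pow_le_one₀ hα.le hα1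
    rw [massRatio]
    calc α ^ 2 * (1 + ⟪B.n w.2.1, perp (B.r w.2.1)⟫ ^ 2 / I) ≤ 1 * (1 + D ^ 2 / I) := by gcongr
      _ = _ := one_mul _
  rw [norm_scatVel_sub B hα hI, Real.rpow_add hα, Real.rpow_two] at hw
  set A := massRatio B α I w.2.1
  have hη0 : 0 < α ^ η := Real.rpow_pos_of_pos hα η
  have hα2 : 0 < α ^ 2 := by positivity
  have h1 : 2 / (A + 1) * |normalVel B α w| < α ^ η := by
    have : α ^ 2 * (2 / (A + 1) * |normalVel B α w|) < α ^ 2 * α ^ η := by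
      rw [← mul_assoc, mul_comm (α ^ 2) (2 / (A + 1))]; exact hw
    exact lt_of_mul_lt_mul_left this hα2.le
  rw [div_mul_eq_mul_div, div_lt_iff₀ (by positivity)] at h1
  have h2 : α ^ η * (A + 1) ≤ α ^ η * (1 + D ^ 2 / I + 1) := by gcongr
  linarith

theorem lintegral_maxwellian_mul_le (hβ : 0 < β) {S : Set Plane}
    {F : Plane → ℝ} {b s : ℝ} (hb : 0 ≤ b) (hF : ∀ v ∈ S, F v ≤ b)
    (hs : ∫⁻ v in S, ENNReal.ofReal (maxwellian β v) ≤ ENNReal.ofReal s) :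
    ∫⁻ v in S, ENNReal.ofReal (maxwellian β v * F v) ≤ ENNReal.ofReal (b * s) := by
  have hM := (continuous_maxwellian β).measurable.ennreal_ofReal
  calc ∫⁻ v in S, ENNReal.ofReal (maxwellian β v * F v)
      ≤ ∫⁻ v in S, ENNReal.ofReal b * ENNReal.ofReal (maxwellian β v) := by
        refine setLIntegral_mono (by fun_prop) fun v hv => ?_
        rw [← ENNReal.ofReal_mul hb, mul_comm b]
        exact ENNReal.ofReal_le_ofReal
          (mul_le_mul_of_nonneg_left (hF v hv) (maxwellian_pos hβ v).le)
    _ ≤ ENNReal.ofReal b * ENNReal.ofReal s := by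
        rw [lintegral_const_mul _ hM]; gcongr
    _ = ENNReal.ofReal (b * s) := (ENNReal.ofReal_mul hb).symm

theorem one_le_exp_mul_exp (a b : ℝ) (ha : 0 ≤ a) (hb : 0 ≤ b) :
    1 ≤ Real.exp (4 * a) * Real.exp (4 * b) :=
  one_le_mul_of_one_le_of_one_le (Real.one_le_exp (by positivity)) (Real.one_le_exp (by positivity))

theorem measurableSet_fast (α : ℝ) : MeasurableSet {w : Phase × ℝ × Plane |
    |Real.log α| < ‖w.1.2.1‖ ∨ |Real.log α| < |w.1.2.2.2|} := by
  have hV : Continuous fun w : Phase × ℝ × Plane => ‖w.1.2.1‖ := by fun_prop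
  have hΩ : Continuous fun w : Phase × ℝ × Plane => |w.1.2.2.2| := by fun_prop
  exact (measurableSet_lt measurable_const hV.measurable).union
    (measurableSet_lt measurable_const hΩ.measurable)

/-- Collisions with a small normal velocity. -/
theorem lintegral_grazing_le (hα : 0 < α) (hβ : 0 < β) (hI : 0 < I) {Λ c : ℝ} (hΛ : 0 ≤ Λ)
    (hL : B.arcMeasure α univ ≤ ENNReal.ofReal Λ) (hc : 0 ≤ c) :
    ∫⁻ w in {w | |normalVel B α w| ≤ c * α ^ η}, ENNReal.ofReal (totalRate B α β I w)
      ∂((volume : Measure Phase).prod (B.collisionMeasure α)) ≤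
      ENNReal.ofReal (c ^ 2 * (β / (2 * Real.pi) * (∫ y : ℝ, Real.exp (-(β / 2) * y ^ 2)) * 2) * Λ *
        equilibriumMoment β I * α ^ (2 * η)) := by
  have hA : MeasurableSet {w | |normalVel B α w| ≤ c * α ^ η} :=
    measurableSet_le (continuous_normalVel B α).measurable.abs measurable_const
  have hη0 : 0 < α ^ η := Real.rpow_pos_of_pos hα η
  set Γ := β / (2 * Real.pi) * (∫ y : ℝ, Real.exp (-(β / 2) * y ^ 2)) with hΓ
  have hΓ0 : 0 ≤ Γ := mul_nonneg (by positivity) (integral_nonneg fun y => (Real.exp_pos _).le)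
  -- Normal speed at most cα^η, times a strip of half-width αcα^η. The factor α of the width cancels
  -- the prefactor 1/α.
  refine (lintegral_totalRate_le B hα hβ hI hA (Q := c * α ^ η * (Γ * (2 * (α * (c * α ^ η)))))
    (by positivity) hΛ hL fun Y σ => ?_).trans_eq ?_
  · set ν := rot Y.2.2.1 (B.n σ) with hν
    have hν1 : ‖ν‖ = 1 := by rw [hν, norm_rot, B.norm_n]
    set t := ⟪Y.2.1 + Y.2.2.2 • perp (rot Y.2.2.1 (B.r σ)), ν⟫ with ht
    have hn : ∀ v, normalVel B α (Y, σ, v) = α⁻¹ * (⟪v, ν⟫ - α * t) := by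
      intro v
      have : normalVel B α (Y, σ, v) = ⟪α⁻¹ • v - Y.2.1 - Y.2.2.2 • perp (rot Y.2.2.1 (B.r σ)), ν⟫ :=
        rfl
      rw [this, sub_sub, inner_sub_left, inner_smul_left, ← ht]
      simp only [conj_trivial]
      field_simp
    have hsub : {v | (Y, σ, v) ∈ {w | |normalVel B α w| ≤ c * α ^ η}} ⊆
        {v | |⟪v, ν⟫ - α * t| ≤ α * (c * α ^ η)} := by
      intro v hv
      have hv' : |normalVel B α (Y, σ, v)| ≤ c * α ^ η := hv
      rw [hn, abs_mul, abs_of_pos (by positivity), inv_mul_le_iff₀ hα] at hv'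
      exact hv'
    have h1 := (lintegral_mono_set hsub).trans
      (lintegral_maxwellian_strip_le hβ hν1 (α * t) (w := α * (c * α ^ η)) (by positivity))
    refine (lintegral_maxwellian_mul_le hβ (by positivity)
      (fun v hv => hv) h1).trans (ENNReal.ofReal_le_ofReal ?_)
    exact le_mul_of_one_le_right (by positivity)
      (one_le_exp_mul_exp _ _ (norm_nonneg _) (abs_nonneg _))
  · congr 1
    rw [two_mul η, Real.rpow_add hα]
    field_simp

/-- Collisions of a very fast body. -/
theorem lintegral_fast_le (hα : 0 < α) (hα1 : α ≤ 1) (hβ : 0 < β) (hI : 0 < I) {Λ D : ℝ}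
    (hΛ : 0 ≤ Λ) (hL : B.arcMeasure α univ ≤ ENNReal.ofReal Λ) (hD0 : 0 < D)
    (hD : ∀ x ∈ B.carrier, ‖x‖ ≤ D) :
    ∫⁻ w in {w : Phase × ℝ × Plane | |Real.log α| < ‖w.1.2.1‖ ∨ |Real.log α| < |w.1.2.2.2|},
      ENNReal.ofReal (totalRate B α β I w)
      ∂((volume : Measure Phase).prod (B.collisionMeasure α)) ≤
      ENNReal.ofReal ((1 + D) * (∫ v, maxwellian β v * (1 + ‖v‖)) * Λ *
        equilibriumMoment β I * α) := by
  have hA : MeasurableSet {w : Phase × ℝ × Plane |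
      |Real.log α| < ‖w.1.2.1‖ ∨ |Real.log α| < |w.1.2.2.2|} :=
    measurableSet_fast α
  have hMpos : ∀ v, 0 ≤ maxwellian β v * (1 + ‖v‖) := fun v => by
    have := (maxwellian_pos hβ v).le
    positivity
  set m₁ := ∫ v, maxwellian β v * (1 + ‖v‖) with hm₁
  have hm₁0 : 0 ≤ m₁ := integral_nonneg hMpos
  refine (lintegral_totalRate_le B hα hβ hI hA (Q := α ^ 2 * (1 + D) * m₁)
    (by positivity) hΛ hL fun Y σ => ?_).trans_eq ?_
  · by_cases hY : |Real.log α| < ‖Y.2.1‖ ∨ |Real.log α| < |Y.2.2.2|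
    swap
    · have : {v : Plane | (Y, σ, v) ∈ {w : Phase × ℝ × Plane |
          |Real.log α| < ‖w.1.2.1‖ ∨ |Real.log α| < |w.1.2.2.2|}} = ∅ := by
        ext v; simpa using hY
      rw [this]; simp
    have hV0 := norm_nonneg Y.2.1
    have hΩ0 := abs_nonneg Y.2.2.2
    -- Since α = exp(−|log α|), three of the four exponentials in `equilibriumMoment` buy α³; the
    -- fourth controls the normal velocity. Two of these powers pay for its α⁻¹ and for the
    -- prefactor.
    have hbig : 1 ≤ α ^ 3 * (Real.exp (3 * ‖Y.2.1‖) * Real.exp (3 * |Y.2.2.2|)) := by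
      have e : α ^ 3 = Real.exp (-(3 * |Real.log α|)) := by
        rw [abs_of_nonpos (Real.log_nonpos hα.le hα1), mul_neg, neg_neg, ← Real.exp_log hα,
          ← Real.exp_nat_mul, Real.exp_log hα]
        norm_num
      rw [e, ← Real.exp_add, ← Real.exp_add]
      refine Real.one_le_exp ?_
      rcases hY with h | h <;> linarith
    have hn : ∀ v, |normalVel B α (Y, σ, v)| ≤
        α⁻¹ * (1 + D) * (Real.exp ‖Y.2.1‖ * Real.exp |Y.2.2.2|) * (1 + ‖v‖) := by
      intro v
      have hα' : 1 ≤ α⁻¹ := (one_le_inv₀ hα).2 hα1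
      have h1 : ‖α⁻¹ • v - Y.2.1‖ ≤ α⁻¹ * ‖v‖ + ‖Y.2.1‖ := by
        refine (norm_sub_le _ _).trans_eq ?_
        rw [norm_smul, Real.norm_of_nonneg (by positivity)]
      have h2 := abs_normalVel_le B (α := α) hD (Y, σ, v)
      have h3 : 1 + ‖Y.2.1‖ + |Y.2.2.2| ≤ Real.exp ‖Y.2.1‖ * Real.exp |Y.2.2.2| := by
        rw [← Real.exp_add]; linarith [Real.add_one_le_exp (‖Y.2.1‖ + |Y.2.2.2|)]
      have hv0 := norm_nonneg v
      have h4 : α⁻¹ * ‖v‖ + ‖Y.2.1‖ + D * |Y.2.2.2| ≤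
          α⁻¹ * ((1 + D) * ((1 + ‖Y.2.1‖ + |Y.2.2.2|) * (1 + ‖v‖))) := by
        have h5 : ‖Y.2.1‖ + D * |Y.2.2.2| ≤ α⁻¹ * (‖Y.2.1‖ + D * |Y.2.2.2|) :=
          le_mul_of_one_le_left (by positivity) hα'
        have h6 : ‖v‖ + (‖Y.2.1‖ + D * |Y.2.2.2|) ≤
            (1 + D) * ((1 + ‖Y.2.1‖ + |Y.2.2.2|) * (1 + ‖v‖)) := by
          nlinarith [mul_nonneg hV0 hv0, mul_nonneg hΩ0 hv0, mul_nonneg hD0.le hV0,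
            mul_nonneg hD0.le hΩ0, mul_nonneg hD0.le hv0, mul_nonneg hD0.le (mul_nonneg hV0 hv0),
            mul_nonneg hD0.le (mul_nonneg hΩ0 hv0)]
        have h7 := mul_le_mul_of_nonneg_left h6 (by positivity : 0 ≤ α⁻¹)
        linarith
      calc |normalVel B α (Y, σ, v)| ≤ ‖α⁻¹ • v - Y.2.1‖ + D * |Y.2.2.2| := h2
        _ ≤ α⁻¹ * ‖v‖ + ‖Y.2.1‖ + D * |Y.2.2.2| := by linarith
        _ ≤ _ := h4
        _ ≤ α⁻¹ * ((1 + D) * ((Real.exp ‖Y.2.1‖ * Real.exp |Y.2.2.2|) * (1 + ‖v‖))) := by gcongr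
        _ = _ := by ring
    set k := α⁻¹ * (1 + D) * (Real.exp ‖Y.2.1‖ * Real.exp |Y.2.2.2|) with hk
    have hk0 : 0 ≤ k := by positivity
    calc ∫⁻ v in {v : Plane | (Y, σ, v) ∈ {w : Phase × ℝ × Plane |
          |Real.log α| < ‖w.1.2.1‖ ∨ |Real.log α| < |w.1.2.2.2|}},
          ENNReal.ofReal (maxwellian β v * |normalVel B α (Y, σ, v)|)
        ≤ ∫⁻ v, ENNReal.ofReal (maxwellian β v * |normalVel B α (Y, σ, v)|) :=
          setLIntegral_le_lintegral _ _
      _ ≤ ∫⁻ v, ENNReal.ofReal (k * (maxwellian β v * (1 + ‖v‖))) := by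
          refine lintegral_mono fun v => ENNReal.ofReal_le_ofReal ?_
          have := mul_le_mul_of_nonneg_left (hn v) (maxwellian_pos hβ v).le
          linarith
      _ = ENNReal.ofReal (k * m₁) := by
          rw [hm₁, ← integral_const_mul, ofReal_integral_eq_lintegral_ofReal
            ((integrable_maxwellian_mul_one_add hβ).const_mul k)
            (Filter.Eventually.of_forall fun v => mul_nonneg hk0 (hMpos v))]
      _ ≤ _ := by
          refine ENNReal.ofReal_le_ofReal ?_
          have e4 : ∀ a : ℝ, Real.exp (4 * a) = Real.exp (3 * a) * Real.exp a := fun a => by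
            rw [← Real.exp_add]; ring_nf
          calc k * m₁ ≤ k * m₁ *
                (α ^ 3 * (Real.exp (3 * ‖Y.2.1‖) * Real.exp (3 * |Y.2.2.2|))) :=
                le_mul_of_one_le_right (by positivity) hbig
            _ = _ := by
                rw [hk, e4, e4]
                field_simp
  · congr 1
    field_simp

/-- Collisions with a small relative velocity. -/
theorem lintegral_slow_le (hα : 0 < α) (hα1 : α ≤ 1) (hβ : 0 < β) (hI : 0 < I) (hη : 0 < η)
    {Λ D : ℝ} (hΛ : 0 ≤ Λ) (hL : B.arcMeasure α univ ≤ ENNReal.ofReal Λ) (hD0 : 0 < D)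
    (hD : ∀ x ∈ B.carrier, ‖x‖ ≤ D) :
    ∫⁻ w in {w : Phase × ℝ × Plane | ‖w.2.2 - α • w.1.2.1‖ ≤ α ^ (2 / 3 + η)},
      ENNReal.ofReal (totalRate B α β I w)
      ∂((volume : Measure Phase).prod (B.collisionMeasure α)) ≤
      ENNReal.ofReal ((1 + D) * (β / 2) * Λ * equilibriumMoment β I * α ^ (2 * η)) := by
  have hA : MeasurableSet {w : Phase × ℝ × Plane | ‖w.2.2 - α • w.1.2.1‖ ≤ α ^ (2 / 3 + η)} :=
    measurableSet_le (Continuous.measurable (by fun_prop)) measurable_const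
  set δ := α ^ (2 / 3 + η) with hδ
  have hδ0 : 0 < δ := Real.rpow_pos_of_pos hα _
  have hJ : 0 ≤ equilibriumMoment β I := integral_nonneg fun Y => by
    have := (bodyMaxwellian_pos hβ hI Y).le
    simp only [Pi.zero_apply]
    positivity
  -- Normal speed of order δ/α + D|Ω| on a disc of area of order δ². The radius δ makes α⁻²δ³ equal
  -- to α^(3η) and α⁻¹δ² equal to α^(1/3+2η).
  refine (lintegral_totalRate_le B hα hβ hI hA (Q := (α⁻¹ * δ + D) * (β / 2 * δ ^ 2))
    (by positivity) hΛ hL fun Y σ => ?_).trans (ENNReal.ofReal_le_ofReal ?_)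
  · have h1 := lintegral_maxwellian_closedBall_le hβ (α • Y.2.1) hδ0.le
    refine (lintegral_maxwellian_mul_le hβ
      (b := α⁻¹ * δ + D * |Y.2.2.2|) (by positivity)
      (fun v hv => ?_) h1).trans (ENNReal.ofReal_le_ofReal ?_)
    · refine (abs_normalVel_le B hD (Y, σ, v)).trans ?_
      rw [norm_inv_smul_sub hα]
      have hv' : ‖v - α • Y.2.1‖ ≤ δ := hv
      gcongr
    · have hΩ0 := abs_nonneg Y.2.2.2
      have h2 : 1 ≤ Real.exp (4 * ‖Y.2.1‖) := Real.one_le_exp (by positivity)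
      have h3 : |Y.2.2.2| ≤ Real.exp (4 * |Y.2.2.2|) := by
        linarith [Real.add_one_le_exp (4 * |Y.2.2.2|)]
      have h4 : 1 ≤ Real.exp (4 * |Y.2.2.2|) := Real.one_le_exp (by positivity)
      have h5 : α⁻¹ * δ + D * |Y.2.2.2| ≤ (α⁻¹ * δ + D) * Real.exp (4 * |Y.2.2.2|) := by
        have : 0 < α⁻¹ * δ := by positivity
        nlinarith
      calc (α⁻¹ * δ + D * |Y.2.2.2|) * (β / 2 * δ ^ 2)
          ≤ ((α⁻¹ * δ + D) * (1 * Real.exp (4 * |Y.2.2.2|))) * (β / 2 * δ ^ 2) := by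
            rw [one_mul]; gcongr
        _ ≤ ((α⁻¹ * δ + D) * (Real.exp (4 * ‖Y.2.1‖) * Real.exp (4 * |Y.2.2.2|))) *
            (β / 2 * δ ^ 2) := by gcongr
        _ = _ := by ring
  · have p1 : α⁻¹ * (α⁻¹ * δ) * δ ^ 2 ≤ α ^ (2 * η) := by
      have e : α⁻¹ * (α⁻¹ * δ) * δ ^ 2 = α ^ (3 * η) := by
        rw [hδ, ← Real.rpow_natCast, ← Real.rpow_mul hα.le, ← Real.rpow_neg_one,
          ← Real.rpow_add hα, ← Real.rpow_add hα, ← Real.rpow_add hα]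
        congr 1; push_cast; ring
      rw [e]
      exact Real.rpow_le_rpow_of_exponent_ge hα hα1 (by linarith)
    have p2 : α⁻¹ * δ ^ 2 ≤ α ^ (2 * η) := by
      have e : α⁻¹ * δ ^ 2 = α ^ (1 / 3 + 2 * η) := by
        rw [hδ, ← Real.rpow_natCast, ← Real.rpow_mul hα.le, ← Real.rpow_neg_one,
          ← Real.rpow_add hα]
        congr 1; push_cast; ring
      rw [e]
      exact Real.rpow_le_rpow_of_exponent_ge hα hα1 (by linarith)
    have p3 : α⁻¹ * (α⁻¹ * δ) * δ ^ 2 + D * (α⁻¹ * δ ^ 2) ≤ (1 + D) * α ^ (2 * η) := by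
      nlinarith [mul_le_mul_of_nonneg_left p2 hD0.le]
    calc α⁻¹ * ((α⁻¹ * δ + D) * (β / 2 * δ ^ 2)) * Λ * equilibriumMoment β I
        = (α⁻¹ * (α⁻¹ * δ) * δ ^ 2 + D * (α⁻¹ * δ ^ 2)) *
          (β / 2 * Λ * equilibriumMoment β I) := by ring
      _ ≤ (1 + D) * α ^ (2 * η) * (β / 2 * Λ * equilibriumMoment β I) := by gcongr
      _ = _ := by ring

/-- Collisions for which the rotation dominates the relative velocity. -/
theorem lintegral_rotating_le (hα : 0 < α) (hβ : 0 < β) (hI : 0 < I)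
    {Λ D K : ℝ} (hΛ : 0 ≤ Λ) (hL : B.arcMeasure α univ ≤ ENNReal.ofReal Λ) (hD0 : 0 < D)
    (hD : ∀ x ∈ B.carrier, ‖x‖ ≤ D) (hK : 0 < K) :
    ∫⁻ w in {w : Phase × ℝ × Plane | ‖w.2.2 - α • w.1.2.1‖ ≤ α * K * |w.1.2.2.2|},
      ENNReal.ofReal (totalRate B α β I w)
      ∂((volume : Measure Phase).prod (B.collisionMeasure α)) ≤
      ENNReal.ofReal ((K + D) * (β / 2 * K ^ 2) * Λ * equilibriumMoment β I * α) := by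
  have hA : MeasurableSet
      {w : Phase × ℝ × Plane | ‖w.2.2 - α • w.1.2.1‖ ≤ α * K * |w.1.2.2.2|} :=
    measurableSet_le (Continuous.measurable (by fun_prop)) (Continuous.measurable (by fun_prop))
  -- The normal speed is at most (K + D)|Ω| and the disc has area of order (αK|Ω|)²; the factor |Ω|³
  -- goes into the exponential moment.
  refine (lintegral_totalRate_le B hα hβ hI hA (Q := (K + D) * (β / 2 * (α * K) ^ 2))
    (by positivity) hΛ hL fun Y σ => ?_).trans_eq ?_
  · have hΩ0 := abs_nonneg Y.2.2.2
    have h1 := lintegral_maxwellian_closedBall_le hβ (α • Y.2.1)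
      (by positivity : 0 ≤ α * K * |Y.2.2.2|)
    refine (lintegral_maxwellian_mul_le hβ
      (b := (K + D) * |Y.2.2.2|) (by positivity)
      (fun v hv => ?_) h1).trans (ENNReal.ofReal_le_ofReal ?_)
    · refine (abs_normalVel_le B hD (Y, σ, v)).trans ?_
      rw [norm_inv_smul_sub hα, add_mul]
      have hv' : ‖v - α • Y.2.1‖ ≤ α * K * |Y.2.2.2| := hv
      have h2 : α⁻¹ * ‖v - α • Y.2.1‖ ≤ α⁻¹ * (α * K * |Y.2.2.2|) := by gcongr
      have h3 : α⁻¹ * (α * K * |Y.2.2.2|) = K * |Y.2.2.2| := by field_simp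
      simp only
      linarith
    · have h2 : 1 ≤ Real.exp (4 * ‖Y.2.1‖) := Real.one_le_exp (by positivity)
      have h3 : |Y.2.2.2| ^ 3 ≤ Real.exp (4 * |Y.2.2.2|) := by
        have h4 : |Y.2.2.2| ≤ Real.exp |Y.2.2.2| := by
          linarith [Real.add_one_le_exp |Y.2.2.2|]
        calc |Y.2.2.2| ^ 3 ≤ Real.exp |Y.2.2.2| ^ 3 := by gcongr
          _ = Real.exp (3 * |Y.2.2.2|) := by rw [← Real.exp_nat_mul]; norm_num
          _ ≤ Real.exp (4 * |Y.2.2.2|) := Real.exp_le_exp.2 (by linarith)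
      calc (K + D) * |Y.2.2.2| * (β / 2 * (α * K * |Y.2.2.2|) ^ 2)
          = (K + D) * (β / 2 * (α * K) ^ 2) * (1 * |Y.2.2.2| ^ 3) := by ring
        _ ≤ _ := by gcongr
  · congr 1
    field_simp

/-- The mass of the truncated collisions is of order `α^{2η}`. -/
theorem exists_truncationError_le (hβ : 0 < β) (hI : 0 < I) (hη : 0 < η) (hη' : η < 1 / 6)
    {K : ℝ} (hK0 : 0 < K) :
    ∃ E : ℝ, 0 ≤ E ∧ ∀ α, 0 < α → α ≤ 1 →
      (∀ (Θ : Orientation) (σ : ℝ) (v V : Plane) (Ω : ℝ),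
        normalVelocity B α Θ σ v V Ω < 0 → K * |Ω| ≤ ‖α⁻¹ • v - V‖ →
        NoBackwardRecollision B α Θ σ v V Ω) →
      truncationError B α β I η ≤ E * α ^ (2 * η) := by
  obtain ⟨D, hD0, hD⟩ := B.exists_norm_bound
  obtain ⟨Λ, hΛ0, hΛ⟩ := B.exists_arcMeasure_univ_le
  have hJ : 0 ≤ equilibriumMoment β I := integral_nonneg fun Y => by
    have := (bodyMaxwellian_pos hβ hI Y).le
    simp only [Pi.zero_apply]
    positivity
  have hm₁ : 0 ≤ ∫ v, maxwellian β v * (1 + ‖v‖) := integral_nonneg fun v => by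
    have := (maxwellian_pos hβ v).le
    simp only [Pi.zero_apply]
    positivity
  have hg₁ : 0 ≤ ∫ y : ℝ, Real.exp (-(β / 2) * y ^ 2) :=
    integral_nonneg fun y => (Real.exp_pos _).le
  set c := (1 + D ^ 2 / I + 1) / 2 with hc
  have hc0 : 0 ≤ c := by positivity
  set E₁ := c ^ 2 * (β / (2 * Real.pi) * (∫ y : ℝ, Real.exp (-(β / 2) * y ^ 2)) * 2) * Λ *
        equilibriumMoment β I with hE₁
  set E₂ := (1 + D) * (∫ v, maxwellian β v * (1 + ‖v‖)) * Λ * equilibriumMoment β I with hE₂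
  set E₃ := (1 + D) * (β / 2) * Λ * equilibriumMoment β I with hE₃
  set E₄ := (K + D) * (β / 2 * K ^ 2) * Λ * equilibriumMoment β I with hE₄
  have hE₁0 : 0 ≤ E₁ := by positivity
  have hE₂0 : 0 ≤ E₂ := by positivity
  have hE₃0 : 0 ≤ E₃ := by positivity
  have hE₄0 : 0 ≤ E₄ := by positivity
  refine ⟨E₁ + E₂ + E₂ + E₃ + E₃ + E₄, by positivity, fun α hα hα1 hrec => ?_⟩
  have hL := hΛ α hα hα1
  set μ := (volume : Measure Phase).prod (B.collisionMeasure α) with hμ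
  set a := α ^ (2 * η) with ha
  have ha0 : 0 ≤ a := (Real.rpow_pos_of_pos hα _).le
  -- Contributions of order α fit because 2η < 1.
  have hαa : α ≤ a := by
    calc α = α ^ (1 : ℝ) := (Real.rpow_one α).symm
      _ ≤ a := Real.rpow_le_rpow_of_exponent_ge hα hα1 (by linarith)
  set A₁ : Set (Phase × ℝ × Plane) := {w | |normalVel B α w| ≤ c * α ^ η} with hA₁
  set A₂ : Set (Phase × ℝ × Plane) :=
    {w | |Real.log α| < ‖w.1.2.1‖ ∨ |Real.log α| < |w.1.2.2.2|} with hA₂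
  set A₃ : Set (Phase × ℝ × Plane) := {w | ‖w.2.2 - α • w.1.2.1‖ ≤ α ^ (2 / 3 + η)} with hA₃
  set A₄ : Set (Phase × ℝ × Plane) :=
    {w | ‖w.2.2 - α • w.1.2.1‖ ≤ α * K * |w.1.2.2.2|} with hA₄
  have hA₂m : MeasurableSet A₂ :=
    measurableSet_fast α
  have hA₃m : MeasurableSet A₃ :=
    measurableSet_le (Continuous.measurable (by fun_prop)) measurable_const
  have hA₄m : MeasurableSet A₄ :=
    measurableSet_le (Continuous.measurable (by fun_prop)) (Continuous.measurable (by fun_prop))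
  set ρ : Phase × ℝ × Plane → ℝ≥0∞ := fun w => ENNReal.ofReal (totalRate B α β I w) with hρ
  have b₁ : ∫⁻ w in A₁, ρ w ∂μ ≤ ENNReal.ofReal (E₁ * a) :=
    lintegral_grazing_le B hα hβ hI hΛ0.le hL hc0
  have b₂ : ∫⁻ w in A₂, ρ w ∂μ ≤ ENNReal.ofReal (E₂ * a) :=
    (lintegral_fast_le B hα hα1 hβ hI hΛ0.le hL hD0 hD).trans
      (ENNReal.ofReal_le_ofReal (mul_le_mul_of_nonneg_left hαa hE₂0))
  have b₃ : ∫⁻ w in A₃, ρ w ∂μ ≤ ENNReal.ofReal (E₃ * a) :=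
    lintegral_slow_le B hα hα1 hβ hI hη hΛ0.le hL hD0 hD
  have b₄ : ∫⁻ w in A₄, ρ w ∂μ ≤ ENNReal.ofReal (E₄ * a) :=
    (lintegral_rotating_le B hα hβ hI hΛ0.le hL hD0 hD hK0).trans
      (ENNReal.ofReal_le_ofReal (mul_le_mul_of_nonneg_left hαa hE₄0))
  have b₂' : ∫⁻ w in scatter B α I ⁻¹' A₂, ρ w ∂μ ≤ ENNReal.ofReal (E₂ * a) :=
    (lintegral_totalRate_scatter B hα hI hA₂m).trans_le b₂
  have b₃' : ∫⁻ w in scatter B α I ⁻¹' A₃, ρ w ∂μ ≤ ENNReal.ofReal (E₃ * a) :=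
    (lintegral_totalRate_scatter B hα hI hA₃m).trans_le b₃
  have hsub : (goodSet B α I η)ᶜ ⊆
      A₁ ∪ (A₂ ∪ (scatter B α I ⁻¹' A₂ ∪ (A₃ ∪ scatter B α I ⁻¹' A₃))) := by
    intro w hw
    by_contra hcon
    simp only [mem_union, not_or] at hcon
    obtain ⟨n1, n2, n2', n3, n3'⟩ := hcon
    refine hw ⟨?_, ⟨?_, ?_, ?_, ?_⟩, ?_, ?_⟩
    · by_contra h
      exact n1 (abs_normalVel_lt_of_not_impulse B hD hα hα1 hI (not_le.1 h))
    · exact not_lt.1 fun h => n2 (Or.inl h)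
    · exact not_lt.1 fun h => n2' (Or.inl h)
    · exact not_lt.1 fun h => n2 (Or.inr h)
    · exact not_lt.1 fun h => n2' (Or.inr h)
    · exact (not_le.1 fun h => n3 h).le
    · exact (not_le.1 fun h => n3' h).le
  have hGbound : ∫⁻ w in (goodSet B α I η)ᶜ, ρ w ∂μ ≤
      ENNReal.ofReal (E₁ * a) + (ENNReal.ofReal (E₂ * a) + (ENNReal.ofReal (E₂ * a) +
        (ENNReal.ofReal (E₃ * a) + ENNReal.ofReal (E₃ * a)))) := by
    refine (lintegral_mono_set hsub).trans ((lintegral_union_le _ _ _).trans ?_)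
    refine add_le_add b₁ ((lintegral_union_le _ _ _).trans ?_)
    refine add_le_add b₂ ((lintegral_union_le _ _ _).trans ?_)
    exact add_le_add b₂' ((lintegral_union_le _ _ _).trans (add_le_add b₃ b₃'))
  have hGm := measurableSet_goodSet B α I η
  have hRm := measurableSet_firstSet B α
  have hr := fun w => collisionRate_nonneg B hα hβ hI w
  have hi0 : ∀ (S : Set (Phase × ℝ × Plane)) w,
      0 ≤ S.indicator (1 : Phase × ℝ × Plane → ℝ) w := fun S w =>
    indicator_nonneg (fun _ _ => zero_le_one) _
  have hpoint : ∀ w, ENNReal.ofReal (((goodSet B α I η)ᶜ.indicator 1 w +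
      (firstSet B α)ᶜ.indicator 1 w) * collisionRate B α β I w) ≤
      (goodSet B α I η)ᶜ.indicator ρ w + A₄.indicator ρ w := by
    intro w
    have hle : ENNReal.ofReal (collisionRate B α β I w) ≤ ρ w :=
      ENNReal.ofReal_le_ofReal (collisionRate_le_totalRate B hα hβ hI w)
    rw [add_mul, ENNReal.ofReal_add (mul_nonneg (hi0 _ _) (hr w)) (mul_nonneg (hi0 _ _) (hr w))]
    refine add_le_add ?_ ?_
    · by_cases hw : w ∈ (goodSet B α I η)ᶜ
      · rw [indicator_of_mem hw, indicator_of_mem hw, Pi.one_apply, one_mul]; exact hle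
      · rw [indicator_of_notMem hw, zero_mul, ENNReal.ofReal_zero]; exact zero_le
    · by_cases hw : w ∈ (firstSet B α)ᶜ
      swap
      · rw [indicator_of_notMem hw, zero_mul, ENNReal.ofReal_zero]; exact zero_le
      by_cases hn : normalVel B α w < 0
      -- An incoming recollision must violate the criterion K|Ω| ≤ |v/α − V|; non-incoming
      -- configurations have zero rate.
      · have hw4 : w ∈ A₄ := by
          by_contra h4
          refine hw (hrec _ _ _ _ _ hn ?_)
          rw [norm_inv_smul_sub hα, le_inv_mul_iff₀ hα, ← mul_assoc]
          exact (not_le.1 fun h => h4 h).le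
        rw [indicator_of_mem hw, indicator_of_mem hw4, Pi.one_apply, one_mul]; exact hle
      · have : collisionRate B α β I w = 0 := by
          rw [collisionRate, max_eq_right (by linarith [not_lt.1 hn])]; simp
        rw [this, mul_zero, ENNReal.ofReal_zero]; exact zero_le
  have hρm : Measurable ρ := (measurable_totalRate B α β I).ennreal_ofReal
  have htot : ∫⁻ w, ENNReal.ofReal (((goodSet B α I η)ᶜ.indicator 1 w +
      (firstSet B α)ᶜ.indicator 1 w) * collisionRate B α β I w) ∂μ ≤
      ENNReal.ofReal ((E₁ + E₂ + E₂ + E₃ + E₃ + E₄) * a) := by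
    refine (lintegral_mono hpoint).trans ?_
    rw [lintegral_add_left (hρm.indicator hGm.compl), lintegral_indicator hGm.compl,
      lintegral_indicator hA₄m]
    refine (add_le_add hGbound b₄).trans_eq ?_
    rw [← ENNReal.ofReal_add (by positivity) (by positivity),
      ← ENNReal.ofReal_add (by positivity) (by positivity),
      ← ENNReal.ofReal_add (by positivity) (by positivity),
      ← ENNReal.ofReal_add (by positivity) (by positivity),
      ← ENNReal.ofReal_add (by positivity) (by positivity)]
    congr 1
    ring
  have hmeas : Measurable fun w => ((goodSet B α I η)ᶜ.indicator (1 : Phase × ℝ × Plane → ℝ) w +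
      (firstSet B α)ᶜ.indicator 1 w) * collisionRate B α β I w :=
    ((measurable_one.indicator hGm.compl).add (measurable_one.indicator hRm.compl)).mul
      (measurable_collisionRate B α β I)
  rw [truncationError, integral_eq_lintegral_of_nonneg_ae
    (Filter.Eventually.of_forall fun w => mul_nonneg (add_nonneg (hi0 _ _) (hi0 _ _)) (hr w))
    hmeas.aestronglyMeasurable]
  exact ENNReal.toReal_le_of_le_ofReal (by positivity) htot

end Error

/-! ### Smallness of α, the weighted L¹ norm and the conclusion. -/

/-- The exponent 1/3 − η is positive, so the power of α beats the logarithm. This fixes the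
threshold below which good collisions exclude recollisions. -/
theorem exists_mul_abs_log_le_rpow {K η : ℝ} (hη' : η < 1 / 6) :
    ∃ α₀ : ℝ, 0 < α₀ ∧ α₀ < 1 ∧ ∀ α, 0 < α → α ≤ α₀ → K * |Real.log α| ≤ α ^ (-(1 / 3) + η) := by
  have hr : 0 < 1 / 3 - η := by linarith
  have h := ((tendsto_log_mul_rpow_nhdsGT_zero hr).abs.const_mul K)
  rw [abs_zero, mul_zero] at h
  have h1 : ∀ᶠ x in nhdsWithin (0 : ℝ) (Ioi 0), K * |Real.log x * x ^ (1 / 3 - η)| < 1 :=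
    h.eventually_lt_const one_pos
  obtain ⟨b, hb, hbs⟩ := mem_nhdsGT_iff_exists_Ioo_subset.1 h1
  have hb0 : 0 < b := hb
  refine ⟨min (b / 2) (1 / 2), by positivity, (min_le_right _ _).trans_lt (by norm_num),
    fun α hα hα₀ => ?_⟩
  have h2 : K * |Real.log α * α ^ (1 / 3 - η)| < 1 :=
    hbs ⟨hα, by linarith [hα₀.trans (min_le_left _ _)]⟩
  have hp : 0 < α ^ (1 / 3 - η) := Real.rpow_pos_of_pos hα _
  rw [abs_mul, abs_of_pos hp, ← mul_assoc] at h2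
  rw [show -(1 / 3) + η = -(1 / 3 - η) by ring, Real.rpow_neg hα.le, ← one_div, le_div_iff₀ hp]
  exact h2.le

/-- The absolute value is the sum of the negative parts for c = 1 and c = −1, whence the factor 2.
-/
theorem eLpNorm_one_bodyMaxwellian_mul_le {β I : ℝ} (hβ : 0 < β) (hI : 0 < I) {f h : Phase → ℝ}
    {b : ℝ} (hb : 0 ≤ b)
    (hneg : ∀ c : ℝ, |c| = 1 →
      Integrable (fun Y => bodyMaxwellian β I Y * max (-(c * f Y + -c * h Y)) 0) ∧
      ∫ Y, bodyMaxwellian β I Y * max (-(c * f Y + -c * h Y)) 0 ≤ b) :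
    eLpNorm (fun Y => bodyMaxwellian β I Y * (f Y - h Y)) 1 volume ≤ ENNReal.ofReal (2 * b) := by
  have hm : ∀ Y, 0 ≤ bodyMaxwellian β I Y := fun Y => (bodyMaxwellian_pos hβ hI Y).le
  have key : ∀ c : ℝ, |c| = 1 →
      ∫⁻ Y, ENNReal.ofReal (bodyMaxwellian β I Y * max (-(c * f Y + -c * h Y)) 0) ≤
        ENNReal.ofReal b := fun c hc => by
    rw [← ofReal_integral_eq_lintegral_ofReal (hneg c hc).1
      (Filter.Eventually.of_forall fun Y => mul_nonneg (hm Y) (le_max_right _ _))]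
    exact ENNReal.ofReal_le_ofReal (hneg c hc).2
  have hsplit : ∀ Y, ‖bodyMaxwellian β I Y * (f Y - h Y)‖ₑ ≤
      ENNReal.ofReal (bodyMaxwellian β I Y * max (-(1 * f Y + -1 * h Y)) 0) +
      ENNReal.ofReal (bodyMaxwellian β I Y * max (-(-1 * f Y + -(-1) * h Y)) 0) := fun Y => by
    rw [← ENNReal.ofReal_add (mul_nonneg (hm Y) (le_max_right _ _))
      (mul_nonneg (hm Y) (le_max_right _ _)), ← mul_add, Real.enorm_eq_ofReal_abs, abs_mul,
      abs_of_nonneg (hm Y)]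
    refine ENNReal.ofReal_le_ofReal (mul_le_mul_of_nonneg_left ?_ (hm Y))
    have h1 := le_max_left (-(1 * f Y + -1 * h Y)) 0
    have h2 := le_max_left (-(-1 * f Y + -(-1) * h Y)) 0
    have h3 := le_max_right (-(1 * f Y + -1 * h Y)) 0
    have h4 := le_max_right (-(-1 * f Y + -(-1) * h Y)) 0
    exact abs_le.2 ⟨by linarith, by linarith⟩
  have hmeas : AEMeasurable fun Y =>
      ENNReal.ofReal (bodyMaxwellian β I Y * max (-(1 * f Y + -1 * h Y)) 0) :=
    (hneg 1 abs_one).1.aestronglyMeasurable.aemeasurable.ennreal_ofReal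
  rw [eLpNorm_one_eq_lintegral_enorm]
  refine (lintegral_mono hsplit).trans ?_
  rw [lintegral_add_left' hmeas, show 2 * b = b + b by ring, ENNReal.ofReal_add hb hb]
  exact add_le_add (key 1 abs_one) (key (-1) (by simp))

end RigidBodyGas


open RigidBodyGas

theorem mainTheorem6 (B : RigidBody) (β I η : ℝ) (hβ : 0 < β) (hI : 0 < I)
    (hη : 0 < η) (hη' : η < 1 / 6) (C : ℝ≥0) :
    ∃ α₀ : ℝ, 0 < α₀ ∧ α₀ < 1 ∧ ∃ (C₀ : ℝ) (C_T : ℝ → ℝ),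
      ∀ α ε : ℝ, 0 < α → α ≤ α₀ → 0 < ε →
      ∀ g₀ : Phase → ℝ, IsInitialDatum β I C g₀ →
      ∀ g gTrunc : ℝ → Phase → ℝ,
        IsMildSolution α ε β I (boltzmannOp B α β I) g₀ g →
        IsMildSolution α ε β I (truncatedBoltzmannOp B α β I η) g₀ gTrunc →
        (∀ t : ℝ, 0 ≤ t → eLpNorm (gTrunc t) ∞ volume ≤ ENNReal.ofReal C₀) ∧
        ∀ T : ℝ, 0 ≤ T → ∀ t ∈ Icc 0 T,
          eLpNorm (fun Y => bodyMaxwellian β I Y * (g t Y - gTrunc t Y)) 1 volume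
            ≤ ENNReal.ofReal (C_T T * α ^ (2 * η)) := by
  obtain ⟨K, hK0, hK⟩ := exists_noBackwardRecollision B
  obtain ⟨E, hE0, hE⟩ := exists_truncationError_le B hβ hI hη hη' hK0
  obtain ⟨α₀, hα₀, hα₀1, hsmall⟩ := exists_mul_abs_log_le_rpow (K := K) hη'
  -- The maximum principle loses nothing, so the bound on the data is the uniform bound. The second
  -- constant is the two signs times C, the duration and the mass constant `E`.
  refine ⟨α₀, hα₀, hα₀1, C, fun T => 2 * (C * (T * E)), ?_⟩
  intro α ε hα hαα₀ _ g₀ hg₀ g gTrunc hg hgt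
  have hα1 : α ≤ 1 := hαα₀.trans hα₀1.le
  have hex : ExcludesRecollision B α η :=
    excludesRecollision B hK0 (hK α hα hα1) hα (hsmall α hα hαα₀)
  have hg₀m : Measurable g₀ := hg₀.lipschitz.continuous.measurable
  have hbd : ∀ t, 0 ≤ t → ∀ᵐ Y, |gTrunc t Y| ≤ C := fun t ht => by
    filter_upwards [hgt.nonneg_const_add B hα hβ hI hex hg₀m C.coe_nonneg hg₀.bounded abs_one ht,
      hgt.nonneg_const_add B hα hβ hI hex hg₀m C.coe_nonneg hg₀.bounded (c := -1) (by simp) ht]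
      with Y h1 h2
    exact abs_le.2 ⟨by linarith, by linarith⟩
  refine ⟨fun t ht => ?_, fun T _ t ht => ?_⟩
  · rw [eLpNorm_exponent_top]
    exact eLpNormEssSup_le_of_ae_bound (hbd t ht)
  · have ha : 0 ≤ α ^ (2 * η) := (Real.rpow_pos_of_pos hα _).le
    have hb : C * (t * truncationError B α β I η) ≤ C * (T * (E * α ^ (2 * η))) := by
      have h1 := hE α hα hα1 (hK α hα hα1)
      refine mul_le_mul_of_nonneg_left ?_ C.coe_nonneg
      exact (mul_le_mul_of_nonneg_left h1 ht.1).trans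
        (mul_le_mul_of_nonneg_right ht.2 (mul_nonneg hE0 ha))
    have hb0 : 0 ≤ C * (T * (E * α ^ (2 * η))) :=
      mul_nonneg C.coe_nonneg (mul_nonneg (ht.1.trans ht.2) (mul_nonneg hE0 ha))
    refine (eLpNorm_one_bodyMaxwellian_mul_le hβ hI hb0 fun c hc => ?_).trans_eq ?_
    · obtain ⟨h1, h2⟩ := integral_negPart_sub_le B hg hgt hα hβ hI hg₀m hc hbd ht.1
      exact ⟨h1, h2.trans hb⟩
    · congr 1
      ring
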